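/- A rational Diophantine triple is a set $\{a,b,c\}$ of three distinct non-zero rational numbers such that $ab+1$, $ac+1$, $bc+1$ are squares of rational numbers. It induces the elliptic curve $E_{a,b,c}: y^2=(ax+1)(bx+1)(cx+1)$ over $\mathbb{Q}$, which has the equivalent form $Y^2=(X+ab)(X+ac)(X+bc)$. There exist rational Diophantine triples with all elements positive inducing curves with torsion group $\mathbb{Z}/2\mathbb{Z}\times\mathbb{Z}/8\mathbb{Z}$. More precisely, for $w\in\mathbb{Q}$ put $$a(w)=\frac{2(2w^4+4w^3+2w^2+1)(1+2w)}{w(2w+2w^2-1)(2+w)(w-1)(w+1)},\quad b(w)=-\frac{2(w+1)^2(w-1)^2}{(2+w)(2w+2w^2-1)w},\quad c(w)=\frac{2w^2(2+w)^2}{(2w+2w^2-1)(w-1)(w+1)}.$$ Then the following hold. (1) If $w\notin\{0,1,-1,-2,-\tfrac12\}$, then $\{a(w),b(w),c(w)\}$ is a rational Diophantine triple. If $w\notin\{0,1,-1,-2\}$ and $2w^4+4w^3+2w^2+1$ is a square in $\mathbb{Q}$, then the group of rational points of the curve induced by this triple contains a subgroup isomorphic to $\mathbb{Z}/2\mathbb{Z}\times\mathbb{Z}/8\mathbb{Z}$.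 (2) The curve $F: Y^2=X^3-X^2-9X+9$ is an elliptic curve of rank $1$ over $\mathbb{Q}$, and $P=[0,3]$ generates $F(\mathbb{Q})$ modulo torsion. The formulas $w=\frac{2(X+1)}{Y-4}$, $s=\frac{w^2(X-1)}{2}-1$ (continued to the point at infinity by $(w,s)=(0,1)$, and to the point $[-1,4]$ by $w=-4$) define a bijection from $F(\mathbb{Q})$ to the set of rational points of the quartic $s^2=2w^4+4w^3+2w^2+1$. (3) One has $3P=\left[-\frac{360}{169},-\frac{8211}{2197}\right]$, which corresponds to $w=\frac{26}{89}$ and gives the triple $$\{a,b,c\}=\left\{\frac{37471518967}{1381254420},\ \frac{5832225}{571948},\ \frac{6251648}{1562505}\right\}.$$ This is a rational Diophantine triple with positive elements. The curve it induces has torsion group $\mathbb{Z}/2\mathbb{Z}\times\mathbb{Z}/8\mathbb{Z}$ and rank exactly $1$, and the point $[0,abc]$ on $Y^2=(X+ab)(X+ac)(X+bc)$ is of infinite order. (4) For $n=3,5,8$, the triple given by the value of $w$ at $nP$ becomes, possibly after changing the signs of all three elements simultaneously (which does not change the curve $Y^2=(X+ab)(X+ac)(X+bc)$), a rational Diophantine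 triple with all elements positive, which induces a curve with torsion group $\mathbb{Z}/2\mathbb{Z}\times\mathbb{Z}/8\mathbb{Z}$ on which the point $[0,abc]$ is of infinite order, so the rank is positive. (5) An infinite family of such curves arises in this way: among the triples $\{a,b,c\}=\{a(w),b(w),c(w)\}$ with $w$ the value at $nP$, $n\in\mathbb{N}$, those which are rational Diophantine triples with all elements positive, induce a curve with torsion group $\mathbb{Z}/2\mathbb{Z}\times\mathbb{Z}/8\mathbb{Z}$ and positive rank, and have $[0,abc]$ of infinite order on it, give curves with infinitely many different $j$-invariants. -/

import Mathlib

/-- `{a, b, c}` is a rational Diophantine triple: three distinct non-zero rationals such that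
the product of any two of them, increased by `1`, is a perfect square. -/
structure IsDiophantineTriple (a b c : ℚ) : Prop where
  a_ne : a ≠ 0
  b_ne : b ≠ 0
  c_ne : c ≠ 0
  ab_ne : a ≠ b
  ac_ne : a ≠ c
  bc_ne : b ≠ c
  ab_sq : IsSquare (a * b + 1)
  ac_sq : IsSquare (a * c + 1)
  bc_sq : IsSquare (b * c + 1)

/-- The curve induced by `{a, b, c}`, namely `y² = (a x + 1) (b x + 1) (c x + 1)`, in the
Weierstrass form `Y² = (X + a b) (X + a c) (X + b c)` obtained by the change of coordinates
`X = a b c x`, `Y = a b c y`. -/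
def inducedCurve (a b c : ℚ) : WeierstrassCurve ℚ where
  a₁ := 0
  a₂ := a * b + a * c + b * c
  a₃ := 0
  a₄ := a * b * c * (a + b + c)
  a₆ := (a * b * c) ^ 2

theorem inducedCurve_equation_iff (a b c X Y : ℚ) :
    (inducedCurve a b c).toAffine.Equation X Y ↔
      Y ^ 2 = (X + a * b) * (X + a * c) * (X + b * c) := by
  rw [WeierstrassCurve.Affine.equation_iff]
  simp only [inducedCurve]
  constructor <;> intro h <;> linear_combination h

theorem inducedCurve_equation_scale_iff {a b c : ℚ} (h : IsDiophantineTriple a b c) (x y : ℚ) :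
    (inducedCurve a b c).toAffine.Equation (a * b * c * x) (a * b * c * y) ↔
      y ^ 2 = (a * x + 1) * (b * x + 1) * (c * x + 1) := by
  have h0 : (a * b * c) ^ 2 ≠ 0 :=
    pow_ne_zero 2 (mul_ne_zero (mul_ne_zero h.a_ne h.b_ne) h.c_ne)
  rw [inducedCurve_equation_iff]
  constructor
  · intro e
    apply mul_left_cancel₀ h0
    linear_combination e
  · intro e
    linear_combination (a * b * c) ^ 2 * e

theorem inducedCurve_isElliptic {a b c : ℚ} (h : IsDiophantineTriple a b c) :
    (inducedCurve a b c).IsElliptic := by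
  have hd : (inducedCurve a b c).Δ =
      16 * (a * b * c * (a - b) * (a - c) * (b - c)) ^ 2 := by
    simp only [inducedCurve, WeierstrassCurve.Δ, WeierstrassCurve.b₂, WeierstrassCurve.b₄,
      WeierstrassCurve.b₆, WeierstrassCurve.b₈]
    ring
  refine ⟨?_⟩
  rw [hd, isUnit_iff_ne_zero]
  have h1 := sub_ne_zero.2 h.ab_ne
  have h2 := sub_ne_zero.2 h.ac_ne
  have h3 := sub_ne_zero.2 h.bc_ne
  have h4 := h.a_ne
  have h5 := h.b_ne
  have h6 := h.c_ne
  positivity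

/-- The rank of the group of rational points (as a cardinal, so that there is no convention for
groups that are not finitely generated). -/
noncomputable def rationalRank (W : WeierstrassCurve ℚ) : Cardinal :=
  Module.rank ℤ W.toAffine.Point

/-- The torsion subgroup of the group of rational points is isomorphic to `ℤ/2 × ℤ/8`. -/
def HasTorsionTwoEight (W : WeierstrassCurve ℚ) : Prop :=
  Nonempty (AddCommGroup.torsion W.toAffine.Point ≃+ ZMod 2 × ZMod 8)

/-- The point `(0, abc)` of `inducedCurve a b c`, that is the point `(0, 1)` of
`y² = (a x + 1) (b x + 1) (c x + 1)`, has infinite order. -/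
def BasePointHasInfiniteOrder (a b c : ℚ) : Prop :=
  ∃ h : (inducedCurve a b c).toAffine.Nonsingular 0 (a * b * c),
    ¬ IsOfFinAddOrder (WeierstrassCurve.Affine.Point.some 0 (a * b * c) h)

/-- `{a, b, c}` is a rational Diophantine triple with positive elements, and the curve which it
induces has torsion group `ℤ/2 × ℤ/8` and positive rank, `(0, abc)` being of infinite order. -/
structure IsPositiveTwoEightTriple (a b c : ℚ) : Prop where
  triple : IsDiophantineTriple a b c
  a_pos : 0 < a
  b_pos : 0 < b
  c_pos : 0 < c
  torsion : HasTorsionTwoEight (inducedCurve a b c)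
  infinite_order : BasePointHasInfiniteOrder a b c
  rank_pos : 1 ≤ rationalRank (inducedCurve a b c)

/-- The quartic polynomial `2 w⁴ + 4 w³ + 2 w² + 1`. -/
def quartic (w : ℚ) : ℚ := 2 * w ^ 4 + 4 * w ^ 3 + 2 * w ^ 2 + 1

/-- First element of the family of triples. -/
def famA (w : ℚ) : ℚ :=
  2 * (2 * w ^ 4 + 4 * w ^ 3 + 2 * w ^ 2 + 1) * (1 + 2 * w) /
    (w * (2 * w + 2 * w ^ 2 - 1) * (2 + w) * (w - 1) * (w + 1))

/-- Second element of the family of triples. -/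
def famB (w : ℚ) : ℚ :=
  -(2 * (w + 1) ^ 2 * (w - 1) ^ 2 / ((2 + w) * (2 * w + 2 * w ^ 2 - 1) * w))

/-- Third element of the family of triples. -/
def famC (w : ℚ) : ℚ :=
  2 * w ^ 2 * (2 + w) ^ 2 / ((2 * w + 2 * w ^ 2 - 1) * (w - 1) * (w + 1))

/-- The elliptic curve `Y² = X³ - X² - 9 X + 9`. -/
def auxCurve : WeierstrassCurve ℚ where
  a₁ := 0
  a₂ := -1
  a₃ := 0
  a₄ := -9
  a₆ := 9

theorem auxCurve_nonsingular : auxCurve.toAffine.Nonsingular 0 3 := by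
  rw [WeierstrassCurve.Affine.nonsingular_iff, WeierstrassCurve.Affine.equation_iff]
  norm_num [auxCurve]

/-- The point `P = (0, 3)` of `auxCurve`. -/
def auxP : auxCurve.toAffine.Point := .some 0 3 auxCurve_nonsingular

/-- The function `w = 2 (X + 1) / (Y - 4)` on the rational points of `auxCurve`. It is regular at
the point at infinity, where its value is `0`, and, being equal to
`2 (Y + 4) / (X² - 2 X - 7)`, at the point `(-1, 4)`, where its value is `-4`; this is the only
rational point with `Y = 4`. -/
def wCoord : auxCurve.toAffine.Point → ℚ
  | .zero => 0
  | .some x y _ => if y = 4 then -4 else 2 * (x + 1) / (y - 4)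

/-- The function `s = w² (X - 1) / 2 - 1` on the rational points of `auxCurve`. It is regular at
the point at infinity, where its value is `1`. -/
def sCoord : auxCurve.toAffine.Point → ℚ
  | .zero => 1
  | .some x y h => wCoord (.some x y h) ^ 2 * (x - 1) / 2 - 1

/-! Put u = 1 - w² and v = w² + 2w. Then u² + uv + v² = (w² + w + 1)², and because this is a square
the induced curve is isomorphic over ℚ to y² = x(x + u⁴)(x + v⁴) (`exists_equiv_legCurve`). Moreover
u² + v² is the quartic in w. When it is a square t², the point (0, 0) can be halved twice over ℚ,
which produces a point R of order 8 (`legCurve_exists_order_eight`). Together with T = (-u⁴, 0) it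
generates ℤ/2 × ℤ/8.

The 2-primary torsion is no larger: modulo squares, x is a homomorphism taking T to -1 and R to 2uv,
so none of T, R, R + T is a double once ±2uv are non-squares. The point [0, abc] goes to the class
uv, which no torsion point has when ±uv are non-squares, so it has infinite order
(`legCurve_torsion`). Odd torsion is excluded by following the 2-adic valuation n of x under
doubling, where k is the valuation of v. Negative n decreases for ever, which means infinite order;
n = 0 and n ≥ 4k lead there; n = 2k leads to n ≥ 4k; n = 2 is impossible modulo 8; all other n move
by explicit affine rules. For k = 3 and k = 5 every orbit ends in an excluded value. For k = 4 there
is one fixed point, n = 10, which is removed by looking at 3P (`HasOddOrder.eq_zero_of_four`).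

The ranks are bounded by complete 2-descent. Three sign or valuation-parity characters are dual to
three points in ⟨torsion, B⟩ for a single point B, and a point killed by all of them is a double:
its values x - eᵢ are squares by local conditions at the bad primes. Hence ⟨torsion, B⟩ covers the
group modulo 2. Finite generation comes from the naive height, and Nakayama's lemma then gives odd
exponent of the quotient (`IsSplit.exists_odd_smul_mem_of_descent`). For `auxCurve` the odd exponent
is removed as well: a point with an odd multiple equal to P must be integral and lie on the bounded
real component, which leaves a finite list (`auxCurve_eq_of_odd_zsmul`).

For the infinite family, the conditions met by w = 26/89 are open: positivity in the real topology,
the torsion and infinite order statements in the 2-adic one. Some multiples of P are simultaneously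
close to the origin in both, and adding them to 3P gives infinitely many n (`exists_wCoord_near`,
`fam_of_near`). A given j-invariant is the root condition of a non-zero polynomial in w, so it
occurs for finitely many n only. -/

open WeierstrassCurve WeierstrassCurve.Affine

/-! ### Curves with full rational 2-torsion: chords, tangents, halving. -/

/-- `W` is the elliptic curve `y² = (x - e₁) (x - e₂) (x - e₃)` with distinct rational `eᵢ`. -/
structure IsSplit (W : WeierstrassCurve ℚ) (e₁ e₂ e₃ : ℚ) : Prop where
  a₁ : W.a₁ = 0
  a₂ : W.a₂ = -(e₁ + e₂ + e₃)
  a₃ : W.a₃ = 0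
  a₄ : W.a₄ = e₁ * e₂ + e₁ * e₃ + e₂ * e₃
  a₆ : W.a₆ = -(e₁ * e₂ * e₃)
  ne₁₂ : e₁ ≠ e₂
  ne₁₃ : e₁ ≠ e₃
  ne₂₃ : e₂ ≠ e₃

namespace IsSplit

variable {W : WeierstrassCurve ℚ} {e₁ e₂ e₃ : ℚ}

theorem swap₁₂ (h : IsSplit W e₁ e₂ e₃) : IsSplit W e₂ e₁ e₃ :=
  ⟨h.a₁, by rw [h.a₂]; ring, h.a₃, by rw [h.a₄]; ring, by rw [h.a₆]; ring, h.ne₁₂.symm, h.ne₂₃,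
    h.ne₁₃⟩

theorem swap₂₃ (h : IsSplit W e₁ e₂ e₃) : IsSplit W e₁ e₃ e₂ :=
  ⟨h.a₁, by rw [h.a₂]; ring, h.a₃, by rw [h.a₄]; ring, by rw [h.a₆]; ring, h.ne₁₃, h.ne₁₂,
    h.ne₂₃.symm⟩

theorem rotate (h : IsSplit W e₁ e₂ e₃) : IsSplit W e₃ e₁ e₂ := h.swap₂₃.swap₁₂

theorem toAffine_a₁ (h : IsSplit W e₁ e₂ e₃) : W.toAffine.a₁ = 0 := h.a₁

theorem toAffine_a₂ (h : IsSplit W e₁ e₂ e₃) : W.toAffine.a₂ = -(e₁ + e₂ + e₃) := h.a₂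

theorem toAffine_a₃ (h : IsSplit W e₁ e₂ e₃) : W.toAffine.a₃ = 0 := h.a₃

theorem disc (h : IsSplit W e₁ e₂ e₃) :
    W.Δ = 16 * ((e₁ - e₂) * (e₁ - e₃) * (e₂ - e₃)) ^ 2 := by
  simp only [WeierstrassCurve.Δ, WeierstrassCurve.b₂, WeierstrassCurve.b₄,
      WeierstrassCurve.b₆, WeierstrassCurve.b₈, h.a₁, h.a₂, h.a₃, h.a₄, h.a₆]
  ring

theorem disc_ne_zero (h : IsSplit W e₁ e₂ e₃) : W.Δ ≠ 0 := by
  have h1 := sub_ne_zero.2 h.ne₁₂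
  have h2 := sub_ne_zero.2 h.ne₁₃
  have h3 := sub_ne_zero.2 h.ne₂₃
  rw [h.disc]
  positivity

theorem isElliptic (h : IsSplit W e₁ e₂ e₃) : W.IsElliptic :=
  ⟨isUnit_iff_ne_zero.2 h.disc_ne_zero⟩

theorem equation_iff (h : IsSplit W e₁ e₂ e₃) {x y : ℚ} :
    W.toAffine.Equation x y ↔ y ^ 2 = (x - e₁) * (x - e₂) * (x - e₃) := by
  rw [WeierstrassCurve.Affine.equation_iff, h.a₁, h.a₂, h.a₃, h.a₄, h.a₆]
  constructor <;> intro H <;> linear_combination H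

theorem nonsingular_iff (h : IsSplit W e₁ e₂ e₃) {x y : ℚ} :
    W.toAffine.Nonsingular x y ↔ y ^ 2 = (x - e₁) * (x - e₂) * (x - e₃) := by
  rw [← h.equation_iff, equation_iff_nonsingular_of_Δ_ne_zero h.disc_ne_zero]

theorem negY_eq (h : IsSplit W e₁ e₂ e₃) (x y : ℚ) : W.toAffine.negY x y = -y := by
  simp [negY, h.a₁, h.a₃]

theorem neg_some (h : IsSplit W e₁ e₂ e₃) {x y : ℚ} (hp : W.toAffine.Nonsingular x y) :
    ∃ hn, -Point.some x y hp = Point.some x (-y) hn := by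
  refine ⟨?_, ?_⟩
  · rw [h.nonsingular_iff] at hp ⊢
    rw [← hp]; ring
  · rw [Point.neg_some]
    simp [h.toAffine_a₁, h.toAffine_a₃]

theorem add_eq_zero (h : IsSplit W e₁ e₂ e₃) {x₁ y₁ x₂ y₂ : ℚ}
    (h₁ : W.toAffine.Nonsingular x₁ y₁) (h₂ : W.toAffine.Nonsingular x₂ y₂)
    (hx : x₁ = x₂) (hy : y₁ = -y₂) : Point.some x₁ y₁ h₁ + Point.some x₂ y₂ h₂ = 0 :=
  Point.add_of_Y_eq hx (by rw [h.negY_eq, hy])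

/-- The chord and tangent construction. -/
theorem add_spec (h : IsSplit W e₁ e₂ e₃) {x₁ y₁ x₂ y₂ : ℚ}
    (h₁ : W.toAffine.Nonsingular x₁ y₁) (h₂ : W.toAffine.Nonsingular x₂ y₂)
    (hxy : ¬(x₁ = x₂ ∧ y₁ = -y₂)) :
    ∃ l x₃ y₃ h₃, Point.some x₁ y₁ h₁ + Point.some x₂ y₂ h₂ = Point.some x₃ y₃ h₃ ∧
      (∀ X, (X - e₁) * (X - e₂) * (X - e₃) - (l * (X - x₁) + y₁) ^ 2 =
        (X - x₁) * (X - x₂) * (X - x₃)) ∧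
      y₃ = -(l * (x₃ - x₁) + y₁) ∧ (x₁ ≠ x₂ → l * (x₁ - x₂) = y₁ - y₂) ∧
      (x₁ = x₂ → y₁ = y₂) := by
  have hxy' : ¬(x₁ = x₂ ∧ y₁ = W.toAffine.negY x₂ y₂) := by rwa [h.negY_eq]
  refine ⟨W.toAffine.slope x₁ x₂ y₁ y₂, _, _, nonsingular_add h₁ h₂ hxy',
    Point.add_some hxy', ?_, ?_, ?_, ?_⟩
  · intro X
    have H := congrArg (Polynomial.eval X) (addPolynomial_slope h₁.1 h₂.1 hxy')
    rw [addPolynomial_eq] at H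
    simp only [Cubic.toPoly, h.a₁, h.a₂, h.a₃, h.a₄, h.a₆] at H
    simp only [addX] at H ⊢
    simp [h.toAffine_a₁, h.toAffine_a₂] at H ⊢
    linear_combination -H
  · simp only [addY, negAddY, h.negY_eq]
  · intro hx
    rw [slope_of_X_ne hx]
    field_simp [sub_ne_zero.2 hx]
  · intro hx
    rcases Y_eq_of_X_eq h₁.1 h₂.1 hx with H | H
    · exact H
    · rw [h.negY_eq] at H
      exact absurd ⟨hx, H⟩ hxy

theorem add_some_ne_zero (h : IsSplit W e₁ e₂ e₃) {x₁ y₁ x₂ y₂ : ℚ}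
    (h₁ : W.toAffine.Nonsingular x₁ y₁) (h₂ : W.toAffine.Nonsingular x₂ y₂)
    (hxy : ¬(x₁ = x₂ ∧ y₁ = -y₂)) : Point.some x₁ y₁ h₁ + Point.some x₂ y₂ h₂ ≠ 0 := by
  obtain ⟨l, x₃, y₃, h₃, H, -⟩ := h.add_spec h₁ h₂ hxy
  rw [H]
  exact Point.some_ne_zero _

theorem two_smul_eq_zero_iff (h : IsSplit W e₁ e₂ e₃) {x y : ℚ}
    (hp : W.toAffine.Nonsingular x y) : 2 • Point.some x y hp = 0 ↔ y = 0 := by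
  rw [two_nsmul]
  constructor
  · intro H
    by_contra hy
    refine h.add_some_ne_zero hp hp ?_ H
    rintro ⟨-, H⟩
    exact hy (by linarith)
  · rintro rfl
    exact h.add_eq_zero hp hp rfl (by simp)

theorem slope_self (h : IsSplit W e₁ e₂ e₃) {l x y x₃ : ℚ}
    (H : ∀ X, (X - e₁) * (X - e₂) * (X - e₃) - (l * (X - x) + y) ^ 2 =
        (X - x) * (X - x) * (X - x₃)) :
    2 * y * l = (x - e₁) * (x - e₂) + (x - e₁) * (x - e₃) + (x - e₂) * (x - e₃) ∧
      x₃ = l ^ 2 + e₁ + e₂ + e₃ - 2 * x := by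
  have _ := h
  constructor
  -- Central differences at x ± 1 and x ± 2 extract the coefficient of X - x from the cubic
  -- identity; the second difference in the next bullet extracts that of (X - x)².
  · linear_combination (-1 / 2) * H (x + 1) + (1 / 2) * H (x - 1) + (1 / 6) * (H (x + 2) - 2 * H (x + 1) + 2 * H (x - 1) - H (x - 2)) / 2
  · linear_combination (1 / 2) * (H (x + 1) - 2 * H x + H (x - 1))

/-- The duplication formula. -/
theorem two_smul_spec (h : IsSplit W e₁ e₂ e₃) {x y : ℚ}
    (hp : W.toAffine.Nonsingular x y) (hy : y ≠ 0) :
    ∃ x' y' h', 2 • Point.some x y hp = Point.some x' y' h' ∧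
      (x' - e₁) * (2 * y) ^ 2 = ((x - e₁) ^ 2 - (e₁ - e₂) * (e₁ - e₃)) ^ 2 ∧
      (x' - e₂) * (2 * y) ^ 2 = ((x - e₂) ^ 2 - (e₂ - e₁) * (e₂ - e₃)) ^ 2 ∧
      (x' - e₃) * (2 * y) ^ 2 = ((x - e₃) ^ 2 - (e₃ - e₁) * (e₃ - e₂)) ^ 2 := by
  obtain ⟨l, x₃, y₃, h₃, H, H1, -⟩ := h.add_spec hp hp (fun H => hy (by linarith [H.2]))
  obtain ⟨hl, hx⟩ := h.slope_self H1
  have hE := h.nonsingular_iff.1 hp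
  refine ⟨x₃, y₃, h₃, by rw [two_nsmul, H], ?_, ?_, ?_⟩ <;> subst hx
  · linear_combination (2 * y * l + ((x - e₁) * (x - e₂) + (x - e₁) * (x - e₃) + (x - e₂) * (x - e₃))) * hl + 4 * (e₂ + e₃ - 2 * x) * hE
  · linear_combination (2 * y * l + ((x - e₁) * (x - e₂) + (x - e₁) * (x - e₃) + (x - e₂) * (x - e₃))) * hl + 4 * (e₁ + e₃ - 2 * x) * hE
  · linear_combination (2 * y * l + ((x - e₁) * (x - e₂) + (x - e₁) * (x - e₃) + (x - e₂) * (x - e₃))) * hl + 4 * (e₂ + e₁ - 2 * x) * hE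

/-- Halving a point. -/
theorem exists_half (h : IsSplit W e₁ e₂ e₃) {x r₁ r₂ r₃ : ℚ} (h₁ : x - e₁ = r₁ ^ 2)
    (h₂ : x - e₂ = r₂ ^ 2) (h₃ : x - e₃ = r₃ ^ 2)
    (hp : W.toAffine.Nonsingular x (r₁ * r₂ * r₃)) :
    ∃ hq, 2 • Point.some (x + r₁ * r₂ + r₁ * r₃ + r₂ * r₃)
      ((r₁ + r₂) * (r₁ + r₃) * (r₂ + r₃)) hq = Point.some x (r₁ * r₂ * r₃) hp := by
  have hq : W.toAffine.Nonsingular (x + r₁ * r₂ + r₁ * r₃ + r₂ * r₃)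
      ((r₁ + r₂) * (r₁ + r₃) * (r₂ + r₃)) := by
    rw [h.nonsingular_iff]
    obtain rfl : e₁ = x - r₁ ^ 2 := by linear_combination -h₁
    obtain rfl : e₂ = x - r₂ ^ 2 := by linear_combination -h₂
    obtain rfl : e₃ = x - r₃ ^ 2 := by linear_combination -h₃
    ring
  refine ⟨hq, ?_⟩
  have n₁₂ : r₁ + r₂ ≠ 0 := fun H => h.ne₁₂ (by linear_combination h₂ - h₁ + (r₂ - r₁) * H)
  have n₁₃ : r₁ + r₃ ≠ 0 := fun H => h.ne₁₃ (by linear_combination h₃ - h₁ + (r₃ - r₁) * H)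
  have n₂₃ : r₂ + r₃ ≠ 0 := fun H => h.ne₂₃ (by linear_combination h₃ - h₂ + (r₃ - r₂) * H)
  have hy : (r₁ + r₂) * (r₁ + r₃) * (r₂ + r₃) ≠ 0 := mul_ne_zero (mul_ne_zero n₁₂ n₁₃) n₂₃
  obtain ⟨l, x₃, y₃, h₃', H, H1, H2, -⟩ := h.add_spec hq hq (fun H => hy (by linarith [H.2]))
  obtain ⟨hl, hx⟩ := h.slope_self H1
  -- The tangent at the half point has slope r₁ + r₂ + r₃, and this determines the double.
  have hl' : l = r₁ + r₂ + r₃ := by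
    apply mul_left_cancel₀ (mul_ne_zero two_ne_zero hy)
    rw [hl]
    obtain rfl : e₁ = x - r₁ ^ 2 := by linear_combination -h₁
    obtain rfl : e₂ = x - r₂ ^ 2 := by linear_combination -h₂
    obtain rfl : e₃ = x - r₃ ^ 2 := by linear_combination -h₃
    ring
  have hx' : x₃ = x := by
    rw [hx, hl']; linear_combination -h₁ - h₂ - h₃
  have hy' : y₃ = r₁ * r₂ * r₃ := by
    rw [H2, hx', hl']; ring
  rw [two_nsmul, H]
  subst hx' hy'
  rfl

/-- The equation gives y = ±r₁r₂r₃, and the sign of r₃ is free, so `exists_half` applies in either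
case. -/
theorem exists_half_of_isSquare (h : IsSplit W e₁ e₂ e₃) {x y : ℚ}
    (hp : W.toAffine.Nonsingular x y) (h₁ : IsSquare (x - e₁)) (h₂ : IsSquare (x - e₂))
    (h₃ : IsSquare (x - e₃)) : ∃ Q, 2 • Q = Point.some x y hp := by
  obtain ⟨r₁, h₁⟩ := h₁
  obtain ⟨r₂, h₂⟩ := h₂
  obtain ⟨r₃, h₃⟩ := h₃
  have hE := h.nonsingular_iff.1 hp
  rw [h₁, h₂, h₃] at hE
  have : (y - r₁ * r₂ * r₃) * (y - r₁ * r₂ * (-r₃)) = 0 := by linear_combination hE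
  rcases mul_eq_zero.1 this with H | H
  · obtain rfl := sub_eq_zero.1 H
    obtain ⟨hq, H⟩ := h.exists_half (by rw [h₁]; ring) (by rw [h₂]; ring) (by rw [h₃]; ring) hp
    exact ⟨_, H⟩
  · obtain rfl := sub_eq_zero.1 H
    obtain ⟨hq, H⟩ := h.exists_half (by rw [h₁]; ring) (by rw [h₂]; ring) (by rw [h₃]; ring) hp
    exact ⟨_, H⟩

end IsSplit

/-! ### The 2-descent homomorphism modulo squares. -/

/-- The descent map attached to the root `e₁`, before reduction modulo squares. -/
def descentMap (e₁ e₂ e₃ : ℚ) {W : WeierstrassCurve ℚ} : W.toAffine.Point → ℚ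
  | .zero => 1
  | .some x _ _ => if x = e₁ then (e₁ - e₂) * (e₁ - e₃) else x - e₁

namespace IsSplit

variable {W : WeierstrassCurve ℚ} {e₁ e₂ e₃ : ℚ}

theorem descentMap_zero : descentMap e₁ e₂ e₃ (0 : W.toAffine.Point) = 1 := rfl

theorem descentMap_of_ne {x y : ℚ} (hp : W.toAffine.Nonsingular x y) (hx : x ≠ e₁) :
    descentMap e₁ e₂ e₃ (Point.some x y hp) = x - e₁ := if_neg hx

theorem descentMap_of_eq {x y : ℚ} (hp : W.toAffine.Nonsingular x y) (hx : x = e₁) :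
    descentMap e₁ e₂ e₃ (Point.some x y hp) = (e₁ - e₂) * (e₁ - e₃) := if_pos hx

theorem descentMap_ne_zero (h : IsSplit W e₁ e₂ e₃) (P : W.toAffine.Point) :
    descentMap e₁ e₂ e₃ P ≠ 0 := by
  rcases P with _ | ⟨x, y, hp⟩
  · exact one_ne_zero
  · by_cases hx : x = e₁
    · rw [descentMap_of_eq hp hx]
      exact mul_ne_zero (sub_ne_zero.2 h.ne₁₂) (sub_ne_zero.2 h.ne₁₃)
    · rw [descentMap_of_ne hp hx]
      exact sub_ne_zero.2 hx

/-- The descent map is a homomorphism modulo squares. -/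
theorem descentMap_add (h : IsSplit W e₁ e₂ e₃) (P Q : W.toAffine.Point) :
    ∃ r : ℚ, r ≠ 0 ∧
      descentMap e₁ e₂ e₃ (P + Q) = descentMap e₁ e₂ e₃ P * descentMap e₁ e₂ e₃ Q * r ^ 2 := by
  suffices H : IsSquare (descentMap e₁ e₂ e₃ (P + Q) *
      (descentMap e₁ e₂ e₃ P * descentMap e₁ e₂ e₃ Q)) by
    have hP := h.descentMap_ne_zero P
    have hQ := h.descentMap_ne_zero Q
    have hR := h.descentMap_ne_zero (P + Q)
    obtain ⟨s, hs⟩ := H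
    have hs0 : s ≠ 0 := by
      rintro rfl
      rw [mul_zero] at hs
      exact mul_ne_zero hR (mul_ne_zero hP hQ) hs
    refine ⟨s / (descentMap e₁ e₂ e₃ P * descentMap e₁ e₂ e₃ Q), by positivity, ?_⟩
    field_simp
    linear_combination hs
  rcases P with _ | ⟨x₁, y₁, h₁⟩
  · exact ⟨descentMap e₁ e₂ e₃ Q, by
      rw [← Point.zero_def, zero_add, descentMap_zero, one_mul]⟩
  rcases Q with _ | ⟨x₂, y₂, h₂⟩
  · exact ⟨descentMap e₁ e₂ e₃ (Point.some x₁ y₁ h₁), by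
      rw [← Point.zero_def, add_zero, descentMap_zero, mul_one]⟩
  by_cases hxy : x₁ = x₂ ∧ y₁ = -y₂
  · rw [h.add_eq_zero h₁ h₂ hxy.1 hxy.2, descentMap_zero, one_mul]
    obtain ⟨rfl, -⟩ := hxy
    exact ⟨_, rfl⟩
  obtain ⟨l, x₃, y₃, h₃, H, H1, H2, -⟩ := h.add_spec h₁ h₂ hxy
  rw [H]
  have hE₁ := h.nonsingular_iff.1 h₁
  have hE₂ := h.nonsingular_iff.1 h₂
  have n12 := sub_ne_zero.2 h.ne₁₂
  have n13 := sub_ne_zero.2 h.ne₁₃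
  -- If one of the three collinear points is the root e₁, cancelling X - e₁ from the chord identity
  -- shows that (e₁ - e₂)(e₁ - e₃) is the product of the other two values x - e₁. This is why the
  -- map has that value at the root.
  by_cases c₁ : x₁ = e₁
  · have hy₁ : y₁ = 0 := by
      rw [c₁] at hE₁
      simpa using hE₁
    have key : (e₁ - e₂) * (e₁ - e₃) = (x₂ - e₁) * (x₃ - e₁) := by
      subst c₁ hy₁
      linear_combination (1 / 2) * H1 (x₁ + 1) - (1 / 2) * H1 (x₁ - 1) - (1 / 6) * (H1 (x₁ + 2) - 2 * H1 (x₁ + 1) + 2 * H1 (x₁ - 1) - H1 (x₁ - 2)) / 2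
    have hn : (x₂ - e₁) * (x₃ - e₁) ≠ 0 := by
      rw [← key]; exact mul_ne_zero n12 n13
    rw [descentMap_of_eq h₁ c₁, descentMap_of_ne h₂ (sub_ne_zero.1 (left_ne_zero_of_mul hn)),
      descentMap_of_ne h₃ (sub_ne_zero.1 (right_ne_zero_of_mul hn)), key]
    exact ⟨(x₂ - e₁) * (x₃ - e₁), by ring⟩
  by_cases c₂ : x₂ = e₁
  · have hy₂ : y₂ = 0 := by
      rw [c₂] at hE₂
      simpa using hE₂
    have hl : l * (e₁ - x₁) + y₁ = 0 := by
      have := H1 e₁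
      rw [c₂] at this
      simpa using this
    have key : (e₁ - e₂) * (e₁ - e₃) = (x₁ - e₁) * (x₃ - e₁) := by
      obtain rfl : y₁ = l * (x₁ - e₁) := by linear_combination hl
      subst c₂ hy₂
      linear_combination (1 / 2) * H1 (x₂ + 1) - (1 / 2) * H1 (x₂ - 1) - (1 / 6) * (H1 (x₂ + 2) - 2 * H1 (x₂ + 1) + 2 * H1 (x₂ - 1) - H1 (x₂ - 2)) / 2
    have hn : (x₁ - e₁) * (x₃ - e₁) ≠ 0 := by
      rw [← key]; exact mul_ne_zero n12 n13
    rw [descentMap_of_ne h₁ c₁, descentMap_of_eq h₂ c₂,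
      descentMap_of_ne h₃ (sub_ne_zero.1 (right_ne_zero_of_mul hn)), key]
    exact ⟨(x₁ - e₁) * (x₃ - e₁), by ring⟩
  rw [descentMap_of_ne h₁ c₁, descentMap_of_ne h₂ c₂]
  by_cases c₃ : x₃ = e₁
  · have hl : l * (e₁ - x₁) + y₁ = 0 := by
      have := H1 e₁
      rw [c₃] at this
      simpa using this
    have key : (e₁ - e₂) * (e₁ - e₃) = (x₁ - e₁) * (x₂ - e₁) := by
      obtain rfl : y₁ = l * (x₁ - e₁) := by linear_combination hl
      subst c₃
      linear_combination (1 / 2) * H1 (x₃ + 1) - (1 / 2) * H1 (x₃ - 1) - (1 / 6) * (H1 (x₃ + 2) - 2 * H1 (x₃ + 1) + 2 * H1 (x₃ - 1) - H1 (x₃ - 2)) / 2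
    rw [descentMap_of_eq h₃ c₃, key]
    exact ⟨(x₁ - e₁) * (x₂ - e₁), by ring⟩
  · rw [descentMap_of_ne h₃ c₃]
    -- Generically the chord identity at X = e₁ exhibits the product of the three values as the
    -- square of the height of the line there.
    exact ⟨l * (e₁ - x₁) + y₁, by linear_combination H1 e₁⟩

theorem isSquare_descentMap_two_smul (h : IsSplit W e₁ e₂ e₃) (P : W.toAffine.Point) :
    IsSquare (descentMap e₁ e₂ e₃ (2 • P)) := by
  obtain ⟨r, -, hr⟩ := h.descentMap_add P P
  rw [two_nsmul, hr]
  exact ⟨descentMap e₁ e₂ e₃ P * r, by ring⟩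

end IsSplit

/-! ### Naive heights and the Mordell–Weil theorem. -/

namespace IsSplit

variable {W : WeierstrassCurve ℚ} {e₁ e₂ e₃ : ℚ}

theorem eval_addSubMap (h : IsSplit W e₁ e₂ e₃) (v : Fin 3 → ℚ) :
    (fun i => (addSubMap W i).eval v) =
      ![v 0 ^ 2 - 2 * W.a₄ * v 0 * v 2 - 4 * W.a₆ * v 1 * v 2 -
          (4 * W.a₂ * W.a₆ - W.a₄ ^ 2) * v 2 ^ 2,
        2 * v 1 * v 0 + 4 * W.a₂ * v 0 * v 2 + 2 * W.a₄ * v 1 * v 2 + 4 * W.a₆ * v 2 ^ 2,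
        v 1 ^ 2 - 4 * v 0 * v 2] := by
  funext i
  fin_cases i <;> simp [addSubMap, WeierstrassCurve.b₂, WeierstrassCurve.b₄, WeierstrassCurve.b₆,
    WeierstrassCurve.b₈, h.a₁, h.a₃]

/-- The three abscissae on a chord of slope l add up to l² + e₁ + e₂ + e₃, and l(x₁ - x₂) is y₁ - y₂
for the sum and y₁ + y₂ for the difference. -/
theorem exists_add_sub_of_X_ne (h : IsSplit W e₁ e₂ e₃) {x₁ y₁ x₂ y₂ : ℚ}
    (h₁ : W.toAffine.Nonsingular x₁ y₁) (h₂ : W.toAffine.Nonsingular x₂ y₂) (hx : x₁ ≠ x₂) :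
    ∃ x₃ y₃ h₃ x₄ y₄ h₄, Point.some x₁ y₁ h₁ + Point.some x₂ y₂ h₂ = Point.some x₃ y₃ h₃ ∧
      Point.some x₁ y₁ h₁ - Point.some x₂ y₂ h₂ = Point.some x₄ y₄ h₄ ∧
      (x₃ + x₁ + x₂ - e₁ - e₂ - e₃) * (x₁ - x₂) ^ 2 = (y₁ - y₂) ^ 2 ∧
      (x₄ + x₁ + x₂ - e₁ - e₂ - e₃) * (x₁ - x₂) ^ 2 = (y₁ + y₂) ^ 2 := by
  obtain ⟨h₂', hneg⟩ := h.neg_some h₂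
  obtain ⟨l, x₃, y₃, h₃, H, H1, -, H2, -⟩ := h.add_spec h₁ h₂ (fun H => hx H.1)
  obtain ⟨l', x₄, y₄, h₄, H', H1', -, H2', -⟩ := h.add_spec h₁ h₂' (fun H => hx H.1)
  refine ⟨x₃, y₃, h₃, x₄, y₄, h₄, H, by rw [sub_eq_add_neg, hneg, H'], ?_, ?_⟩
  · have E : x₃ + x₁ + x₂ - e₁ - e₂ - e₃ = l ^ 2 := by
      linear_combination (1 / 2) * (H1 1 - 2 * H1 0 + H1 (-1))
    rw [E, ← H2 hx]; ring
  · have E : x₄ + x₁ + x₂ - e₁ - e₂ - e₃ = l' ^ 2 := by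
      linear_combination (1 / 2) * (H1' 1 - 2 * H1' 0 + H1' (-1))
    have H2 := H2' hx
    rw [E, ← sub_neg_eq_add y₁ y₂, ← H2]; ring

theorem addSubMap_sym2x_self (h : IsSplit W e₁ e₂ e₃) {x y : ℚ} (hp : W.toAffine.Nonsingular x y) :
    ∃ c : ℚ, c ≠ 0 ∧ ![(x * x) ^ 2 - 2 * W.a₄ * (x * x) * 1 - 4 * W.a₆ * (x + x) * 1 -
          (4 * W.a₂ * W.a₆ - W.a₄ ^ 2) * 1 ^ 2,
        2 * (x + x) * (x * x) + 4 * W.a₂ * (x * x) * 1 + 2 * W.a₄ * (x + x) * 1 + 4 * W.a₆ * 1 ^ 2,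
        (x + x) ^ 2 - 4 * (x * x) * 1] =
      c • Point.sym2x (Point.some x y hp + Point.some x y hp) 0 := by
  have hE := h.nonsingular_iff.1 hp
  have n12 := sub_ne_zero.2 h.ne₁₂
  have n13 := sub_ne_zero.2 h.ne₁₃
  have n23 := sub_ne_zero.2 h.ne₂₃
  rw [h.a₂, h.a₄, h.a₆]
  by_cases hy : y = 0
  · rw [← two_nsmul (Point.some x y hp), (h.two_smul_eq_zero_iff hp).2 hy, Point.sym2x_zero_zero]
    -- Up to a multiple of the vanishing cubic this is the numerator of x(2P); it is non-zero
    -- because the roots are distinct.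
    refine ⟨((x - e₁) ^ 2 - (e₁ - e₂) * (e₁ - e₃)) ^ 2 - 4 * (e₁ - x) *  ((x - e₁) * (x - e₂) * (x - e₃)), ?_, ?_⟩
    · rw [hy] at hE
      rw [← hE]
      have : (x - e₁) * (x - e₂) * (x - e₃) = 0 := by rw [← hE]; ring
      rcases mul_eq_zero.1 this with H | H
      · rcases mul_eq_zero.1 H with H | H
        · rw [H]
          have := mul_ne_zero n12 n13
          simpa using ⟨n12, n13⟩
        · obtain rfl := sub_eq_zero.1 H
          have : (x - e₁) ^ 2 - (e₁ - x) * (e₁ - e₃) = (e₁ - x) * (e₃ - x) := by ring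
          rw [this]
          simpa using ⟨n12, sub_ne_zero.2 h.ne₂₃.symm⟩
      · obtain rfl := sub_eq_zero.1 H
        have : (x - e₁) ^ 2 - (e₁ - e₂) * (e₁ - x) = (e₁ - x) * (e₂ - x) := by ring
        rw [this]
        simpa using ⟨n13, n23⟩
    · funext i
      fin_cases i
      · simp
        have : (x - e₁) * (x - e₂) * (x - e₃) = 0 := by rw [← hE, hy]; ring
        linear_combination (8 * e₁ - 4 * x) * this
      · simp
        have : (x - e₁) * (x - e₂) * (x - e₃) = 0 := by rw [← hE, hy]; ring
        linear_combination 4 * this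
      · simp
        ring
  · obtain ⟨x', y', h', H, H1, -⟩ := h.two_smul_spec hp hy
    rw [← two_nsmul (Point.some x y hp), H, Point.sym2x_some_zero]
    refine ⟨(2 * y) ^ 2, by positivity, ?_⟩
    funext i
    fin_cases i
    · simp
      linear_combination -H1 - 4 * e₁ * hE
    · simp
      linear_combination -4 * hE
    · simp
      ring

/-- The map `addSubMap` describes the `x`-coordinates of the sum and the difference of points. -/
theorem addSubMap_sym2x (h : IsSplit W e₁ e₂ e₃) (P Q : W.toAffine.Point) :
    ∃ c : ℚ, c ≠ 0 ∧ (fun i => (addSubMap W i).eval (P.sym2x Q)) = c • (P + Q).sym2x (P - Q) := by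
  rw [h.eval_addSubMap]
  rcases P with _ | ⟨x₁, y₁, h₁⟩
  · rw [← Point.zero_def, zero_add, zero_sub, Point.sym2x_neg_right]
    refine ⟨1, one_ne_zero, ?_⟩
    rcases Q with _ | ⟨x, y, hq⟩
    · rw [← Point.zero_def, Point.sym2x_zero_zero]
      funext i; fin_cases i <;> simp
    · rw [Point.sym2x_zero_some, Point.sym2x_some_some]
      funext i; fin_cases i <;> simp <;> ring
  rcases Q with _ | ⟨x₂, y₂, h₂⟩
  · rw [← Point.zero_def, add_zero, sub_zero, Point.sym2x_some_zero, Point.sym2x_some_some]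
    refine ⟨1, one_ne_zero, ?_⟩
    funext i; fin_cases i <;> simp <;> ring
  rw [Point.sym2x_some_some]
  by_cases hx : x₁ = x₂
  · have hE₁ := h.nonsingular_iff.1 h₁
    have hE₂ := h.nonsingular_iff.1 h₂
    subst hx
    have : (y₁ - y₂) * (y₁ + y₂) = 0 := by linear_combination hE₁ - hE₂
    obtain ⟨c, hc, H⟩ := h.addSubMap_sym2x_self h₁
    refine ⟨c, hc, ?_⟩
    rcases mul_eq_zero.1 this with H' | H'
    · obtain rfl := sub_eq_zero.1 H'
      rw [sub_self]
      exact H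
    · have hz := h.add_eq_zero h₁ h₂ rfl (by linarith)
      rw [hz, sub_eq_add_neg (Point.some _ _ _), ← eq_neg_of_add_eq_zero_left hz, Point.sym2x_comm]
      exact H
  · obtain ⟨x₃, y₃, h₃, x₄, y₄, h₄, H3, H4, E3, E4⟩ := h.exists_add_sub_of_X_ne h₁ h₂ hx
    have hE₁ := h.nonsingular_iff.1 h₁
    have hE₂ := h.nonsingular_iff.1 h₂
    have hc : (x₁ - x₂) ^ 2 ≠ 0 := pow_ne_zero 2 (sub_ne_zero.2 hx)
    rw [H3, H4, Point.sym2x_some_some, h.a₂, h.a₄, h.a₆]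
    refine ⟨(x₁ - x₂) ^ 2, hc, ?_⟩
    funext i
    fin_cases i
    · simp
      apply mul_left_cancel₀ hc
      have P3 : x₃ * (x₁ - x₂) ^ 2 = (y₁ - y₂) ^ 2 - (x₁ + x₂ - e₁ - e₂ - e₃) * (x₁ - x₂) ^ 2 := by
        linear_combination E3
      have P4 : x₄ * (x₁ - x₂) ^ 2 = (y₁ + y₂) ^ 2 - (x₁ + x₂ - e₁ - e₂ - e₃) * (x₁ - x₂) ^ 2 := by
        linear_combination E4
      have P5 : (x₁ - x₂) ^ 2 * ((x₁ - x₂) ^ 2 * (x₃ * x₄)) =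
          (y₁ ^ 2 - y₂ ^ 2) ^ 2 - 2 * (x₁ + x₂ - e₁ - e₂ - e₃) * (x₁ - x₂) ^ 2 * (y₁ ^ 2 + y₂ ^ 2) +
          ((x₁ + x₂ - e₁ - e₂ - e₃) * (x₁ - x₂) ^ 2) ^ 2 := by
        rw [show (x₁ - x₂) ^ 2 * ((x₁ - x₂) ^ 2 * (x₃ * x₄)) =
          (x₃ * (x₁ - x₂) ^ 2) * (x₄ * (x₁ - x₂) ^ 2) by ring, P3, P4]
        ring
      rw [P5, hE₁, hE₂]
      ring
    · simp
      linear_combination -E3 - E4 - 2 * hE₁ - 2 * hE₂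
    · simp
      ring

/-- The naive height. -/
noncomputable def _root_.naiveHeight {W : WeierstrassCurve ℚ} (P : W.toAffine.Point) : ℝ :=
  Height.logHeight P.xRep

/-- The quadratic map `addSubMap` doubles heights up to a bounded error and carries the pair (x(P),
x(Q)) to (x(P + Q), x(P - Q)). The height of a symmetric pair is the sum of the two heights, again
up to a bounded error. -/
theorem naiveHeight_parallelogram (h : IsSplit W e₁ e₂ e₃) :
    ∃ C, ∀ P Q : W.toAffine.Point,
      |naiveHeight (P + Q) + naiveHeight (P - Q) - 2 * (naiveHeight P + naiveHeight Q)| ≤ C := by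
  have := h.isElliptic
  obtain ⟨C₁, hC₁⟩ := W.abs_logHeight_addSubMap_sub_two_mul_logHeight_le
  obtain ⟨C₂, hC₂⟩ := Height.abs_logHeight_sym2_sub_le ℚ
  have key : ∀ P Q : W.toAffine.Point,
      |Height.logHeight (P.sym2x Q) - (naiveHeight P + naiveHeight Q)| ≤ C₂ := by
    intro P Q
    have e : ∀ P : W.toAffine.Point, P.xRep = ![P.xRep 0, P.xRep 1] := by
      intro P; funext i; fin_cases i <;> rfl
    have := hC₂ (a := P.xRep 0) (b := P.xRep 1) (c := Q.xRep 0) (d := Q.xRep 1)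
      (by rw [← e]; exact P.xRep_ne_zero) (by rw [← e]; exact Q.xRep_ne_zero)
    rw [← e, ← e] at this
    exact this
  refine ⟨C₁ + 3 * C₂, fun P Q => ?_⟩
  obtain ⟨c, hc, H⟩ := h.addSubMap_sym2x P Q
  have h1 := hC₁ (P.sym2x Q)
  rw [H, Height.logHeight_smul_eq_logHeight _ hc] at h1
  have h2 := key P Q
  have h3 := key (P + Q) (P - Q)
  rw [abs_le] at *
  constructor <;> linarith [h1.1, h1.2, h2.1, h2.2, h3.1, h3.2]

/-- Since x determines a point up to sign, finiteness is inherited from ℚ. -/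
theorem northcott_naiveHeight (W : WeierstrassCurve ℚ) :
    Northcott (naiveHeight (W := W)) := by
  refine ⟨fun B => ?_⟩
  have hfin : {x : ℚ | Height.logHeight₁ x ≤ B}.Finite := Northcott.finite_le B
  have hfin' : (insert ![1, 0] ((fun x : ℚ => ![x, 1]) '' {x : ℚ | Height.logHeight₁ x ≤ B})).Finite :=
    (hfin.image _).insert _
  refine (hfin'.preimage' (f := Point.xRep (W' := W.toAffine)) ?_).subset ?_
  · intro v _
    by_cases hv : ∃ P : W.toAffine.Point, P.xRep = v
    · obtain ⟨P, rfl⟩ := hv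
      refine (Set.toFinite {P, -P}).subset ?_
      intro Q hQ
      simp only [Set.mem_preimage, Set.mem_singleton_iff] at hQ
      exact Point.eq_or_eq_neg_of_xRep_eq_xRep hQ
    · convert Set.finite_empty
      ext P
      simp only [Set.mem_preimage, Set.mem_singleton_iff, Set.mem_empty_iff_false, iff_false]
      exact fun H => hv ⟨P, H⟩
  · intro P hP
    rcases P with _ | ⟨x, y, hp⟩
    · left; rfl
    · right
      refine ⟨x, ?_, rfl⟩
      have : naiveHeight (Point.some x y hp) = Height.logHeight₁ x := by
        rw [Height.logHeight₁_eq_logHeight]; rfl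
      simpa [this] using hP

/-- The Mordell-Weil theorem, given representatives modulo doubling. -/
theorem fg_of_finite (h : IsSplit W e₁ e₂ e₃) {s : Set W.toAffine.Point} (hs : s.Finite)
    (H : ∀ P, ∃ Q ∈ s, ∃ R, P = Q + 2 • R) : AddGroup.FG W.toAffine.Point := by
  obtain ⟨C, hC⟩ := h.naiveHeight_parallelogram
  have := northcott_naiveHeight W
  refine AddCommGroup.fg_of_descent' (h := naiveHeight) (C := C) ?_ (fun _ => Height.logHeight_nonneg _) hC
  have : Finite s := hs
  have : Finite (W.toAffine.Point ⧸ (nsmulAddMonoidHom (α := W.toAffine.Point) 2).range) := by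
    refine Finite.of_surjective (fun Q : s => QuotientAddGroup.mk (Q : W.toAffine.Point)) ?_
    intro q
    obtain ⟨P, rfl⟩ := QuotientAddGroup.mk_surjective q
    obtain ⟨Q, hQ, R, rfl⟩ := H P
    refine ⟨⟨Q, hQ⟩, ?_⟩
    rw [QuotientAddGroup.eq]
    exact ⟨R, by simp⟩
  exact AddSubgroup.finiteIndex_of_finite_quotient

end IsSplit

/-! ### Abelian groups: odd exponent, rank bounds, recognition of ℤ/2 × ℤ/8. -/

section AbelianGroup

variable {G : Type*} [AddCommGroup G]

/-- A subgroup which covers a finitely generated group modulo doubling has odd exponent in it. -/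
theorem exists_odd_smul_mem [AddGroup.FG G] (H : AddSubgroup G)
    (hH : ∀ g : G, ∃ h ∈ H, ∃ r : G, g = h + 2 • r) : ∃ n : ℤ, Odd n ∧ ∀ g : G, n • g ∈ H := by
  let N := H.toIntSubmodule
  have : Module.Finite ℤ G := Module.Finite.iff_addGroup_fg.2 inferInstance
  -- The quotient equals its own double, so Nakayama's lemma yields n ≡ 1 modulo 2 that annihilates
  -- it.
  have hle : (⊤ : Submodule ℤ (G ⧸ N)) ≤ Ideal.span {(2 : ℤ)} • ⊤ := by
    rintro q -
    obtain ⟨g, rfl⟩ := N.mkQ_surjective q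
    obtain ⟨h, hh, r, rfl⟩ := hH g
    have h0 : N.mkQ h = 0 := by
      rw [Submodule.mkQ_apply, Submodule.Quotient.mk_eq_zero]
      exact hh
    rw [map_add, h0, zero_add, map_nsmul]
    have : (2 : ℕ) • N.mkQ r = (2 : ℤ) • N.mkQ r := by
      rw [two_smul, two_smul]
    rw [this]
    exact Submodule.smul_mem_smul (Ideal.mem_span_singleton_self _) trivial
  obtain ⟨n, hn, hz⟩ := Submodule.exists_sub_one_mem_and_smul_eq_zero_of_fg_of_le_smul _ _
    Module.Finite.fg_top hle
  obtain ⟨k, hk⟩ := Ideal.mem_span_singleton.1 hn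
  refine ⟨n, ⟨k, by linarith⟩, fun g => ?_⟩
  have := hz (N.mkQ g) trivial
  rw [← map_smul, Submodule.mkQ_apply, Submodule.Quotient.mk_eq_zero] at this
  exact this

theorem rank_le_one_of_smul (Q : G)
    (H : ∀ g : G, ∃ n : ℤ, n ≠ 0 ∧ ∃ m : ℤ, IsOfFinAddOrder (n • g - m • Q)) :
    Module.rank ℤ G ≤ 1 := by
  have key : ∀ s : Finset G, LinearIndependent ℤ (fun i : s => (i : G)) → s.card ≤ 1 := by
    intro s hs
    rw [Finset.card_le_one]
    intro a ha b hb
    by_contra hab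
    obtain ⟨n₁, hn₁, m₁, h₁⟩ := H a
    obtain ⟨n₂, hn₂, m₂, h₂⟩ := H b
    obtain ⟨k₁, hk₁, e₁⟩ := isOfFinAddOrder_iff_nsmul_eq_zero.1 h₁
    obtain ⟨k₂, hk₂, e₂⟩ := isOfFinAddOrder_iff_nsmul_eq_zero.1 h₂
    have hab' : Function.Injective (![⟨a, ha⟩, ⟨b, hb⟩] : Fin 2 → s) := by
      intro i j hij
      fin_cases i <;> fin_cases j <;> simp at hij ⊢
      · exact hab hij
      · exact hab hij.symm
    have hp : LinearIndependent ℤ ![a, b] := by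
      have e : ![a, b] = (fun i : s => (i : G)) ∘ (![⟨a, ha⟩, ⟨b, hb⟩] : Fin 2 → s) := by
        funext i
        fin_cases i <;> rfl
      rw [e]
      exact hs.comp _ hab'
    rw [LinearIndependent.pair_iff] at hp
    have f₁ : (k₁ * n₁ : ℤ) • a = (k₁ * m₁ : ℤ) • Q := by
      rw [mul_smul, mul_smul, ← sub_eq_zero, ← smul_sub]
      exact_mod_cast e₁
    have f₂ : (k₂ * n₂ : ℤ) • b = (k₂ * m₂ : ℤ) • Q := by
      rw [mul_smul, mul_smul, ← sub_eq_zero, ← smul_sub]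
      exact_mod_cast e₂
    have hk₁' : (k₁ : ℤ) ≠ 0 := by exact_mod_cast hk₁.ne'
    have hk₂' : (k₂ : ℤ) ≠ 0 := by exact_mod_cast hk₂.ne'
    by_cases hm : m₁ = 0
    · have := hp (k₁ * n₁) 0 (by rw [f₁, hm, mul_zero, zero_smul, zero_smul, add_zero])
      exact mul_ne_zero hk₁' hn₁ this.1
    · have := hp ((k₂ * m₂) * (k₁ * n₁)) (-((k₁ * m₁) * (k₂ * n₂))) (by
        rw [neg_smul, mul_smul (k₂ * m₂), mul_smul (k₁ * m₁), f₁, f₂, ← mul_smul, ← mul_smul,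
          mul_comm (k₂ * m₂ : ℤ), add_neg_cancel])
      exact mul_ne_zero (mul_ne_zero hk₁' hm) (mul_ne_zero hk₂' hn₂) (neg_eq_zero.1 this.2)
  exact_mod_cast rank_le key

theorem one_le_rank_of_not_isOfFinAddOrder {Q : G} (hQ : ¬ IsOfFinAddOrder Q) : 1 ≤ Module.rank ℤ G := by
  have : LinearIndependent ℤ (fun _ : PUnit => Q) := by
    refine Fintype.linearIndependent_iff.2 fun g hg i => ?_
    simp only [Finset.univ_unique, Finset.sum_singleton] at hg
    by_contra hi
    exact hQ (isOfFinAddOrder_iff_zsmul_eq_zero.2 ⟨g i, hi, hg⟩)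
  simpa using this.cardinal_le_rank

/-- A kernel element gives mT = -nR. If m is odd, doubling forces 4 ∣ n, and then T is 0 or 4R. -/
theorem exists_twoEight_hom {R T : G} (hR : 8 • R = 0) (hR4 : 4 • R ≠ 0) (hT : 2 • T = 0)
    (hT0 : T ≠ 0) (hTR : T ≠ 4 • R) :
    ∃ f : ZMod 2 × ZMod 8 →+ G, Function.Injective f ∧
      ∀ m n : ℤ, f ((m : ZMod 2), (n : ZMod 8)) = m • T + n • R := by
  let f₁ : ZMod 2 →+ G := ZMod.lift 2 ⟨zmultiplesHom G T, by simpa using mod_cast hT⟩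
  let f₂ : ZMod 8 →+ G := ZMod.lift 8 ⟨zmultiplesHom G R, by simpa using mod_cast hR⟩
  have hf : ∀ m n : ℤ, f₁.coprod f₂ ((m : ZMod 2), (n : ZMod 8)) = m • T + n • R := by
    intro m n
    simp [f₁, f₂]
  have ho : addOrderOf R = 8 :=
    addOrderOf_eq_prime_pow (p := 2) (n := 2) (by simpa using hR4) (by simpa using hR)
  refine ⟨f₁.coprod f₂, ?_, hf⟩
  rw [injective_iff_map_eq_zero]
  rintro ⟨a, b⟩ hab
  obtain ⟨m, rfl⟩ := ZMod.intCast_surjective a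
  obtain ⟨n, rfl⟩ := ZMod.intCast_surjective b
  rw [hf] at hab
  have hT' : (2 : ℤ) • T = 0 := mod_cast hT
  have hR' : (8 : ℤ) • R = 0 := mod_cast hR
  rcases Int.even_or_odd' m with ⟨k, rfl | rfl⟩
  · have h1 : (2 * k) • T = 0 := by rw [mul_comm, mul_smul, hT', smul_zero]
    rw [h1, zero_add] at hab
    have := addOrderOf_dvd_iff_zsmul_eq_zero.2 hab
    rw [ho] at this
    have e1 : ((2 * k : ℤ) : ZMod 2) = 0 := (ZMod.intCast_zmod_eq_zero_iff_dvd _ _).2 ⟨k, rfl⟩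
    have e2 : ((n : ℤ) : ZMod 8) = 0 := (ZMod.intCast_zmod_eq_zero_iff_dvd _ _).2 this
    rw [e1, e2]; rfl
  · exfalso
    have h1 : (2 * k + 1) • T = T := by
      rw [add_smul, mul_comm, mul_smul, hT', smul_zero, zero_add, one_smul]
    rw [h1] at hab
    have h2 : (2 * n) • R = 0 := by
      have : (2 : ℤ) • (T + n • R) = 0 := by rw [hab, smul_zero]
      rwa [smul_add, hT', zero_add, ← mul_smul] at this
    have := addOrderOf_dvd_iff_zsmul_eq_zero.2 h2
    rw [ho] at this
    obtain ⟨j, rfl⟩ : ∃ j, n = 4 * j := ⟨n / 4, by omega⟩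
    rcases Int.even_or_odd' j with ⟨i, rfl | rfl⟩
    · apply hT0
      have : (4 * (2 * i)) • R = 0 := by
        rw [show 4 * (2 * i) = i * 8 by ring, mul_smul, hR', smul_zero]
      rwa [this, add_zero] at hab
    · apply hTR
      have e : (4 * (2 * i + 1)) • R = (4 : ℕ) • R := by
        rw [show 4 * (2 * i + 1) = i * 8 + 4 by ring, add_smul, mul_smul, hR', smul_zero, zero_add]
        exact mod_cast rfl
      have e' : (4 : ℕ) • R + (4 : ℕ) • R = 0 := by rw [← add_smul]; exact hR
      rw [e] at hab
      rw [eq_neg_of_add_eq_zero_left hab, ← eq_neg_of_add_eq_zero_left e']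

/-- A torsion point of `2`-power order lies in the subgroup generated by `R` and `T`. -/
theorem exists_eq_of_two_pow_smul {R T : G}
    (hE : ∀ P : G, 2 • P = 0 → P = 0 ∨ P = 4 • R ∨ P = T ∨ P = T + 4 • R)
    (n₁ : ∀ Q, 2 • Q ≠ T) (n₂ : ∀ Q, 2 • Q ≠ R) (n₃ : ∀ Q, 2 • Q ≠ R + T)
    (hT : 2 • T = 0) (k : ℕ) (P : G) (hP : 2 ^ k • P = 0) : ∃ m n : ℤ, P = m • T + n • R := by
  induction k generalizing P with
  | zero => exact ⟨0, 0, by simpa using hP⟩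
  | succ k ih =>
    obtain ⟨m, n, h⟩ := ih (2 • P) (by rw [← mul_smul, ← pow_succ]; exact hP)
    have hT' : (2 : ℤ) • T = 0 := mod_cast hT
    have hP2 : ((2 : ℕ) • P) = (2 : ℤ) • P := mod_cast rfl
    -- Unless m and n are both even, subtracting doubles from 2P = mT + nR shows that T, R or R + T
    -- is a double. If both are even, P is a combination of R and T up to 2-torsion.
    rcases Int.even_or_odd' n with ⟨j, rfl | rfl⟩ <;> rcases Int.even_or_odd' m with ⟨i, rfl | rfl⟩
    · have : 2 • (P - j • R) = 0 := by
        rw [smul_sub, h, mul_comm 2 i, mul_smul, hT', smul_zero, zero_add, mul_smul]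
        exact sub_eq_zero.2 (mod_cast rfl)
      rcases hE _ this with H | H | H | H
      · exact ⟨0, j, by rw [sub_eq_zero.1 H, zero_smul, zero_add]⟩
      · exact ⟨0, j + 4, by rw [sub_eq_iff_eq_add.1 H, zero_smul, zero_add, add_smul, add_comm]; exact mod_cast rfl⟩
      · exact ⟨1, j, by rw [sub_eq_iff_eq_add.1 H, one_smul]⟩
      · refine ⟨1, j + 4, ?_⟩
        rw [sub_eq_iff_eq_add.1 H, one_smul, add_smul, add_comm (j • R), add_assoc]
        exact mod_cast rfl
    · exfalso
      apply n₁ (P - j • R)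
      rw [smul_sub, h, add_smul, mul_comm 2 i, mul_smul i, hT', smul_zero, zero_add, one_smul,
        mul_smul, add_sub_assoc, add_eq_left]
      exact sub_eq_zero.2 (mod_cast rfl)
    · exfalso
      apply n₂ (P - j • R)
      rw [smul_sub, h, mul_comm 2 i, mul_smul, hT', smul_zero, zero_add, add_smul, one_smul,
        mul_smul, add_comm, add_sub_assoc, add_eq_left]
      exact sub_eq_zero.2 (mod_cast rfl)
    · exfalso
      apply n₃ (P - j • R)
      rw [smul_sub, h, add_smul, mul_comm 2 i, mul_smul i, hT', smul_zero, zero_add, one_smul,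
        add_smul, one_smul, mul_smul, add_comm R T, add_comm _ R, ← add_assoc, add_sub_assoc, add_eq_left]
      exact sub_eq_zero.2 (mod_cast rfl)

/-- Applied to Q = 0 and Q = 2R, the hypothesis `n₁` gives T ∉ {0, 4R}, hence injectivity;
surjectivity onto the torsion is `exists_eq_of_two_pow_smul`. -/
theorem torsion_equiv_twoEight {R T : G} (hR : 8 • R = 0) (hR4 : 4 • R ≠ 0) (hT : 2 • T = 0)
    (hE : ∀ P : G, 2 • P = 0 → P = 0 ∨ P = 4 • R ∨ P = T ∨ P = T + 4 • R)
    (n₁ : ∀ Q, 2 • Q ≠ T) (n₂ : ∀ Q, 2 • Q ≠ R) (n₃ : ∀ Q, 2 • Q ≠ R + T)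
    (h2 : ∀ P : G, IsOfFinAddOrder P → ∃ k, 2 ^ k • P = 0) :
    Nonempty (AddCommGroup.torsion G ≃+ ZMod 2 × ZMod 8) := by
  obtain ⟨f, hf, hfe⟩ := exists_twoEight_hom hR hR4 hT
    (fun h => n₁ 0 (by rw [h, smul_zero]))
    (fun h => n₁ (2 • R) (by rw [h, ← mul_smul]; norm_num))
  have hmem : ∀ z, f z ∈ AddCommGroup.torsion G := by
    intro z
    have : IsOfFinAddOrder z := isOfFinAddOrder_of_finite z
    exact f.isOfFinAddOrder this
  let g : ZMod 2 × ZMod 8 →+ AddCommGroup.torsion G := f.codRestrict _ hmem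
  refine ⟨(AddEquiv.ofBijective g ⟨?_, ?_⟩).symm⟩
  · intro a b hab
    exact hf (congrArg Subtype.val hab)
  · rintro ⟨P, hP⟩
    obtain ⟨k, hk⟩ := h2 P hP
    obtain ⟨m, n, h⟩ := exists_eq_of_two_pow_smul hE n₁ n₂ n₃ hT k P hk
    refine ⟨((m : ZMod 2), (n : ZMod 8)), Subtype.ext ?_⟩
    change f _ = P
    rw [hfe, h]

end AbelianGroup

/-! ### Calculus of p-adic valuations on ℚ. -/

/-- `x` is non-zero of `p`-adic valuation `n`. -/
def HasVal (p : ℕ) (n : ℤ) (x : ℚ) : Prop := x ≠ 0 ∧ padicValRat p x = n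

/-- `x` is zero or of `p`-adic valuation at least `n`. -/
def ValGE (p : ℕ) (n : ℤ) (x : ℚ) : Prop := x = 0 ∨ n ≤ padicValRat p x

section Valuation

set_option linter.unusedSectionVars false

variable {p : ℕ} [hp : Fact p.Prime] {m n : ℤ} {x y : ℚ}

theorem exists_hasVal (p : ℕ) (hx : x ≠ 0) : ∃ n, HasVal p n x := ⟨_, hx, rfl⟩

theorem HasVal.congr (hx : HasVal p m x) (h : m = n) : HasVal p n x := h ▸ hx

theorem ValGE.congr (hx : ValGE p m x) (h : m = n) : ValGE p n x := h ▸ hx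

theorem HasVal.unique (hx : HasVal p m x) (hy : HasVal p n x) : m = n := hx.2.symm.trans hy.2

theorem HasVal.valGE (hx : HasVal p n x) (h : m ≤ n) : ValGE p m x := Or.inr (hx.2 ▸ h)

theorem ValGE.mono (hx : ValGE p n x) (h : m ≤ n) : ValGE p m x := hx.imp_right h.trans

theorem ValGE.hasVal (hx : ValGE p n x) (h0 : x ≠ 0) : ∃ m, n ≤ m ∧ HasVal p m x :=
  ⟨_, hx.resolve_left h0, h0, rfl⟩

theorem HasVal.not_valGE (hx : HasVal p m x) (h : m < n) : ¬ ValGE p n x := by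
  rintro (h' | h')
  · exact hx.1 h'
  · rw [hx.2] at h'; omega

theorem HasVal.mul (hx : HasVal p m x) (hy : HasVal p n y) : HasVal p (m + n) (x * y) :=
  ⟨mul_ne_zero hx.1 hy.1, by rw [padicValRat.mul hx.1 hy.1, hx.2, hy.2]⟩

theorem HasVal.pow (hx : HasVal p m x) (k : ℕ) : HasVal p (k * m) (x ^ k) :=
  ⟨pow_ne_zero k hx.1, by rw [padicValRat.pow, hx.2]⟩

theorem HasVal.neg (hx : HasVal p m x) : HasVal p m (-x) :=
  ⟨neg_ne_zero.2 hx.1, by rw [padicValRat.neg, hx.2]⟩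

theorem HasVal.inv (hx : HasVal p m x) : HasVal p (-m) x⁻¹ :=
  ⟨inv_ne_zero hx.1, by rw [padicValRat.inv, hx.2]⟩

theorem HasVal.div (hx : HasVal p m x) (hy : HasVal p n y) : HasVal p (m - n) (x / y) := by
  rw [div_eq_mul_inv, sub_eq_add_neg]
  exact hx.mul hy.inv

theorem HasVal.of_mul (hxy : HasVal p m (x * y)) (hy : HasVal p n y) : HasVal p (m - n) x := by
  have := hxy.div hy
  rwa [mul_div_cancel_right₀ _ hy.1] at this

theorem ValGE.neg (hx : ValGE p m x) : ValGE p m (-x) := by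
  rcases hx with h | h
  · exact Or.inl (by rw [h, neg_zero])
  · exact Or.inr (by rwa [padicValRat.neg])

theorem ValGE.mul (hx : ValGE p m x) (hy : ValGE p n y) : ValGE p (m + n) (x * y) := by
  by_cases h1 : x = 0
  · exact Or.inl (by rw [h1, zero_mul])
  by_cases h2 : y = 0
  · exact Or.inl (by rw [h2, mul_zero])
  obtain ⟨a, ha, hx⟩ := hx.hasVal h1
  obtain ⟨b, hb, hy⟩ := hy.hasVal h2
  exact (hx.mul hy).valGE (by omega)

theorem ValGE.add (hx : ValGE p n x) (hy : ValGE p n y) : ValGE p n (x + y) := by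
  by_cases h0 : x + y = 0
  · exact Or.inl h0
  rcases hx with rfl | hx
  · rwa [zero_add]
  rcases hy with rfl | hy
  · rw [add_zero]; exact Or.inr hx
  exact Or.inr ((le_min hx hy).trans (padicValRat.min_le_padicValRat_add h0))

theorem ValGE.sub (hx : ValGE p n x) (hy : ValGE p n y) : ValGE p n (x - y) := by
  rw [sub_eq_add_neg]; exact hx.add hy.neg

theorem HasVal.add_valGE (hx : HasVal p m x) (hy : ValGE p n y) (h : m < n) :
    HasVal p m (x + y) := by
  have h0 : x + y ≠ 0 := by
    intro h'
    obtain rfl : y = -x := by linarith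
    exact hx.neg.not_valGE h hy
  refine ⟨h0, ?_⟩
  rcases hy with rfl | hy
  · rw [add_zero, hx.2]
  · by_cases hy0 : y = 0
    · rw [hy0, add_zero, hx.2]
    · rw [padicValRat.add_eq_of_lt h0 hx.1 hy0 (by rw [hx.2]; omega), hx.2]

theorem ValGE.add_hasVal (hx : ValGE p n x) (hy : HasVal p m y) (h : m < n) :
    HasVal p m (x + y) := by
  rw [add_comm]; exact hy.add_valGE hx h

theorem HasVal.sub_valGE (hx : HasVal p m x) (hy : ValGE p n y) (h : m < n) :
    HasVal p m (x - y) := by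
  rw [sub_eq_add_neg]; exact hx.add_valGE hy.neg h

theorem hasVal_self : HasVal p 1 (p : ℚ) :=
  ⟨by exact_mod_cast hp.out.ne_zero, padicValRat.self hp.out.one_lt⟩

theorem hasVal_one : HasVal p 0 1 := ⟨one_ne_zero, padicValRat.one⟩

theorem hasVal_intCast {z : ℤ} (h : ¬ (p : ℤ) ∣ z) : HasVal p 0 (z : ℚ) := by
  refine ⟨?_, ?_⟩
  · rintro h0
    exact h (by rw [Int.cast_eq_zero.1 h0]; exact dvd_zero _)
  · rw [padicValRat.of_int, padicValInt.eq_zero_of_not_dvd h]; rfl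

theorem valGE_intCast (z : ℤ) : ValGE p 0 (z : ℚ) :=
  Or.inr (by rw [padicValRat.of_int]; positivity)

theorem valGE_intCast_of_dvd {z : ℤ} (h : (p : ℤ) ∣ z) : ValGE p 1 (z : ℚ) := by
  obtain ⟨k, rfl⟩ := h
  push_cast
  have := (hasVal_self (p := p)).valGE le_rfl |>.mul (valGE_intCast (p := p) k)
  simpa using this

/-- The residue field at 2 has a single unit: x / y is a quotient of odd integers, so x / y + 1 has
even numerator. -/
theorem HasVal.add_of_two (hx : HasVal 2 n x) (hy : HasVal 2 n y) :
    ValGE 2 (n + 1) (x + y) := by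
  have key : ∀ z : ℚ, HasVal 2 0 z → ValGE 2 1 (z + 1) := by
    intro z hz
    have hn : ¬ 2 ∣ z.den := by
      intro hd
      have h1 : ¬ 2 ∣ z.num.natAbs := fun hn => by
        have := Nat.dvd_gcd hn hd
        rw [z.reduced] at this
        omega
      have h2 := hz.2
      rw [padicValRat.eq_1, padicValInt.eq_1, padicValNat.eq_zero_of_not_dvd h1] at h2
      have h3 := one_le_padicValNat_of_dvd (p := 2) z.den_nz hd
      omega
    have hm : ¬ 2 ∣ z.num.natAbs := by
      intro hd
      have h2 := hz.2
      rw [padicValRat.eq_1, padicValInt.eq_1, padicValNat.eq_zero_of_not_dvd hn] at h2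
      have h3 := one_le_padicValNat_of_dvd (p := 2) (Int.natAbs_ne_zero.2 (Rat.num_ne_zero.2 hz.1)) hd
      omega
    have e : z + 1 = ((z.num + z.den : ℤ) : ℚ) * ((z.den : ℤ) : ℚ)⁻¹ := by
      have : (z.den : ℚ) ≠ 0 := by exact_mod_cast z.den_nz
      push_cast
      field_simp
      rw [add_mul, Rat.mul_den_eq_num]
      ring
    rw [e]
    have h1 : ValGE 2 1 ((z.num + z.den : ℤ) : ℚ) := valGE_intCast_of_dvd (by omega)
    have h2 : HasVal 2 0 ((z.den : ℤ) : ℚ) := hasVal_intCast (by omega)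
    simpa using h1.mul (h2.inv.valGE le_rfl)
  have h := key (x / y) (by simpa using hx.div hy)
  have e : x + y = (x / y + 1) * y := by
    have := hy.1
    field_simp
  rw [e, add_comm n]
  exact h.mul (hy.valGE le_rfl)

/-- The factors x + 1 and x - 1 are both even and differ by 2, so one of them is divisible by 4. -/
theorem HasVal.sq_sub_one (hx : HasVal 2 0 x) : ValGE 2 3 (x ^ 2 - 1) := by
  have h1 : ValGE 2 1 (x + 1) := HasVal.add_of_two hx hasVal_one
  have h2 : HasVal 2 1 (2 : ℚ) := by simpa using hasVal_self (p := 2)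
  have e : x ^ 2 - 1 = (x + 1) * (x - 1) := by ring
  by_cases h : HasVal 2 1 (x + 1)
  · have h3 : ValGE 2 2 (x - 1) := by
      have := HasVal.add_of_two h h2.neg
      ring_nf at this ⊢
      exact this
    rw [e]
    exact h1.mul h3
  · have h4 : ValGE 2 2 (x + 1) := by
      by_cases h0 : x + 1 = 0
      · exact Or.inl h0
      · obtain ⟨m, hm, h'⟩ := h1.hasVal h0
        have : m ≠ 1 := by rintro rfl; exact h h'
        exact h'.valGE (by omega)
    have h3 : ValGE 2 1 (x - 1) := by
      have := h1.sub (h2.valGE le_rfl)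
      ring_nf at this ⊢
      exact this
    rw [e]
    exact h4.mul h3

end Valuation

/-! ### The curve y² = x(x + u⁴)(x + v⁴): no odd torsion, by 2-adic dynamics of doubling. -/

/-- The curve `y² = x (x + u⁴) (x + v⁴)`. -/
def legCurve (u v : ℚ) : WeierstrassCurve ℚ where
  a₁ := 0
  a₂ := u ^ 4 + v ^ 4
  a₃ := 0
  a₄ := u ^ 4 * v ^ 4
  a₆ := 0

theorem legCurve_isSplit {u v : ℚ} (hu : u ≠ 0) (hv : v ≠ 0) (h : u ^ 4 ≠ v ^ 4) :
    IsSplit (legCurve u v) 0 (-u ^ 4) (-v ^ 4) where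
  a₁ := rfl
  a₂ := by simp [legCurve, add_comm]
  a₃ := rfl
  a₄ := by simp [legCurve]
  a₆ := by simp [legCurve]
  ne₁₂ := by simpa using hu
  ne₁₃ := by simpa using hv
  ne₂₃ := by simpa using h

theorem two_hasVal : HasVal 2 1 (2 : ℚ) := by simpa using hasVal_self (p := 2)

theorem four_hasVal : HasVal 2 2 (4 : ℚ) := by
  have := two_hasVal.mul two_hasVal
  norm_num at this
  exact this

/-- An element of odd order. -/
def HasOddOrder {G : Type*} [AddCommGroup G] (P : G) : Prop := ∃ n : ℕ, Odd n ∧ n • P = 0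

theorem HasOddOrder.smul {G : Type*} [AddCommGroup G] {P : G} (h : HasOddOrder P) (m : ℕ) :
    HasOddOrder (m • P) := by
  obtain ⟨n, hn, h⟩ := h
  exact ⟨n, hn, by rw [← mul_smul, mul_comm, mul_smul, h, smul_zero]⟩

theorem HasOddOrder.eq_zero {G : Type*} [AddCommGroup G] {P : G} (h : HasOddOrder P)
    (h2 : 2 • P = 0) : P = 0 := by
  obtain ⟨n, ⟨k, rfl⟩, h⟩ := h
  rwa [add_smul, mul_comm, mul_smul, h2, smul_zero, zero_add, one_smul] at h

theorem HasOddOrder.isOfFinAddOrder {G : Type*} [AddCommGroup G] {P : G} (h : HasOddOrder P) :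
    IsOfFinAddOrder P := by
  obtain ⟨n, hn, h⟩ := h
  exact isOfFinAddOrder_iff_nsmul_eq_zero.2 ⟨n, hn.pos, h⟩

theorem exists_two_pow_smul_eq_zero {G : Type*} [AddCommGroup G]
    (h : ∀ P : G, HasOddOrder P → P = 0) {P : G} (hP : IsOfFinAddOrder P) :
    ∃ k, 2 ^ k • P = 0 := by
  obtain ⟨n, hn, h0⟩ := isOfFinAddOrder_iff_nsmul_eq_zero.1 hP
  obtain ⟨k, m, hm, rfl⟩ := Nat.exists_eq_two_pow_mul_odd hn.ne'
  refine ⟨k, h _ ⟨m, hm, ?_⟩⟩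
  rw [← mul_smul, mul_comm, h0]

/-- The point `P` is affine and `x(P) - e` has `p`-adic valuation `n`. -/
def PointVal {W : WeierstrassCurve ℚ} (p : ℕ) (e : ℚ) (n : ℤ) (P : W.toAffine.Point) : Prop :=
  ∃ x y h, P = Point.some x y h ∧ HasVal p n (x - e)

theorem PointVal.unique {W : WeierstrassCurve ℚ} {p : ℕ} [Fact p.Prime]
    {e : ℚ} {m n : ℤ} {P : W.toAffine.Point}
    (h : PointVal p e m P) (h' : PointVal p e n P) : m = n := by
  obtain ⟨x, y, hp, rfl, h⟩ := h
  obtain ⟨x', y', hp', e, h'⟩ := h'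
  simp only [Point.some.injEq] at e
  obtain ⟨rfl, rfl⟩ := e
  exact h.unique h'

/-- Points whose doublings have strictly decreasing valuations are of infinite order. -/
theorem not_isOfFinAddOrder_of_pointVal {W : WeierstrassCurve ℚ} {e : ℚ}
    (h : ∀ (P : W.toAffine.Point) (n : ℤ), n < 0 → PointVal 2 e n P → PointVal 2 e (n - 2) (2 • P))
    {P : W.toAffine.Point} {n : ℤ} (hn : n < 0) (hP : PointVal 2 e n P) :
    ¬ IsOfFinAddOrder P := by
  have key : ∀ i : ℕ, PointVal 2 e (n - 2 * i) (2 ^ i • P) := by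
    intro i
    induction i with
    | zero => simpa using hP
    | succ i ih =>
      have := h _ _ (by omega) ih
      rw [← mul_smul, ← pow_succ'] at this
      convert this using 1
      push_cast; ring
  intro hfin
  obtain ⟨i, j, hij, H⟩ : ∃ i j : ℕ, i < j ∧ 2 ^ i • P = 2 ^ j • P := by
    have hf : Finite (AddSubmonoid.multiples P) := hfin.finite_multiples
    obtain ⟨i, j, hij, H⟩ := Finite.exists_ne_map_eq_of_infinite
      (fun i : ℕ => (⟨2 ^ i • P, 2 ^ i, rfl⟩ : AddSubmonoid.multiples P))
    have H' : 2 ^ i • P = 2 ^ j • P := congrArg Subtype.val H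
    rcases lt_or_gt_of_ne hij with h | h
    · exact ⟨i, j, h, H'⟩
    · exact ⟨j, i, h, H'.symm⟩
  have h1 := key i
  rw [H] at h1
  have := h1.unique (key j)
  omega

section LegCurve

variable {u v : ℚ} {k : ℤ}

theorem isSplit_of_hasVal (hu : HasVal 2 0 u) (hv : HasVal 2 k v) (hk : 2 ≤ k) :
    IsSplit (legCurve u v) 0 (-u ^ 4) (-v ^ 4) := by
  refine legCurve_isSplit hu.1 hv.1 fun h => ?_
  have h1 := hu.pow 4
  rw [h] at h1
  have := h1.unique (hv.pow 4)
  omega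

theorem legCurve_equation (hW : IsSplit (legCurve u v) 0 (-u ^ 4) (-v ^ 4)) {x y : ℚ}
    (h : (legCurve u v).toAffine.Nonsingular x y) : y ^ 2 = x * (x + u ^ 4) * (x + v ^ 4) := by
  have := hW.nonsingular_iff.1 h
  rw [this]; ring

/-- The valuation of `x(2P)` in terms of the valuations of the terms of the duplication formula. -/
theorem pointVal_two_smul (hW : IsSplit (legCurve u v) 0 (-u ^ 4) (-v ^ 4)) {x y : ℚ} {a b c d : ℤ}
    (h : (legCurve u v).toAffine.Nonsingular x y) (hx : HasVal 2 a x) (hxu : HasVal 2 b (x + u ^ 4))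
    (hxv : HasVal 2 c (x + v ^ 4)) (hd : HasVal 2 d (x ^ 2 - u ^ 4 * v ^ 4)) :
    PointVal 2 0 (2 * d - 2 - a - b - c) (2 • Point.some x y h) := by
  have hE := legCurve_equation hW h
  have hy : HasVal 2 (a + b + c) (y ^ 2) := by rw [hE]; exact (hx.mul hxu).mul hxv
  have hy0 : y ≠ 0 := by
    rintro rfl
    exact hy.1 (by norm_num)
  obtain ⟨x', y', h', H, H1, -⟩ := hW.two_smul_spec h hy0
  refine ⟨x', y', h', H, ?_⟩
  have h4 : HasVal 2 (2 + (a + b + c)) ((2 * y) ^ 2) := by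
    rw [mul_pow, show (2 : ℚ) ^ 2 = 4 by norm_num]
    exact four_hasVal.mul hy
  refine HasVal.congr (HasVal.of_mul ?_ h4) (n := 2 * d - 2 - a - b - c) (m := 2 * d - (2 + (a + b + c))) (by ring)
  rw [H1]
  rw [show (x - 0) ^ 2 - (0 - -u ^ 4) * (0 - -v ^ 4) = x ^ 2 - u ^ 4 * v ^ 4 by ring]
  exact hd.pow 2

/-- Here x dominates both u⁴ and v⁴, so the duplication formula gives 4n - 2 - 3n = n - 2. -/
theorem pointVal_two_smul_of_neg (hu : HasVal 2 0 u) (hv : HasVal 2 k v) (hk : 2 ≤ k)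
    (P : (legCurve u v).toAffine.Point) (n : ℤ) (hn : n < 0) (hP : PointVal 2 0 n P) :
    PointVal 2 0 (n - 2) (2 • P) := by
  have hW := isSplit_of_hasVal hu hv hk
  obtain ⟨x, y, h, rfl, hx⟩ := hP
  rw [sub_zero] at hx
  have hu4 : HasVal 2 0 (u ^ 4) := (hu.pow 4).congr (by ring)
  have hv4 : HasVal 2 (4 * k) (v ^ 4) := (hv.pow 4).congr (by ring)
  have := pointVal_two_smul hW h hx (hx.add_valGE (hu4.valGE le_rfl) (by omega))
    (hx.add_valGE (hv4.valGE le_rfl) (by omega))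
    ((hx.pow 2).sub_valGE ((hu4.mul hv4).valGE le_rfl) (by push_cast; omega))
  convert this using 1
  push_cast; ring

theorem not_isOfFinAddOrder_of_neg (hu : HasVal 2 0 u) (hv : HasVal 2 k v) (hk : 2 ≤ k)
    {P : (legCurve u v).toAffine.Point} {n : ℤ} (hn : n < 0) (hP : PointVal 2 0 n P) :
    ¬ IsOfFinAddOrder P :=
  not_isOfFinAddOrder_of_pointVal (pointVal_two_smul_of_neg hu hv hk) hn hP

theorem HasOddOrder.y_ne_zero (hW : IsSplit (legCurve u v) 0 (-u ^ 4) (-v ^ 4)) {x y : ℚ}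
    {h : (legCurve u v).toAffine.Nonsingular x y} (hP : HasOddOrder (Point.some x y h)) : y ≠ 0 :=
  fun hy => Point.some_ne_zero h (hP.eq_zero ((hW.two_smul_eq_zero_iff h).2 hy))

/-- Both x and u⁴ are 2-adic units, so x + u⁴ is even. It stands in the denominator of x(2P), which
acquires negative valuation. -/
theorem HasOddOrder.not_pointVal_zero (hu : HasVal 2 0 u) (hv : HasVal 2 k v) (hk : 2 ≤ k)
    {P : (legCurve u v).toAffine.Point} (hP : HasOddOrder P) : ¬ PointVal 2 0 0 P := by
  rintro ⟨x, y, h, rfl, hx⟩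
  have hW := isSplit_of_hasVal hu hv hk
  rw [sub_zero] at hx
  have hu4 : HasVal 2 0 (u ^ 4) := (hu.pow 4).congr (by ring)
  have hv4 : HasVal 2 (4 * k) (v ^ 4) := (hv.pow 4).congr (by ring)
  have hE := legCurve_equation hW h
  have hy := hP.y_ne_zero hW
  have hxu0 : x + u ^ 4 ≠ 0 := by
    intro h0
    rw [h0, mul_zero, zero_mul] at hE
    exact hy (pow_eq_zero_iff two_ne_zero |>.1 hE)
  obtain ⟨m, hm, hxu⟩ := (hx.add_of_two hu4).hasVal hxu0
  have := pointVal_two_smul hW h hx hxu (hx.add_valGE (hv4.valGE le_rfl) (by omega))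
    ((hx.pow 2).sub_valGE ((hu4.mul hv4).valGE le_rfl) (by push_cast; omega))
  exact not_isOfFinAddOrder_of_neg hu hv hk (by push_cast; omega) this (hP.smul 2).isOfFinAddOrder

/-- The numerator of x(2P) has valuation exactly 8k, while x and x + v⁴ together contribute at least
8k to the denominator and 4 contributes 2 more, so x(2P) has negative valuation. -/
theorem HasOddOrder.not_pointVal_of_ge (hu : HasVal 2 0 u) (hv : HasVal 2 k v) (hk : 2 ≤ k)
    {P : (legCurve u v).toAffine.Point} (hP : HasOddOrder P) {n : ℤ} (hn : 4 * k ≤ n) :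
    ¬ PointVal 2 0 n P := by
  rintro ⟨x, y, h, rfl, hx⟩
  have hW := isSplit_of_hasVal hu hv hk
  rw [sub_zero] at hx
  have hu4 : HasVal 2 0 (u ^ 4) := (hu.pow 4).congr (by ring)
  have hv4 : HasVal 2 (4 * k) (v ^ 4) := (hv.pow 4).congr (by ring)
  have hE := legCurve_equation hW h
  have hy := hP.y_ne_zero hW
  have hxv0 : x + v ^ 4 ≠ 0 := by
    intro h0
    rw [h0, mul_zero] at hE
    exact hy (pow_eq_zero_iff two_ne_zero |>.1 hE)
  obtain ⟨m, hm, hxv⟩ : ∃ m, 4 * k ≤ m ∧ HasVal 2 m (x + v ^ 4) :=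
    ((hx.valGE hn).add (hv4.valGE le_rfl)).hasVal hxv0
  have hmn : 4 * k < n + m := by omega
  have h4 : HasVal 2 (0 + 4 * k) (x ^ 2 - u ^ 4 * v ^ 4) := by
    rw [← neg_sub]
    exact ((hu4.mul hv4).sub_valGE ((hx.pow 2).valGE le_rfl) (by push_cast; omega)).neg
  have := pointVal_two_smul hW h hx ((hx.valGE le_rfl).add_hasVal hu4 (by omega)) hxv h4
  refine not_isOfFinAddOrder_of_neg hu hv hk ?_ this (hP.smul 2).isOfFinAddOrder
  -- If n = 4k the two terms of x + v⁴ have equal valuation and the sum gains at least 1; if n > 4k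
  -- then v⁴ dominates and m = 4k.
  rcases eq_or_lt_of_le hn with h | h
  · subst h
    have : 4 * k + 1 ≤ m := by
      have h' := hx.add_of_two hv4
      by_contra hlt
      exact hxv.not_valGE (by omega) h'
    omega
  · have : m = 4 * k := hxv.unique ((hx.valGE le_rfl).add_hasVal hv4 h)
    omega

/-- Now x and u²v² have the same valuation, so both factors of x² - u⁴v⁴ gain at least 1. Doubling
then lands in valuation at least 4k + 2, excluded by `not_pointVal_of_ge`; if x² = u⁴v⁴ it lands on
(0, 0), which has order 2. -/
theorem HasOddOrder.not_pointVal_two_mul (hu : HasVal 2 0 u) (hv : HasVal 2 k v) (hk : 2 ≤ k)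
    {P : (legCurve u v).toAffine.Point} (hP : HasOddOrder P) : ¬ PointVal 2 0 (2 * k) P := by
  rintro ⟨x, y, h, rfl, hx⟩
  have hW := isSplit_of_hasVal hu hv hk
  rw [sub_zero] at hx
  have hu4 : HasVal 2 0 (u ^ 4) := (hu.pow 4).congr (by ring)
  have hv4 : HasVal 2 (4 * k) (v ^ 4) := (hv.pow 4).congr (by ring)
  have huv : HasVal 2 (2 * k) (u ^ 2 * v ^ 2) := ((hu.pow 2).mul (hv.pow 2)).congr (by push_cast; ring)
  have h1 := hx.add_of_two huv
  have h2 := hx.add_of_two huv.neg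
  have e : x ^ 2 - u ^ 4 * v ^ 4 = (x + u ^ 2 * v ^ 2) * (x + -(u ^ 2 * v ^ 2)) := by ring
  by_cases h0 : x ^ 2 - u ^ 4 * v ^ 4 = 0
  · have hy := hP.y_ne_zero hW
    obtain ⟨x', y', h', H, H1, -⟩ := hW.two_smul_spec h hy
    have hx' : x' = 0 := by
      have : (x' - 0) * (2 * y) ^ 2 = 0 := by
        rw [H1, show (x - 0) ^ 2 - (0 - -u ^ 4) * (0 - -v ^ 4) = x ^ 2 - u ^ 4 * v ^ 4 by ring, h0]
        norm_num
      simpa [hy] using this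
    have hP2 := hP.smul 2
    rw [H] at hP2
    have hE' := legCurve_equation hW h'
    rw [hx', zero_mul, zero_mul] at hE'
    exact hP2.y_ne_zero hW (pow_eq_zero_iff two_ne_zero |>.1 hE')
  · obtain ⟨m, hm, hd⟩ : ∃ m, 4 * k + 2 ≤ m ∧ HasVal 2 m (x ^ 2 - u ^ 4 * v ^ 4) := by
      refine ValGE.hasVal ?_ h0
      rw [e]
      exact (h1.mul h2).mono (by omega)
    have := pointVal_two_smul hW h hx ((hx.valGE le_rfl).add_hasVal hu4 (by omega))
      (hx.add_valGE (hv4.valGE le_rfl) (by omega)) hd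
    exact (hP.smul 2).not_pointVal_of_ge hu hv hk (by omega) this

theorem pointVal_two_smul_of_lt (hu : HasVal 2 0 u) (hv : HasVal 2 k v) (hk : 2 ≤ k)
    {P : (legCurve u v).toAffine.Point} {n : ℤ} (h0 : 0 < n) (hn : n < 2 * k)
    (hP : PointVal 2 0 n P) : PointVal 2 0 (2 * n - 2) (2 • P) := by
  have hW := isSplit_of_hasVal hu hv hk
  obtain ⟨x, y, h, rfl, hx⟩ := hP
  rw [sub_zero] at hx
  have hu4 : HasVal 2 0 (u ^ 4) := (hu.pow 4).congr (by ring)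
  have hv4 : HasVal 2 (4 * k) (v ^ 4) := (hv.pow 4).congr (by ring)
  have := pointVal_two_smul hW h hx ((hx.valGE le_rfl).add_hasVal hu4 (by omega))
    (hx.add_valGE (hv4.valGE le_rfl) (by omega))
    ((hx.pow 2).sub_valGE ((hu4.mul hv4).valGE le_rfl) (by push_cast; omega))
  convert this using 1
  push_cast; ring

theorem pointVal_two_smul_of_gt (hu : HasVal 2 0 u) (hv : HasVal 2 k v) (hk : 2 ≤ k)
    {P : (legCurve u v).toAffine.Point} {n : ℤ} (h0 : 2 * k < n) (hn : n < 4 * k)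
    (hP : PointVal 2 0 n P) : PointVal 2 0 (8 * k - 2 - 2 * n) (2 • P) := by
  have hW := isSplit_of_hasVal hu hv hk
  obtain ⟨x, y, h, rfl, hx⟩ := hP
  rw [sub_zero] at hx
  have hu4 : HasVal 2 0 (u ^ 4) := (hu.pow 4).congr (by ring)
  have hv4 : HasVal 2 (4 * k) (v ^ 4) := (hv.pow 4).congr (by ring)
  have h4 : HasVal 2 (0 + 4 * k) (x ^ 2 - u ^ 4 * v ^ 4) := by
    rw [← neg_sub]
    exact ((hu4.mul hv4).sub_valGE ((hx.pow 2).valGE le_rfl) (by push_cast; omega)).neg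
  have := pointVal_two_smul hW h hx ((hx.valGE le_rfl).add_hasVal hu4 (by omega))
    (hx.add_valGE (hv4.valGE le_rfl) (by omega)) h4
  convert this using 1
  ring

/-- On the curve (y / x)² = x + u⁴ + v⁴ + u⁴v⁴ / x, which would be 1 + 4 modulo 8 and therefore not
the square of a 2-adic unit. -/
theorem not_pointVal_two (hu : HasVal 2 0 u) (hv : HasVal 2 k v) (hk : 2 ≤ k)
    (P : (legCurve u v).toAffine.Point) : ¬ PointVal 2 0 2 P := by
  rintro ⟨x, y, h, rfl, hx⟩
  have hW := isSplit_of_hasVal hu hv hk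
  rw [sub_zero] at hx
  have hu4 : HasVal 2 0 (u ^ 4) := (hu.pow 4).congr (by ring)
  have hv4 : HasVal 2 (4 * k) (v ^ 4) := (hv.pow 4).congr (by ring)
  have hE := legCurve_equation hW h
  have hx0 := hx.1
  have e : (y / x) ^ 2 - 1 = x + (((u ^ 2) ^ 2 - 1) + (v ^ 4 + u ^ 4 * v ^ 4 / x)) := by
    rw [div_pow, hE]
    field_simp
    ring
  have h1 : HasVal 2 2 ((y / x) ^ 2 - 1) := by
    rw [e]
    refine hx.add_valGE (n := 3) ?_ (by norm_num)
    refine ValGE.add ((hu.pow 2).congr (by ring)).sq_sub_one (ValGE.add (hv4.valGE (by omega)) ?_)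
    exact ((hu4.mul hv4).div hx).valGE (by omega)
  have h2 : HasVal 2 0 ((y / x) ^ 2) := by
    have := h1.valGE (m := 1) (by norm_num) |>.add_hasVal hasVal_one (by norm_num)
    rwa [sub_add_cancel] at this
  have hyx : y / x ≠ 0 := by
    intro h0
    exact h2.1 (by rw [h0]; norm_num)
  obtain ⟨m, hm⟩ := exists_hasVal 2 hyx
  have : m = 0 := by
    have := (hm.pow 2).unique h2
    push_cast at this
    omega
  subst this
  exact h1.not_valGE (by norm_num) hm.sq_sub_one

theorem HasOddOrder.exists_pointVal (hW : IsSplit (legCurve u v) 0 (-u ^ 4) (-v ^ 4))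
    {P : (legCurve u v).toAffine.Point} (hP : HasOddOrder P) (hP0 : P ≠ 0) :
    ∃ n, PointVal 2 0 n P := by
  rcases P with _ | ⟨x, y, h⟩
  · exact absurd rfl hP0
  have hx0 : x ≠ 0 := by
    rintro rfl
    have hE := legCurve_equation hW h
    rw [zero_mul, zero_mul] at hE
    exact hP.y_ne_zero hW (pow_eq_zero_iff two_ne_zero |>.1 hE)
  obtain ⟨n, hn⟩ := exists_hasVal 2 hx0
  exact ⟨n, x, y, h, rfl, by rwa [sub_zero]⟩

/-- The rules n ↦ 2n - 2 below 6 and n ↦ 22 - 2n above 6 lead each n in [0, 12) to one of the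
excluded values 0, 2, 6. -/
theorem HasOddOrder.eq_zero_of_three (hu : HasVal 2 0 u) (hv : HasVal 2 3 v)
    {P : (legCurve u v).toAffine.Point} (hP : HasOddOrder P) : P = 0 := by
  have hk : (2 : ℤ) ≤ 3 := by norm_num
  by_contra hP0
  obtain ⟨n, hn'⟩ := hP.exists_pointVal (isSplit_of_hasVal hu hv hk) hP0
  have lo : ∀ {P : (legCurve u v).toAffine.Point} (n : ℤ), 0 < n → n < 6 → PointVal 2 0 n P →
    PointVal 2 0 (2 * n - 2) (2 • P) := fun n h h' => pointVal_two_smul_of_lt hu hv hk h (by omega)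
  have hi : ∀ {P : (legCurve u v).toAffine.Point} (n : ℤ), 6 < n → n < 12 → PointVal 2 0 n P →
    PointVal 2 0 (22 - 2 * n) (2 • P) := fun n h h' h'' => by
      convert pointVal_two_smul_of_gt hu hv hk (by omega) (by omega) h'' using 1
      ring
  have c6 : ∀ {P : (legCurve u v).toAffine.Point}, HasOddOrder P → ¬ PointVal 2 0 6 P :=
    fun hP => hP.not_pointVal_two_mul hu hv hk
  have c4 : ∀ {P : (legCurve u v).toAffine.Point}, HasOddOrder P → ¬ PointVal 2 0 4 P :=
    fun hP h => c6 (hP.smul 2) (lo 4 (by norm_num) (by norm_num) h)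
  have c8 : ∀ {P : (legCurve u v).toAffine.Point}, HasOddOrder P → ¬ PointVal 2 0 8 P :=
    fun hP h => c6 (hP.smul 2) (hi 8 (by norm_num) (by norm_num) h)
  rcases lt_or_ge n 0 with h | h
  · exact not_isOfFinAddOrder_of_neg hu hv hk h hn' hP.isOfFinAddOrder
  rcases le_or_gt 12 n with h' | h'
  · exact hP.not_pointVal_of_ge hu hv hk (by omega) hn'
  interval_cases n
  · exact hP.not_pointVal_zero hu hv hk hn'
  · exact (hP.smul 2).not_pointVal_zero hu hv hk (lo 1 (by norm_num) (by norm_num) hn')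
  · exact not_pointVal_two hu hv hk _ hn'
  · exact c4 (hP.smul 2) (lo 3 (by norm_num) (by norm_num) hn')
  · exact c4 hP hn'
  · exact c8 (hP.smul 2) (lo 5 (by norm_num) (by norm_num) hn')
  · exact c6 hP hn'
  · exact c8 (hP.smul 2) (hi 7 (by norm_num) (by norm_num) hn')
  · exact c8 hP hn'
  · exact c4 (hP.smul 2) (hi 9 (by norm_num) (by norm_num) hn')
  · exact not_pointVal_two hu hv hk _ (hi 10 (by norm_num) (by norm_num) hn')
  · exact (hP.smul 2).not_pointVal_zero hu hv hk (hi 11 (by norm_num) (by norm_num) hn')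

/-- The same orbit chase with n ↦ 2n - 2 and n ↦ 38 - 2n; all orbits in [0, 20) reach 0, 2 or 10. -/
theorem HasOddOrder.eq_zero_of_five (hu : HasVal 2 0 u) (hv : HasVal 2 5 v)
    {P : (legCurve u v).toAffine.Point} (hP : HasOddOrder P) : P = 0 := by
  have hk : (2 : ℤ) ≤ 5 := by norm_num
  by_contra hP0
  obtain ⟨n, hn'⟩ := hP.exists_pointVal (isSplit_of_hasVal hu hv hk) hP0
  have lo : ∀ {P : (legCurve u v).toAffine.Point} (n : ℤ), 0 < n → n < 10 → PointVal 2 0 n P →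
    PointVal 2 0 (2 * n - 2) (2 • P) := fun n h h' => pointVal_two_smul_of_lt hu hv hk h (by omega)
  have hi : ∀ {P : (legCurve u v).toAffine.Point} (n : ℤ), 10 < n → n < 20 → PointVal 2 0 n P →
    PointVal 2 0 (38 - 2 * n) (2 • P) := fun n h h' h'' => by
      convert pointVal_two_smul_of_gt hu hv hk (by omega) (by omega) h'' using 1
      ring
  have c10 : ∀ {P : (legCurve u v).toAffine.Point}, HasOddOrder P → ¬ PointVal 2 0 10 P :=
    fun hP => hP.not_pointVal_two_mul hu hv hk
  have c6 : ∀ {P : (legCurve u v).toAffine.Point}, HasOddOrder P → ¬ PointVal 2 0 6 P :=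
    fun hP h => c10 (hP.smul 2) (lo 6 (by norm_num) (by norm_num) h)
  have c4 : ∀ {P : (legCurve u v).toAffine.Point}, HasOddOrder P → ¬ PointVal 2 0 4 P :=
    fun hP h => c6 (hP.smul 2) (lo 4 (by norm_num) (by norm_num) h)
  have c14 : ∀ {P : (legCurve u v).toAffine.Point}, HasOddOrder P → ¬ PointVal 2 0 14 P :=
    fun hP h => c10 (hP.smul 2) (hi 14 (by norm_num) (by norm_num) h)
  have c8 : ∀ {P : (legCurve u v).toAffine.Point}, HasOddOrder P → ¬ PointVal 2 0 8 P :=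
    fun hP h => c14 (hP.smul 2) (lo 8 (by norm_num) (by norm_num) h)
  have c12 : ∀ {P : (legCurve u v).toAffine.Point}, HasOddOrder P → ¬ PointVal 2 0 12 P :=
    fun hP h => c14 (hP.smul 2) (hi 12 (by norm_num) (by norm_num) h)
  have c16 : ∀ {P : (legCurve u v).toAffine.Point}, HasOddOrder P → ¬ PointVal 2 0 16 P :=
    fun hP h => c6 (hP.smul 2) (hi 16 (by norm_num) (by norm_num) h)
  rcases lt_or_ge n 0 with h | h
  · exact not_isOfFinAddOrder_of_neg hu hv hk h hn' hP.isOfFinAddOrder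
  rcases le_or_gt 20 n with h' | h'
  · exact hP.not_pointVal_of_ge hu hv hk (by omega) hn'
  interval_cases n
  · exact hP.not_pointVal_zero hu hv hk hn'
  · exact (hP.smul 2).not_pointVal_zero hu hv hk (lo 1 (by norm_num) (by norm_num) hn')
  · exact not_pointVal_two hu hv hk _ hn'
  · exact c4 (hP.smul 2) (lo 3 (by norm_num) (by norm_num) hn')
  · exact c4 hP hn'
  · exact c8 (hP.smul 2) (lo 5 (by norm_num) (by norm_num) hn')
  · exact c6 hP hn'
  · exact c12 (hP.smul 2) (lo 7 (by norm_num) (by norm_num) hn')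
  · exact c8 hP hn'
  · exact c16 (hP.smul 2) (lo 9 (by norm_num) (by norm_num) hn')
  · exact c10 hP hn'
  · exact c16 (hP.smul 2) (hi 11 (by norm_num) (by norm_num) hn')
  · exact c12 hP hn'
  · exact c12 (hP.smul 2) (hi 13 (by norm_num) (by norm_num) hn')
  · exact c14 hP hn'
  · exact c8 (hP.smul 2) (hi 15 (by norm_num) (by norm_num) hn')
  · exact c16 hP hn'
  · exact c4 (hP.smul 2) (hi 17 (by norm_num) (by norm_num) hn')
  · exact not_pointVal_two hu hv hk _ (hi 18 (by norm_num) (by norm_num) hn')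
  · exact (hP.smul 2).not_pointVal_zero hu hv hk (hi 19 (by norm_num) (by norm_num) hn')

/-- For k = 4 the rule n ↦ 30 - 2n fixes 10, so an orbit that avoids the excluded values 0, 2, 8
ends there instead of in a contradiction. -/
theorem HasOddOrder.exists_pointVal_ten (hu : HasVal 2 0 u) (hv : HasVal 2 4 v)
    {P : (legCurve u v).toAffine.Point} (hP : HasOddOrder P) (hP0 : P ≠ 0) :
    ∃ i : ℕ, PointVal 2 0 10 (i • P) := by
  have hk : (2 : ℤ) ≤ 4 := by norm_num
  obtain ⟨n, hn'⟩ := hP.exists_pointVal (isSplit_of_hasVal hu hv hk) hP0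
  have lo : ∀ {P : (legCurve u v).toAffine.Point} (n : ℤ), 0 < n → n < 8 → PointVal 2 0 n P →
    PointVal 2 0 (2 * n - 2) (2 • P) := fun n h h' => pointVal_two_smul_of_lt hu hv hk h (by omega)
  have hi : ∀ {P : (legCurve u v).toAffine.Point} (n : ℤ), 8 < n → n < 16 → PointVal 2 0 n P →
    PointVal 2 0 (30 - 2 * n) (2 • P) := fun n h h' h'' => by
      convert pointVal_two_smul_of_gt hu hv hk (by omega) (by omega) h'' using 1
      ring
  have c8 : ∀ {P : (legCurve u v).toAffine.Point}, HasOddOrder P → ¬ PointVal 2 0 8 P :=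
    fun hP => hP.not_pointVal_two_mul hu hv hk
  have db : ∀ {P : (legCurve u v).toAffine.Point}, (∃ i : ℕ, PointVal 2 0 10 (i • 2 • P)) →
      ∃ i : ℕ, PointVal 2 0 10 (i • P) := by
    rintro P ⟨i, h⟩
    exact ⟨i * 2, by rwa [mul_smul]⟩
  have c10 : ∀ {P : (legCurve u v).toAffine.Point}, PointVal 2 0 10 P →
      ∃ i : ℕ, PointVal 2 0 10 (i • P) := fun h => ⟨1, by rwa [one_smul]⟩
  have c6 : ∀ {P : (legCurve u v).toAffine.Point}, PointVal 2 0 6 P →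
      ∃ i : ℕ, PointVal 2 0 10 (i • P) := fun h => db (c10 (lo 6 (by norm_num) (by norm_num) h))
  have c4 : ∀ {P : (legCurve u v).toAffine.Point}, PointVal 2 0 4 P →
      ∃ i : ℕ, PointVal 2 0 10 (i • P) := fun h => db (c6 (lo 4 (by norm_num) (by norm_num) h))
  have c12 : ∀ {P : (legCurve u v).toAffine.Point}, PointVal 2 0 12 P →
      ∃ i : ℕ, PointVal 2 0 10 (i • P) := fun h => db (c6 (hi 12 (by norm_num) (by norm_num) h))
  rcases lt_or_ge n 0 with h | h
  · exact absurd hP.isOfFinAddOrder (not_isOfFinAddOrder_of_neg hu hv hk h hn')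
  rcases le_or_gt 16 n with h' | h'
  · exact absurd hn' (hP.not_pointVal_of_ge hu hv hk (by omega))
  interval_cases n
  · exact absurd hn' (hP.not_pointVal_zero hu hv hk)
  · exact absurd (lo 1 (by norm_num) (by norm_num) hn') ((hP.smul 2).not_pointVal_zero hu hv hk)
  · exact absurd hn' (not_pointVal_two hu hv hk _)
  · exact db (c4 (lo 3 (by norm_num) (by norm_num) hn'))
  · exact c4 hn'
  · exact absurd (lo 5 (by norm_num) (by norm_num) hn') (c8 (hP.smul 2))
  · exact c6 hn'
  · exact db (c12 (lo 7 (by norm_num) (by norm_num) hn'))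
  · exact absurd hn' (c8 hP)
  · exact db (c12 (hi 9 (by norm_num) (by norm_num) hn'))
  · exact c10 hn'
  · exact absurd (hi 11 (by norm_num) (by norm_num) hn') (c8 (hP.smul 2))
  · exact c12 hn'
  · exact db (c4 (hi 13 (by norm_num) (by norm_num) hn'))
  · exact absurd (hi 14 (by norm_num) (by norm_num) hn') (not_pointVal_two hu hv hk _)
  · exact absurd (hi 15 (by norm_num) (by norm_num) hn') ((hP.smul 2).not_pointVal_zero hu hv hk)

theorem legCurve_add_mul_sub (hW : IsSplit (legCurve u v) 0 (-u ^ 4) (-v ^ 4)) {x₁ y₁ x₂ y₂ : ℚ}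
    (h₁ : (legCurve u v).toAffine.Nonsingular x₁ y₁) (h₂ : (legCurve u v).toAffine.Nonsingular x₂ y₂)
    (hx : x₁ ≠ x₂) :
    ∃ x₃ y₃ h₃ x₄ y₄ h₄, Point.some x₁ y₁ h₁ + Point.some x₂ y₂ h₂ = Point.some x₃ y₃ h₃ ∧
      Point.some x₁ y₁ h₁ - Point.some x₂ y₂ h₂ = Point.some x₄ y₄ h₄ ∧
      x₃ * x₄ * (x₁ - x₂) ^ 2 = (x₁ * x₂ - u ^ 4 * v ^ 4) ^ 2 := by
  obtain ⟨x₃, y₃, h₃, x₄, y₄, h₄, H3, H4, E3, E4⟩ := hW.exists_add_sub_of_X_ne h₁ h₂ hx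
  refine ⟨x₃, y₃, h₃, x₄, y₄, h₄, H3, H4, ?_⟩
  have hE₁ := legCurve_equation hW h₁
  have hE₂ := legCurve_equation hW h₂
  have hc : (x₁ - x₂) ^ 2 ≠ 0 := pow_ne_zero 2 (sub_ne_zero.2 hx)
  apply mul_left_cancel₀ hc
  have P3 : x₃ * (x₁ - x₂) ^ 2 = (y₁ - y₂) ^ 2 - (x₁ + x₂ + u ^ 4 + v ^ 4) * (x₁ - x₂) ^ 2 := by
    linear_combination E3
  have P4 : x₄ * (x₁ - x₂) ^ 2 = (y₁ + y₂) ^ 2 - (x₁ + x₂ + u ^ 4 + v ^ 4) * (x₁ - x₂) ^ 2 := by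
    linear_combination E4
  have P5 : (x₁ - x₂) ^ 2 * (x₃ * x₄ * (x₁ - x₂) ^ 2) =
      (y₁ ^ 2 - y₂ ^ 2) ^ 2 - 2 * (x₁ + x₂ + u ^ 4 + v ^ 4) * (x₁ - x₂) ^ 2 * (y₁ ^ 2 + y₂ ^ 2) +
      ((x₁ + x₂ + u ^ 4 + v ^ 4) * (x₁ - x₂) ^ 2) ^ 2 := by
    rw [show (x₁ - x₂) ^ 2 * (x₃ * x₄ * (x₁ - x₂) ^ 2) =
      (x₃ * (x₁ - x₂) ^ 2) * (x₄ * (x₁ - x₂) ^ 2) by ring, P3, P4]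
    ring
  rw [P5, hE₁, hE₂]
  ring

/-- A multiple P has v₂(x(P)) = v₂(x(2P)) = 10, so x(2P) - x(P) has valuation at least 11. In x(3P)
x(P) (x(2P) - x(P))² = (x(P) x(2P) - u⁴v⁴)² the right side has valuation 32, hence v₂(x(3P)) ≤ 0,
which is excluded. The case x(2P) = x(P) means that x(P) is a root of the 3-division polynomial,
which `h3` rules out. -/
theorem HasOddOrder.eq_zero_of_four (hu : HasVal 2 0 u) (hv : HasVal 2 4 v)
    (h3 : ∀ x : ℚ, 3 * x ^ 4 + 4 * (u ^ 4 + v ^ 4) * x ^ 3 + 6 * (u ^ 4 * v ^ 4) * x ^ 2 -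
      (u ^ 4 * v ^ 4) ^ 2 ≠ 0)
    {P : (legCurve u v).toAffine.Point} (hP : HasOddOrder P) : P = 0 := by
  have hk : (2 : ℤ) ≤ 4 := by norm_num
  have hW := isSplit_of_hasVal hu hv hk
  by_contra hP0
  obtain ⟨i, hi⟩ := hP.exists_pointVal_ten hu hv hP0
  replace hP := hP.smul i
  generalize i • P = P at hP hi
  have h2 : PointVal 2 0 10 (2 • P) := by
    convert pointVal_two_smul_of_gt hu hv hk (by norm_num) (by norm_num) hi using 1
    norm_num
  have hP2 := hP.smul 2
  have hP3 := hP.smul 3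
  obtain ⟨x₁, y₁, h₁, rfl, hx₁⟩ := hi
  obtain ⟨x₂, y₂, h₂, e₂, hx₂⟩ := h2
  have hy₁ := hP.y_ne_zero hW
  obtain ⟨x', y', h', H, H1, -⟩ := hW.two_smul_spec h₁ hy₁
  rw [H] at e₂
  simp only [Point.some.injEq] at e₂
  obtain ⟨rfl, rfl⟩ := e₂
  have hE₁ := legCurve_equation hW h₁
  rw [sub_zero] at hx₁ hx₂
  have hu4 : HasVal 2 0 (u ^ 4) := (hu.pow 4).congr (by ring)
  have hv4 : HasVal 2 16 (v ^ 4) := (hv.pow 4).congr (by norm_num)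
  by_cases hx : x' = x₁
  · subst hx
    apply h3 x'
    have : 4 * (x' * (x' * (x' + u ^ 4) * (x' + v ^ 4))) = (x' ^ 2 - u ^ 4 * v ^ 4) ^ 2 := by
      rw [← hE₁]
      linear_combination H1
    linear_combination this
  · obtain ⟨x₃, y₃, h₃, x₄, y₄, h₄, H3, H4, E⟩ := legCurve_add_mul_sub hW h' h₁ hx
    rw [← H] at H3 H4
    have e3 : 3 • Point.some x₁ y₁ h₁ = Point.some x₃ y₃ h₃ := by
      rw [← H3, show 3 = 2 + 1 by rfl, add_smul, one_smul]
    have e4 : Point.some x₁ y₁ h₁ = Point.some x₄ y₄ h₄ := by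
      rw [← H4, two_nsmul, add_sub_cancel_right]
    simp only [Point.some.injEq] at e4
    obtain ⟨rfl, rfl⟩ := e4
    obtain ⟨m, hm, hd⟩ := (hx₂.add_of_two hx₁.neg).hasVal (by rwa [← sub_eq_add_neg, sub_ne_zero])
    rw [← sub_eq_add_neg] at hd
    have hR : HasVal 2 16 (x' * x₁ - u ^ 4 * v ^ 4) := by
      rw [← neg_sub]
      exact ((hu4.mul hv4).sub_valGE ((hx₂.mul hx₁).valGE le_rfl) (by norm_num)).neg
    have hR2 := hR.pow 2
    rw [← E] at hR2
    have hx₃ := (hR2.of_mul (hd.pow 2)).of_mul hx₁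
    rw [e3] at hP3
    have hv3 : PointVal 2 0 _ (Point.some x₃ y₃ h₃) := ⟨x₃, y₃, h₃, rfl, by rw [sub_zero]; exact hx₃⟩
    push_cast at hv3
    rcases lt_or_eq_of_le (show 32 - 2 * m - 10 ≤ 0 by omega) with h | h
    · exact not_isOfFinAddOrder_of_neg hu hv hk h hv3 hP3.isOfFinAddOrder
    · rw [h] at hv3
      exact hP3.not_pointVal_zero hu hv hk hv3

end LegCurve

/-! ### Points of order two and affine changes of coordinate. -/

namespace IsSplit

variable {W W' : WeierstrassCurve ℚ} {e₁ e₂ e₃ : ℚ}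

theorem some_congr {x y x' y' : ℚ} {h : W.toAffine.Nonsingular x y}
    {h' : W.toAffine.Nonsingular x' y'} (hx : x = x') (hy : y = y') :
    Point.some x y h = Point.some x' y' h' := by
  subst hx hy; rfl

theorem exists_half_eq (h : IsSplit W e₁ e₂ e₃) {x y xq yq r₁ r₂ r₃ : ℚ} (h₁ : x - e₁ = r₁ ^ 2)
    (h₂ : x - e₂ = r₂ ^ 2) (h₃ : x - e₃ = r₃ ^ 2) (hp : W.toAffine.Nonsingular x y)
    (hy : y = r₁ * r₂ * r₃) (hxq : xq = x + r₁ * r₂ + r₁ * r₃ + r₂ * r₃)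
    (hyq : yq = (r₁ + r₂) * (r₁ + r₃) * (r₂ + r₃)) :
    ∃ hq, 2 • Point.some xq yq hq = Point.some x y hp := by
  subst hy hxq hyq
  exact h.exists_half h₁ h₂ h₃ hp

theorem nonsingular_root (h : IsSplit W e₁ e₂ e₃) : W.toAffine.Nonsingular e₁ 0 := by
  rw [h.nonsingular_iff]; ring

theorem eq_root_of_y_eq_zero (h : IsSplit W e₁ e₂ e₃) {x : ℚ} (hp : W.toAffine.Nonsingular x 0) :
    x = e₁ ∨ x = e₂ ∨ x = e₃ := by
  have := h.nonsingular_iff.1 hp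
  rw [zero_pow two_ne_zero, eq_comm, mul_eq_zero, mul_eq_zero, sub_eq_zero, sub_eq_zero,
    sub_eq_zero, or_assoc] at this
  exact this

theorem eq_of_two_smul_eq_zero (h : IsSplit W e₁ e₂ e₃) {P : W.toAffine.Point} (hP : 2 • P = 0) :
    P = 0 ∨ P = Point.some e₁ 0 h.nonsingular_root ∨
      P = Point.some e₂ 0 h.swap₁₂.nonsingular_root ∨
      P = Point.some e₃ 0 h.rotate.nonsingular_root := by
  rcases P with _ | ⟨x, y, hp⟩
  · exact Or.inl rfl
  right
  obtain rfl := (h.two_smul_eq_zero_iff hp).1 hP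
  rcases h.eq_root_of_y_eq_zero hp with H | H | H
  · exact Or.inl (some_congr H rfl)
  · exact Or.inr (Or.inl (some_congr H rfl))
  · exact Or.inr (Or.inr (some_congr H rfl))

theorem two_smul_root (h : IsSplit W e₁ e₂ e₃) :
    2 • Point.some e₁ 0 h.nonsingular_root = 0 :=
  (h.two_smul_eq_zero_iff _).2 rfl

theorem root_add_root (h : IsSplit W e₁ e₂ e₃) :
    Point.some e₂ 0 h.swap₁₂.nonsingular_root + Point.some e₁ 0 h.nonsingular_root =
      Point.some e₃ 0 h.rotate.nonsingular_root := by
  have h2 : 2 • (Point.some e₂ 0 h.swap₁₂.nonsingular_root +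
      Point.some e₁ 0 h.nonsingular_root) = 0 := by
    rw [nsmul_add, h.two_smul_root, h.swap₁₂.two_smul_root, add_zero]
  rcases h.eq_of_two_smul_eq_zero h2 with H | H | H | H
  · exact absurd H (h.add_some_ne_zero _ _ (fun H' => h.ne₁₂ H'.1.symm))
  · exact absurd (add_eq_right.1 H) (Point.some_ne_zero _)
  · exact absurd (add_eq_left.1 H) (Point.some_ne_zero _)
  · exact H

/-- The map on points induced by an affine change of the `x`-coordinate. -/
def scaleFun (h : IsSplit W e₁ e₂ e₃) {m r : ℚ}
    (h' : IsSplit W' (m ^ 2 * e₁ + r) (m ^ 2 * e₂ + r) (m ^ 2 * e₃ + r)) :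
    W.toAffine.Point → W'.toAffine.Point
  | .zero => 0
  | .some x y hp => .some (m ^ 2 * x + r) (m ^ 3 * y) (by
      rw [h'.nonsingular_iff]
      linear_combination m ^ 6 * h.nonsingular_iff.1 hp)

theorem scaleFun_add (h : IsSplit W e₁ e₂ e₃) {m r : ℚ} (hm : m ≠ 0)
    (h' : IsSplit W' (m ^ 2 * e₁ + r) (m ^ 2 * e₂ + r) (m ^ 2 * e₃ + r)) (P Q : W.toAffine.Point) :
    h.scaleFun h' (P + Q) = h.scaleFun h' P + h.scaleFun h' Q := by
  rcases P with _ | ⟨x₁, y₁, h₁⟩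
  · change h.scaleFun h' (0 + Q) = 0 + h.scaleFun h' Q
    rw [zero_add, zero_add]
  rcases Q with _ | ⟨x₂, y₂, h₂⟩
  · change h.scaleFun h' (_ + 0) = h.scaleFun h' _ + 0
    rw [add_zero, add_zero]
  by_cases hxy : x₁ = x₂ ∧ y₁ = -y₂
  · rw [h.add_eq_zero h₁ h₂ hxy.1 hxy.2]
    refine (h'.add_eq_zero _ _ (by rw [hxy.1]) ?_).symm
    rw [hxy.2]; ring
  · have hxy' : ¬(m ^ 2 * x₁ + r = m ^ 2 * x₂ + r ∧ m ^ 3 * y₁ = -(m ^ 3 * y₂)) := by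
      rintro ⟨H, H'⟩
      refine hxy ⟨?_, ?_⟩
      · exact mul_left_cancel₀ (pow_ne_zero 2 hm) (add_right_cancel H)
      · apply mul_left_cancel₀ (pow_ne_zero 3 hm)
        rw [H']; ring
    obtain ⟨l, x₃, y₃, h₃, H, H1, H2, H3, H4⟩ := h.add_spec h₁ h₂ hxy
    have H' := h'.add_spec (x₁ := m ^ 2 * x₁ + r) (y₁ := m ^ 3 * y₁) (x₂ := m ^ 2 * x₂ + r)
      (y₂ := m ^ 3 * y₂)
      (by rw [h'.nonsingular_iff]; linear_combination m ^ 6 * h.nonsingular_iff.1 h₁)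
      (by rw [h'.nonsingular_iff]; linear_combination m ^ 6 * h.nonsingular_iff.1 h₂) hxy'
    obtain ⟨l', x₃', y₃', h₃', H', H1', H2', H3', H4'⟩ := H'
    -- Slopes scale by m for chords and tangents alike; the coordinates of the sum then follow from
    -- the chord formulas.
    have hl : l' = m * l := by
      by_cases hx : x₁ = x₂
      · subst hx
        obtain rfl := H4 rfl
        have hy : y₁ ≠ 0 := fun h0 => hxy ⟨rfl, by rw [h0]; ring⟩
        have e := (h.slope_self H1).1
        have e' := (h'.slope_self H1').1
        apply mul_left_cancel₀ (mul_ne_zero (mul_ne_zero two_ne_zero hy) (pow_ne_zero 3 hm))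
        linear_combination e' - m ^ 4 * e
      · have e := H3 hx
        have e' := H3' (fun h0 => hx (mul_left_cancel₀ (pow_ne_zero 2 hm) (add_right_cancel h0)))
        apply mul_left_cancel₀ (mul_ne_zero (sub_ne_zero.2 hx) (pow_ne_zero 2 hm))
        linear_combination e' - m ^ 3 * e
    have hx₃ : x₃' = m ^ 2 * x₃ + r := by
      have e : x₃ + x₁ + x₂ - e₁ - e₂ - e₃ = l ^ 2 := by
        linear_combination (1 / 2) * (H1 1 - 2 * H1 0 + H1 (-1))
      have e' : x₃' + (m ^ 2 * x₁ + r) + (m ^ 2 * x₂ + r) - (m ^ 2 * e₁ + r) - (m ^ 2 * e₂ + r) -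
          (m ^ 2 * e₃ + r) = l' ^ 2 := by
        linear_combination (1 / 2) * (H1' 1 - 2 * H1' 0 + H1' (-1))
      rw [hl] at e'
      linear_combination e' - m ^ 2 * e
    have hy₃ : y₃' = m ^ 3 * y₃ := by
      rw [H2', H2, hl, hx₃]; ring
    rw [H]
    refine Eq.trans ?_ H'.symm
    exact some_congr hx₃.symm hy₃.symm

theorem exists_scale_equiv (h : IsSplit W e₁ e₂ e₃) {m r : ℚ} (hm : m ≠ 0)
    (h' : IsSplit W' (m ^ 2 * e₁ + r) (m ^ 2 * e₂ + r) (m ^ 2 * e₃ + r)) :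
    ∃ φ : W.toAffine.Point ≃+ W'.toAffine.Point, ∀ x y hp, ∃ hp',
      φ (Point.some x y hp) = Point.some (m ^ 2 * x + r) (m ^ 3 * y) hp' := by
  let f : W.toAffine.Point →+ W'.toAffine.Point :=
    AddMonoidHom.mk' (h.scaleFun h') (h.scaleFun_add hm h')
  refine ⟨AddEquiv.ofBijective f ⟨?_, ?_⟩, fun x y hp => ⟨_, rfl⟩⟩
  · rw [injective_iff_map_eq_zero]
    rintro (_ | ⟨x, y, hp⟩) H
    · rfl
    · exact absurd H (Point.some_ne_zero _)
  · rintro (_ | ⟨x, y, hp⟩)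
    · exact ⟨0, rfl⟩
    · refine ⟨Point.some ((x - r) / m ^ 2) (y / m ^ 3) ?_, ?_⟩
      · rw [h.nonsingular_iff]
        have := h'.nonsingular_iff.1 hp
        field_simp
        linear_combination this
      · exact some_congr (by field_simp; ring) (by field_simp)

end IsSplit

section Parity

variable {G : Type*} [AddCommGroup G] (T R : G) (i j : ℤ)

theorem zsmul_add_zsmul_even_even :
    (2 * i) • T + (2 * j) • R = 0 + 2 • (i • T + j • R) := by module

theorem zsmul_add_zsmul_even_odd :
    (2 * i) • T + (2 * j + 1) • R = R + 2 • (i • T + j • R) := by module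

theorem zsmul_add_zsmul_odd_even :
    (2 * i + 1) • T + (2 * j) • R = T + 2 • (i • T + j • R) := by module

theorem zsmul_add_zsmul_odd_odd :
    (2 * i + 1) • T + (2 * j + 1) • R = R + T + 2 • (i • T + j • R) := by module

end Parity

/-! ### Torsion ℤ/2 × ℤ/8 when u² + v² is a square. -/

section LegCurve

variable {u v t : ℚ}

/-- The points generating the torsion subgroup of the curve attached to a Pythagorean triple. -/
theorem legCurve_exists_order_eight (hW : IsSplit (legCurve u v) 0 (-u ^ 4) (-v ^ 4))
    (ht : u ^ 2 + v ^ 2 = t ^ 2) :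
    ∃ y h, 4 • Point.some (u * v * (u + t) * (v + t)) y h =
      Point.some 0 0 hW.nonsingular_root := by
  have hS : (legCurve u v).toAffine.Nonsingular (u ^ 2 * v ^ 2) (u ^ 2 * v ^ 2 * t ^ 2) := by
    rw [hW.nonsingular_iff, ← ht]; ring
  obtain ⟨_, H1⟩ := hW.exists_half_eq (x := 0) (y := 0) (xq := u ^ 2 * v ^ 2)
    (yq := u ^ 2 * v ^ 2 * t ^ 2) (r₁ := 0) (r₂ := u ^ 2) (r₃ := v ^ 2) (by ring) (by ring) (by ring)
    hW.nonsingular_root (by ring) (by ring) (by rw [← ht]; ring)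
  obtain ⟨h, H2⟩ := hW.exists_half_eq (x := u ^ 2 * v ^ 2) (y := u ^ 2 * v ^ 2 * t ^ 2)
    (xq := u * v * (u + t) * (v + t)) (r₁ := u * v) (r₂ := u * t) (r₃ := v * t) (by ring)
    (by rw [mul_pow u t, ← ht]; ring) (by rw [mul_pow v t, ← ht]; ring) hS (by ring)
    (by ring) rfl
  refine ⟨_, h, ?_⟩
  exact (mul_nsmul _ 2 2).trans (by rw [H2, H1])

theorem legCurve_root_ne (hW : IsSplit (legCurve u v) 0 (-u ^ 4) (-v ^ 4))
    {R : (legCurve u v).toAffine.Point} (hR : 4 • R = Point.some 0 0 hW.nonsingular_root) :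
    8 • R = 0 ∧ 4 • R ≠ 0 ∧ Point.some (-u ^ 4) 0 hW.swap₁₂.nonsingular_root ≠ 4 • R := by
  refine ⟨?_, ?_, ?_⟩
  · exact (mul_nsmul _ 4 2).trans (by rw [hR, hW.two_smul_root])
  · rw [hR]; exact Point.some_ne_zero _
  · rw [hR]
    intro H
    simp only [Point.some.injEq] at H
    exact hW.ne₁₂ H.1.symm

theorem legCurve_exists_hom (hW : IsSplit (legCurve u v) 0 (-u ^ 4) (-v ^ 4))
    (ht : u ^ 2 + v ^ 2 = t ^ 2) :
    ∃ f : ZMod 2 × ZMod 8 →+ (legCurve u v).toAffine.Point, Function.Injective f := by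
  obtain ⟨y, h, H⟩ := legCurve_exists_order_eight hW ht
  obtain ⟨h1, h2, h3⟩ := legCurve_root_ne hW H
  obtain ⟨f, hf, -⟩ := exists_twoEight_hom h1 h2 hW.swap₁₂.two_smul_root (Point.some_ne_zero _) h3
  exact ⟨f, hf⟩

theorem isSquare_mul_sq_iff {a r : ℚ} (hr : r ≠ 0) : IsSquare (a * r ^ 2) ↔ IsSquare a := by
  constructor
  · rintro ⟨s, hs⟩
    exact ⟨s / r, by field_simp; linear_combination hs⟩
  · rintro ⟨s, rfl⟩
    exact ⟨s * r, by ring⟩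

/-- Everything is read off from the class of x modulo squares. The torsion classes are 1, 2uv, -1,
-2uv, so ±2uv decide which torsion points are doubles, and ±uv decide whether the class uv can
belong to a torsion point. -/
theorem legCurve_torsion (hW : IsSplit (legCurve u v) 0 (-u ^ 4) (-v ^ 4))
    (ht : u ^ 2 + v ^ 2 = t ^ 2) (hodd : ∀ P : (legCurve u v).toAffine.Point, HasOddOrder P → P = 0)
    (h₁ : ¬ IsSquare (2 * (u * v))) (h₂ : ¬ IsSquare (-(2 * (u * v)))) :
    HasTorsionTwoEight (legCurve u v) ∧
      (¬ IsSquare (u * v) → ¬ IsSquare (-(u * v)) → ∀ Q : (legCurve u v).toAffine.Point,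
        (∃ r : ℚ, r ≠ 0 ∧ descentMap 0 (-u ^ 4) (-v ^ 4) Q = u * v * r ^ 2) →
        ¬ IsOfFinAddOrder Q) := by
  obtain ⟨y, h, H⟩ := legCurve_exists_order_eight hW ht
  obtain ⟨H1, H2, H3⟩ := legCurve_root_ne hW H
  have hu : u ≠ 0 := by
    rintro rfl
    exact hW.ne₁₂ (by norm_num)
  have hx : u * v * (u + t) * (v + t) ≠ 0 := by
    intro h0
    have hE := legCurve_equation hW h
    rw [h0, zero_mul, zero_mul] at hE
    have : 2 • Point.some _ y h = 0 :=
      (hW.two_smul_eq_zero_iff h).2 (pow_eq_zero_iff two_ne_zero |>.1 hE)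
    exact H2 ((mul_nsmul _ 2 2).trans (by rw [this, nsmul_zero]))
  -- From u² + v² = t² follows 2(u + t)(v + t) = (u + v + t)², so R has class 2uv.
  have hs : 2 * (u * v * (u + t) * (v + t)) = u * v * (u + v + t) ^ 2 := by
    linear_combination u * v * ht * -1
  have hs0 : u + v + t ≠ 0 := by
    intro h0
    rw [h0] at hs
    exact hx (by linarith)
  have dR : descentMap 0 (-u ^ 4) (-v ^ 4) (Point.some _ y h) =
      2 * (u * v) * ((u + v + t) / 2) ^ 2 := by
    rw [IsSplit.descentMap_of_ne h hx]
    linear_combination (1 / 2) * hs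
  have dT : descentMap 0 (-u ^ 4) (-v ^ 4) (Point.some (-u ^ 4) 0 hW.swap₁₂.nonsingular_root) =
      -1 * (u ^ 2) ^ 2 := by
    rw [IsSplit.descentMap_of_ne _ hW.ne₁₂.symm]
    ring
  have hs2 : (u + v + t) / 2 ≠ 0 := div_ne_zero hs0 two_ne_zero
  have hu2 : u ^ 2 ≠ 0 := pow_ne_zero 2 hu
  generalize hRdef : Point.some _ y h = R at H H1 H2 H3 dR
  generalize hTdef : Point.some (-u ^ 4) 0 hW.swap₁₂.nonsingular_root = T at H3 dT
  have hT : 2 • T = 0 := by rw [← hTdef]; exact hW.swap₁₂.two_smul_root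
  have dRT : ∃ r : ℚ, r ≠ 0 ∧ descentMap 0 (-u ^ 4) (-v ^ 4) (R + T) = -(2 * (u * v)) * r ^ 2 := by
    obtain ⟨r, hr, e⟩ := hW.descentMap_add R T
    exact ⟨(u + v + t) / 2 * u ^ 2 * r, mul_ne_zero (mul_ne_zero hs2 hu2) hr, by
      rw [e, dR, dT]; ring⟩
  have hE : ∀ P, 2 • P = 0 → P = 0 ∨ P = 4 • R ∨ P = T ∨ P = T + 4 • R := by
    intro P hP
    rw [H, ← hTdef, hW.root_add_root]
    exact hW.eq_of_two_smul_eq_zero hP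
  have n₁ : ∀ Q, 2 • Q ≠ T := by
    intro Q hQ
    have := hW.isSquare_descentMap_two_smul Q
    rw [hQ, dT, isSquare_mul_sq_iff hu2] at this
    exact absurd this.nonneg (by norm_num)
  have n₂ : ∀ Q, 2 • Q ≠ R := by
    intro Q hQ
    have := hW.isSquare_descentMap_two_smul Q
    rw [hQ, dR, isSquare_mul_sq_iff hs2] at this
    exact h₁ this
  have n₃ : ∀ Q, 2 • Q ≠ R + T := by
    intro Q hQ
    have := hW.isSquare_descentMap_two_smul Q
    obtain ⟨r, hr, e⟩ := dRT
    rw [hQ, e, isSquare_mul_sq_iff hr] at this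
    exact h₂ this
  refine ⟨torsion_equiv_twoEight H1 H2 hT hE n₁ n₂ n₃ fun P hP =>
    exists_two_pow_smul_eq_zero hodd hP, ?_⟩
  rintro m₁ m₂ Q ⟨r, hr, dQ⟩ hQ
  obtain ⟨k, hk⟩ := exists_two_pow_smul_eq_zero hodd hQ
  obtain ⟨m, n, e⟩ := exists_eq_of_two_pow_smul hE n₁ n₂ n₃ hT k Q hk
  -- If Q = S + 2Z, then S and Q have the same class, so that of S times uv is a square. For S = 0,
  -- R, T, R + T this would make uv, 2, -uv, -2 a square.
  have key : ∀ S Z : (legCurve u v).toAffine.Point, Q = S + 2 • Z →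
      IsSquare (descentMap 0 (-u ^ 4) (-v ^ 4) S * (u * v)) := by
    rintro S Z rfl
    obtain ⟨s, hs, e'⟩ := hW.descentMap_add S (2 • Z)
    obtain ⟨z, hz⟩ := hW.isSquare_descentMap_two_smul Z
    rw [e', hz] at dQ
    rw [← isSquare_mul_sq_iff hr]
    exact ⟨descentMap 0 (-u ^ 4) (-v ^ 4) S * z * s, by
      linear_combination (-descentMap 0 (-u ^ 4) (-v ^ 4) S) * dQ⟩
  rcases Int.even_or_odd' m with ⟨i, rfl | rfl⟩ <;> rcases Int.even_or_odd' n with ⟨j, rfl | rfl⟩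
  · have := key 0 (i • T + j • R) (e.trans (zsmul_add_zsmul_even_even _ _ _ _))
    rw [IsSplit.descentMap_zero, one_mul] at this
    exact m₁ this
  · have := key R (i • T + j • R) (e.trans (zsmul_add_zsmul_even_odd _ _ _ _))
    rw [dR, show 2 * (u * v) * ((u + v + t) / 2) ^ 2 * (u * v) =
      2 * ((u + v + t) / 2 * (u * v)) ^ 2 by ring, isSquare_mul_sq_iff] at this
    · norm_num at this
    · refine mul_ne_zero hs2 fun h0 => m₁ ?_
      rw [h0]; exact ⟨0, by ring⟩
  · have := key T (i • T + j • R) (e.trans (zsmul_add_zsmul_odd_even _ _ _ _))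
    rw [dT, show -1 * (u ^ 2) ^ 2 * (u * v) = -(u * v) * (u ^ 2) ^ 2 by ring,
      isSquare_mul_sq_iff hu2] at this
    exact m₂ this
  · have := key (R + T) (i • T + j • R) (e.trans (zsmul_add_zsmul_odd_odd _ _ _ _))
    obtain ⟨s, hs', e'⟩ := dRT
    rw [e', show -(2 * (u * v)) * s ^ 2 * (u * v) = -2 * (s * (u * v)) ^ 2 by ring,
      isSquare_mul_sq_iff] at this
    · exact absurd this.nonneg (by norm_num)
    · refine mul_ne_zero hs' fun h0 => m₁ ?_
      rw [h0]; exact ⟨0, by ring⟩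

end LegCurve

/-! ### From induced curves to the normal form x(x + u⁴)(x + v⁴). -/

theorem HasTorsionTwoEight.of_equiv {W W' : WeierstrassCurve ℚ}
    (φ : W.toAffine.Point ≃+ W'.toAffine.Point) (h : HasTorsionTwoEight W') :
    HasTorsionTwoEight W := by
  obtain ⟨f⟩ := h
  have hφ : AddCommGroup.torsion W'.toAffine.Point =
      (AddCommGroup.torsion W.toAffine.Point).map (φ : W.toAffine.Point →+ W'.toAffine.Point) := by
    ext P
    constructor
    · intro hP
      refine ⟨φ.symm P, ?_, φ.apply_symm_apply P⟩
      exact (φ.symm : W'.toAffine.Point →+ W.toAffine.Point).isOfFinAddOrder hP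
    · rintro ⟨Q, hQ, rfl⟩
      exact (φ : W.toAffine.Point →+ W'.toAffine.Point).isOfFinAddOrder hQ
  exact ⟨((φ.addSubgroupMap _).trans (AddEquiv.addSubgroupCongr hφ.symm)).trans f⟩

theorem inducedCurve_isSplit {a b c : ℚ} (h : IsDiophantineTriple a b c) :
    IsSplit (inducedCurve a b c) (-(b * c)) (-(a * b)) (-(a * c)) where
  a₁ := rfl
  a₂ := by simp only [inducedCurve]; ring
  a₃ := rfl
  a₄ := by simp only [inducedCurve]; ring
  a₆ := by simp only [inducedCurve]; ring
  ne₁₂ H := h.ac_ne (mul_left_cancel₀ h.b_ne (by linarith))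
  ne₁₃ H := h.ab_ne (mul_left_cancel₀ h.c_ne (by linarith))
  ne₂₃ H := h.bc_ne (mul_left_cancel₀ h.a_ne (by linarith))

theorem inducedCurve_sign {ε : ℚ} (hε : ε = 1 ∨ ε = -1) (a b c : ℚ) :
    inducedCurve (ε * a) (ε * b) (ε * c) = inducedCurve a b c := by
  rcases hε with rfl | rfl <;> ext <;> simp only [inducedCurve] <;> ring

theorem IsDiophantineTriple.sign {ε a b c : ℚ} (hε : ε = 1 ∨ ε = -1)
    (h : IsDiophantineTriple a b c) : IsDiophantineTriple (ε * a) (ε * b) (ε * c) := by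
  rcases hε with rfl | rfl
  · simpa using h
  · simp only [neg_one_mul]
    exact ⟨neg_ne_zero.2 h.a_ne, neg_ne_zero.2 h.b_ne, neg_ne_zero.2 h.c_ne,
      neg_inj.not.2 h.ab_ne, neg_inj.not.2 h.ac_ne, neg_inj.not.2 h.bc_ne,
      by rw [neg_mul_neg]; exact h.ab_sq, by rw [neg_mul_neg]; exact h.ac_sq,
      by rw [neg_mul_neg]; exact h.bc_sq⟩

/-! ### The family in terms of `u = 1 - w²` and `v = w² + 2 w` -/

theorem famA_eq (w : ℚ) : famA w =
    -(2 * ((1 - w ^ 2) ^ 2 + (w ^ 2 + 2 * w) ^ 2) * (1 - w ^ 2 + (w ^ 2 + 2 * w))) /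
      ((1 - w ^ 2) * (w ^ 2 + 2 * w) * (w ^ 2 + 2 * w - (1 - w ^ 2))) := by
  rw [famA, ← neg_div_neg_eq]
  congr 1 <;> ring

theorem famB_eq (w : ℚ) : famB w =
    -(2 * (1 - w ^ 2) ^ 2) / ((w ^ 2 + 2 * w) * (w ^ 2 + 2 * w - (1 - w ^ 2))) := by
  rw [famB, ← neg_div]
  congr 1 <;> ring

theorem famC_eq (w : ℚ) : famC w =
    -(2 * (w ^ 2 + 2 * w) ^ 2) / ((1 - w ^ 2) * (w ^ 2 + 2 * w - (1 - w ^ 2))) := by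
  rw [famC, ← neg_div_neg_eq]
  congr 1 <;> ring

theorem quartic_eq (w : ℚ) : quartic w = (1 - w ^ 2) ^ 2 + (w ^ 2 + 2 * w) ^ 2 := by
  rw [quartic]; ring

/-- The square roots are explicit, and each difference of two elements is a non-zero multiple of the
positive definite form u² + uv + v². -/
theorem isDiophantineTriple_of_ne {u v : ℚ} (hu : u ≠ 0) (hv : v ≠ 0) (h : v - u ≠ 0)
    (h' : u + v ≠ 0) :
    IsDiophantineTriple (-(2 * (u ^ 2 + v ^ 2) * (u + v)) / (u * v * (v - u)))
      (-(2 * u ^ 2) / (v * (v - u))) (-(2 * v ^ 2) / (u * (v - u))) := by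
  have hs : u ^ 2 + v ^ 2 ≠ 0 := by positivity
  have hg : u ^ 2 + u * v + v ^ 2 ≠ 0 := by
    have : 0 < (u + v) ^ 2 := by positivity
    have : 0 < u ^ 2 := by positivity
    nlinarith [sq_nonneg v]
  refine ⟨div_ne_zero (neg_ne_zero.2 (by positivity)) (by positivity),
    div_ne_zero (neg_ne_zero.2 (by positivity)) (by positivity),
    div_ne_zero (neg_ne_zero.2 (by positivity)) (by positivity), ?_, ?_, ?_,
    ⟨(2 * u ^ 2 + u * v + v ^ 2) / (v * (v - u)), by field_simp; ring⟩,
    ⟨(u ^ 2 + u * v + 2 * v ^ 2) / (u * (v - u)), by field_simp; ring⟩,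
    ⟨(u + v) / (v - u), by field_simp; ring⟩⟩
  · rw [ne_eq, div_eq_div_iff (by positivity) (by positivity)]
    intro H
    have : 2 * v ^ 2 * (v - u) * (u ^ 2 + u * v + v ^ 2) = 0 := by linear_combination -H
    exact absurd this (by positivity)
  · rw [ne_eq, div_eq_div_iff (by positivity) (by positivity)]
    intro H
    have : 2 * u ^ 2 * (v - u) * (u ^ 2 + u * v + v ^ 2) = 0 := by linear_combination -H
    exact absurd this (by positivity)
  · rw [ne_eq, div_eq_div_iff (by positivity) (by positivity)]
    intro H
    have : (v - u) ^ 2 * (u ^ 2 + u * v + v ^ 2) = 0 := by linear_combination (1 / 2) * H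
    exact absurd this (by positivity)

theorem isSplit_of_ne {u v : ℚ} (hu : u ≠ 0) (hv : v ≠ 0) (h : v - u ≠ 0) (h' : u + v ≠ 0) :
    IsSplit (legCurve u v) 0 (-u ^ 4) (-v ^ 4) := by
  refine legCurve_isSplit hu hv fun H => ?_
  have hs : u ^ 2 + v ^ 2 ≠ 0 := by positivity
  have : (v - u) * (u + v) * (u ^ 2 + v ^ 2) = 0 := by linear_combination -H
  exact absurd this (by positivity)

/-- The induced curve is isomorphic to a curve attached to a Pythagorean triple. -/
theorem exists_equiv_legCurve {u v g a b c : ℚ} (hu : u ≠ 0) (hv : v ≠ 0) (h : v - u ≠ 0)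
    (h' : u + v ≠ 0) (hg : g ^ 2 = u ^ 2 + u * v + v ^ 2)
    (ha : a = -(2 * (u ^ 2 + v ^ 2) * (u + v)) / (u * v * (v - u)))
    (hb : b = -(2 * u ^ 2) / (v * (v - u))) (hc : c = -(2 * v ^ 2) / (u * (v - u))) :
    ∃ φ : (inducedCurve a b c).toAffine.Point ≃+ (legCurve u v).toAffine.Point,
      ∀ y hp, ∃ r : ℚ, r ≠ 0 ∧
        descentMap 0 (-u ^ 4) (-v ^ 4) (φ (Point.some 0 y hp)) = u * v * r ^ 2 := by
  have hd := isDiophantineTriple_of_ne hu hv h h'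
  rw [← ha, ← hb, ← hc] at hd
  have hg0 : g ≠ 0 := by
    rintro rfl
    have : 0 < (u + v) ^ 2 := by positivity
    have : 0 < u ^ 2 := by positivity
    nlinarith [sq_nonneg v]
  have hμ : u * v * (v - u) / (2 * g) ≠ 0 := by positivity
  have e : (u * v * (v - u) / (2 * g)) ^ 2 = u ^ 2 * v ^ 2 * (v - u) ^ 2 / (4 * g ^ 2) := by ring
  have hg2 : u ^ 2 + u * v + v ^ 2 ≠ 0 := hg ▸ pow_ne_zero 2 hg0
  -- The coordinate change scales by m = uv(v - u) / (2g) and shifts by m²bc, so that the root -bc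
  -- goes to 0. The points with X = 0 then have image abscissa m²bc = uv(uv / g)², of class uv.
  have ebc : (u * v * (v - u) / (2 * g)) ^ 2 * (b * c) = u * v * (u * v / g) ^ 2 := by
    rw [hb, hc]; field_simp; try ring
  have W := inducedCurve_isSplit hd
  have W' := isSplit_of_ne hu hv h h'
  have e₁ : (u * v * (v - u) / (2 * g)) ^ 2 * (-(b * c)) + u * v * (u * v / g) ^ 2 = 0 := by
    linear_combination -ebc
  have e₂ : (u * v * (v - u) / (2 * g)) ^ 2 * (-(a * b)) + u * v * (u * v / g) ^ 2 = -u ^ 4 := by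
    have : (u * v * (v - u) / (2 * g)) ^ 2 * (a * b) =
        (u ^ 2 + v ^ 2) * u ^ 3 * (u + v) / g ^ 2 := by
      rw [ha, hb]; field_simp; try ring
    rw [mul_neg, this]; field_simp; linear_combination u * hg
  have e₃ : (u * v * (v - u) / (2 * g)) ^ 2 * (-(a * c)) + u * v * (u * v / g) ^ 2 = -v ^ 4 := by
    have : (u * v * (v - u) / (2 * g)) ^ 2 * (a * c) =
        (u ^ 2 + v ^ 2) * v ^ 3 * (u + v) / g ^ 2 := by
      rw [ha, hc]; field_simp; try ring
    rw [mul_neg, this]; field_simp; linear_combination v * hg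
  obtain ⟨φ, hφ⟩ := W.exists_scale_equiv hμ (W' := legCurve u v) (r := u * v * (u * v / g) ^ 2)
    (by rw [e₁, e₂, e₃]; exact W')
  refine ⟨φ, fun y hp => ⟨u * v / g, by positivity, ?_⟩⟩
  obtain ⟨hp', H⟩ := hφ 0 y hp
  rw [H, IsSplit.descentMap_of_ne]
  · ring
  · rw [mul_zero, zero_add]; positivity

theorem quadratic_ne_zero (w : ℚ) : w ^ 2 + 2 * w - (1 - w ^ 2) ≠ 0 := by
  intro h
  have h3 : ¬ IsSquare (3 : ℚ) := by norm_num
  exact h3 ⟨2 * w + 1, by linear_combination -2 * h⟩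

theorem one_sub_sq_ne_zero {w : ℚ} (h₁ : w ≠ 1) (h₂ : w ≠ -1) : 1 - w ^ 2 ≠ 0 := by
  rw [show 1 - w ^ 2 = -((w - 1) * (w - -1)) by ring]
  exact neg_ne_zero.2 (mul_ne_zero (sub_ne_zero.2 h₁) (sub_ne_zero.2 h₂))

theorem sq_add_two_mul_ne_zero {w : ℚ} (h₁ : w ≠ 0) (h₂ : w ≠ -2) : w ^ 2 + 2 * w ≠ 0 := by
  rw [show w ^ 2 + 2 * w = w * (w - -2) by ring]
  exact mul_ne_zero h₁ (sub_ne_zero.2 h₂)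

theorem add_ne_zero_of_ne {w : ℚ} (h : w ≠ -1 / 2) : 1 - w ^ 2 + (w ^ 2 + 2 * w) ≠ 0 := by
  intro H
  exact h (by linear_combination (1 / 2) * H)

theorem fam_isDiophantineTriple {w : ℚ} (h₀ : w ≠ 0) (h₁ : w ≠ 1) (h₂ : w ≠ -1) (h₃ : w ≠ -2)
    (h₄ : w ≠ -1 / 2) : IsDiophantineTriple (famA w) (famB w) (famC w) := by
  rw [famA_eq, famB_eq, famC_eq]
  exact isDiophantineTriple_of_ne (one_sub_sq_ne_zero h₁ h₂) (sq_add_two_mul_ne_zero h₀ h₃)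
    (quadratic_ne_zero w) (add_ne_zero_of_ne h₄)

theorem fam_exists_equiv {w : ℚ} (h₀ : w ≠ 0) (h₁ : w ≠ 1) (h₂ : w ≠ -1) (h₃ : w ≠ -2)
    (h₄ : w ≠ -1 / 2) :
    ∃ φ : (inducedCurve (famA w) (famB w) (famC w)).toAffine.Point ≃+
        (legCurve (1 - w ^ 2) (w ^ 2 + 2 * w)).toAffine.Point,
      ∀ y hp, ∃ r : ℚ, r ≠ 0 ∧
        descentMap 0 (-(1 - w ^ 2) ^ 4) (-(w ^ 2 + 2 * w) ^ 4) (φ (Point.some 0 y hp)) =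
          (1 - w ^ 2) * (w ^ 2 + 2 * w) * r ^ 2 :=
  exists_equiv_legCurve (g := w ^ 2 + w + 1) (one_sub_sq_ne_zero h₁ h₂)
    (sq_add_two_mul_ne_zero h₀ h₃) (quadratic_ne_zero w) (add_ne_zero_of_ne h₄) (by ring)
    (famA_eq w) (famB_eq w) (famC_eq w)

/-- The quartic takes the non-square value 9/8 at -1/2, so this exclusion is automatic for rational
points of the quartic. -/
theorem ne_neg_half_of_isSquare {w : ℚ} (h : IsSquare (quartic w)) : w ≠ -1 / 2 := by
  rintro rfl
  norm_num [quartic] at h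

theorem fam_exists_hom {w : ℚ} (h₀ : w ≠ 0) (h₁ : w ≠ 1) (h₂ : w ≠ -1) (h₃ : w ≠ -2)
    (h : IsSquare (quartic w)) :
    ∃ f : ZMod 2 × ZMod 8 →+ (inducedCurve (famA w) (famB w) (famC w)).toAffine.Point,
      Function.Injective f := by
  have h₄ := ne_neg_half_of_isSquare h
  obtain ⟨φ, -⟩ := fam_exists_equiv h₀ h₁ h₂ h₃ h₄
  obtain ⟨t, ht⟩ := h
  obtain ⟨f, hf⟩ := legCurve_exists_hom (isSplit_of_ne (one_sub_sq_ne_zero h₁ h₂)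
    (sq_add_two_mul_ne_zero h₀ h₃) (quadratic_ne_zero w) (add_ne_zero_of_ne h₄)) (t := t)
    (by rw [← quartic_eq, ht, sq])
  exact ⟨(φ.symm : _ →+ _).comp f, φ.symm.injective.comp hf⟩

/-- Collects what must be checked for a given w: `hodd`, `n₁`, `n₂` determine the torsion, while
`n₃`, `n₄` make the base point of infinite order. The sign ε does not affect the curve. -/
theorem fam_isPositiveTwoEightTriple {w ε : ℚ} (h₀ : w ≠ 0) (h₁ : w ≠ 1) (h₂ : w ≠ -1)
    (h₃ : w ≠ -2) (h : IsSquare (quartic w)) (hε : ε = 1 ∨ ε = -1)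
    (ha : 0 < ε * famA w) (hb : 0 < ε * famB w) (hc : 0 < ε * famC w)
    (hodd : ∀ P : (legCurve (1 - w ^ 2) (w ^ 2 + 2 * w)).toAffine.Point, HasOddOrder P → P = 0)
    (n₁ : ¬ IsSquare (2 * ((1 - w ^ 2) * (w ^ 2 + 2 * w))))
    (n₂ : ¬ IsSquare (-(2 * ((1 - w ^ 2) * (w ^ 2 + 2 * w)))))
    (n₃ : ¬ IsSquare ((1 - w ^ 2) * (w ^ 2 + 2 * w)))
    (n₄ : ¬ IsSquare (-((1 - w ^ 2) * (w ^ 2 + 2 * w)))) :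
    IsPositiveTwoEightTriple (ε * famA w) (ε * famB w) (ε * famC w) := by
  have h₄ := ne_neg_half_of_isSquare h
  have hd := (fam_isDiophantineTriple h₀ h₁ h₂ h₃ h₄).sign hε
  obtain ⟨φ, hφ⟩ := fam_exists_equiv h₀ h₁ h₂ h₃ h₄
  obtain ⟨t, ht⟩ := h
  obtain ⟨H₁, H₂⟩ := legCurve_torsion (isSplit_of_ne (one_sub_sq_ne_zero h₁ h₂)
    (sq_add_two_mul_ne_zero h₀ h₃) (quadratic_ne_zero w) (add_ne_zero_of_ne h₄)) (t := t)
    (by rw [← quartic_eq, ht, sq]) hodd n₁ n₂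
  have hW := inducedCurve_sign hε (famA w) (famB w) (famC w)
  have key : ∀ W : WeierstrassCurve ℚ, W = inducedCurve (famA w) (famB w) (famC w) →
      HasTorsionTwoEight W ∧ ∀ (y : ℚ) (hp : W.toAffine.Nonsingular 0 y),
        ¬ IsOfFinAddOrder (Point.some 0 y hp) := by
    rintro _ rfl
    exact ⟨H₁.of_equiv φ, fun y hp hf => H₂ n₃ n₄ _ (hφ y hp)
      ((φ : _ →+ (legCurve (1 - w ^ 2) (w ^ 2 + 2 * w)).toAffine.Point).isOfFinAddOrder hf)⟩
  obtain ⟨k₁, k₂⟩ := key _ hW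
  have hns := (inducedCurve_isSplit hd).nonsingular_iff (x := 0)
    (y := ε * famA w * (ε * famB w) * (ε * famC w)) |>.2 (by ring)
  exact ⟨hd, ha, hb, hc, k₁, ⟨hns, k₂ _ hns⟩, one_le_rank_of_not_isOfFinAddOrder (k₂ _ hns)⟩

/-! ### The triples attached to 3P, 5P and 8P. -/

theorem hasVal_of_eq {p : ℕ} [Fact p.Prime] {x : ℚ} (n : ℕ) (a b : ℤ) (ha : ¬ (p : ℤ) ∣ a)
    (hb : ¬ (p : ℤ) ∣ b) (hx : x = (p : ℚ) ^ n * (a / b)) : HasVal p n x := by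
  rw [hx]
  exact (((hasVal_self (p := p)).pow n).mul ((hasVal_intCast ha).div (hasVal_intCast hb))).congr
    (by ring)

theorem valGE_of_eq {p : ℕ} [Fact p.Prime] {x : ℚ} (n : ℕ) (a b : ℤ) (hb : ¬ (p : ℤ) ∣ b)
    (hx : x = (p : ℚ) ^ n * (a / b)) : ValGE p n x := by
  rw [hx, div_eq_mul_inv]
  exact ((((hasVal_self (p := p)).pow n).valGE le_rfl).mul ((valGE_intCast a).mul
    ((hasVal_intCast hb).inv.valGE le_rfl))).congr (by ring)

/-- A rational root, written in lowest terms after clearing D, gives a homogeneous integral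
relation. Modulo p its denominator cannot vanish, as the numerator would vanish too, so it reduces
to a root in `ZMod p`. -/
theorem three_division_ne_zero {p : ℕ} [Fact p.Prime] {U V D : ℤ} (hD : D ≠ 0)
    (h3 : (3 : ZMod p) ≠ 0)
    (H : ∀ z : ZMod p, 3 * z ^ 4 + 4 * (U ^ 4 + V ^ 4) * z ^ 3 + 6 * (U ^ 4 * V ^ 4) * z ^ 2 -
      (U ^ 4 * V ^ 4) ^ 2 ≠ 0) {u v : ℚ} (hu : u = U / D) (hv : v = V / D) (x : ℚ) :
    3 * x ^ 4 + 4 * (u ^ 4 + v ^ 4) * x ^ 3 + 6 * (u ^ 4 * v ^ 4) * x ^ 2 -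
      (u ^ 4 * v ^ 4) ^ 2 ≠ 0 := by
  intro h
  have hD' : (D : ℚ) ≠ 0 := mod_cast hD
  obtain ⟨y, hy⟩ : ∃ y : ℚ, y = x * D ^ 4 := ⟨_, rfl⟩
  obtain rfl : x = y / D ^ 4 := by rw [hy]; field_simp
  have e : 3 * y ^ 4 + 4 * ((U : ℚ) ^ 4 + V ^ 4) * y ^ 3 + 6 * (U ^ 4 * V ^ 4) * y ^ 2 -
      (U ^ 4 * V ^ 4) ^ 2 = 0 := by
    rw [hu, hv] at h
    field_simp at h
    linear_combination h
  have hden : (y.den : ℚ) ≠ 0 := mod_cast y.den_ne_zero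
  have e' : 3 * (y.num : ℤ) ^ 4 + 4 * (U ^ 4 + V ^ 4) * y.num ^ 3 * y.den +
      6 * (U ^ 4 * V ^ 4) * y.num ^ 2 * y.den ^ 2 - (U ^ 4 * V ^ 4) ^ 2 * y.den ^ 4 = 0 := by
    have hn : (y.num : ℚ) = y * y.den := (Rat.mul_den_eq_num y).symm
    have : (3 * (y.num : ℚ) ^ 4 + 4 * (U ^ 4 + V ^ 4) * y.num ^ 3 * y.den +
      6 * (U ^ 4 * V ^ 4) * y.num ^ 2 * y.den ^ 2 - (U ^ 4 * V ^ 4) ^ 2 * y.den ^ 4) = 0 := by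
      rw [hn]; linear_combination (y.den : ℚ) ^ 4 * e
    exact_mod_cast this
  have e'' := congrArg (Int.cast : ℤ → ZMod p) e'
  push_cast at e''
  by_cases hd : (y.den : ZMod p) = 0
  · rw [hd] at e''
    have hn : (y.num : ZMod p) = 0 := by
      have : 3 * (y.num : ZMod p) ^ 4 = 0 := by linear_combination e''
      exact pow_eq_zero_iff four_ne_zero |>.1 ((mul_eq_zero.1 this).resolve_left h3)
    rw [ZMod.natCast_eq_zero_iff] at hd
    rw [ZMod.intCast_zmod_eq_zero_iff_dvd, Int.natCast_dvd] at hn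
    exact Nat.not_coprime_of_dvd_of_dvd (Fact.out : p.Prime).one_lt hn hd y.reduced
  · apply H (y.num / y.den)
    field_simp
    linear_combination e''

/-- Here u = 7245/7921 and v = 8 · 663/7921, so k = 3. -/
theorem fam_three : IsPositiveTwoEightTriple (1 * famA (26 / 89)) (1 * famB (26 / 89))
    (1 * famC (26 / 89)) := by
  refine fam_isPositiveTwoEightTriple (by norm_num) (by norm_num) (by norm_num) (by norm_num)
    (by norm_num [quartic]) (Or.inl rfl) (by norm_num [famA]) (by norm_num [famB])
    (by norm_num [famC]) (fun P hP => hP.eq_zero_of_three (hasVal_of_eq 0 7245 7921 ?_ ?_ ?_)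
    (hasVal_of_eq 3 663 7921 ?_ ?_ ?_)) ?_ ?_ ?_ ?_ <;> norm_num

instance fact_prime_29 : Fact (Nat.Prime 29) := ⟨by norm_num⟩

/-- Here v has 2-adic valuation 4, so the 3-division polynomial has to be excluded; it has no root
modulo 29. -/
theorem fam_five : IsPositiveTwoEightTriple (-1 * famA (-1389334 / 1233407))
    (-1 * famB (-1389334 / 1233407)) (-1 * famC (-1389334 / 1233407)) := by
  refine fam_isPositiveTwoEightTriple (by norm_num) (by norm_num) (by norm_num) (by norm_num)
    (by norm_num [quartic]) (Or.inr rfl) (by norm_num [famA]) (by norm_num [famB])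
    (by norm_num [famC]) (fun P hP => hP.eq_zero_of_four
      (hasVal_of_eq 0 (-408956135907) (1233407 ^ 2) ?_ ?_ ?_)
      (hasVal_of_eq 4 (-93561224895) (1233407 ^ 2) ?_ ?_ ?_)
      (three_division_ne_zero (p := 29) (U := -408956135907) (V := -1496979598320)
        (D := 1233407 ^ 2) (by norm_num) (by decide) ?_ (by norm_num) (by norm_num)))
      ?_ ?_ ?_ ?_
  case refine_7 =>
    rw [show ((-408956135907 : ℤ) : ZMod 29) = 2 by decide,
      show ((-1496979598320 : ℤ) : ZMod 29) = 1 by decide]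
    decide
  all_goals norm_num

/-- Here v has 2-adic valuation 5, hence the division by 32 below. -/
theorem fam_eight : IsPositiveTwoEightTriple
    (-1 * famA (-29961886650170640 / 25895756518234849))
    (-1 * famB (-29961886650170640 / 25895756518234849))
    (-1 * famC (-29961886650170640 / 25895756518234849)) := by
  refine fam_isPositiveTwoEightTriple (by norm_num) (by norm_num) (by norm_num) (by norm_num)
    (by norm_num [quartic]) (Or.inr rfl) (by norm_num [famA]) (by norm_num [famB])
    (by norm_num [famC]) (fun P hP => hP.eq_zero_of_five
      (hasVal_of_eq 0 (25895756518234849 ^ 2 - 29961886650170640 ^ 2) (25895756518234849 ^ 2)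
        ?_ ?_ ?_)
      (hasVal_of_eq 5 ((29961886650170640 ^ 2 - 2 * 29961886650170640 * 25895756518234849) / 32)
        (25895756518234849 ^ 2) ?_ ?_ ?_)) ?_ ?_ ?_ ?_ <;> norm_num

/-! ### Local square conditions on the factors of d₁d₂d₃ = y². -/

/-- `z` is a square of a unit modulo `pⁿ`, up to squares of rational numbers. -/
def SqP (p : ℕ) (n : ℤ) (z : ℚ) : Prop := ∃ r : ℚ, ValGE p n (z * r ^ 2 - 1)

section LocalSquares

set_option linter.unusedSectionVars false

variable {p : ℕ} [Fact p.Prime] {n : ℤ} {z c r y d₁ d₂ d₃ : ℚ}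

theorem HasVal.even_of_sq {m k : ℤ} (hy : HasVal p k y) (h : HasVal p m (y ^ 2)) : Even m := by
  have := (hy.pow 2).unique h
  exact ⟨k, by push_cast at this; omega⟩

theorem hasVal_zero_of_sub_one (hn : 1 ≤ n) (h : ValGE p n (z - 1)) : HasVal p 0 z := by
  have := hasVal_one.add_valGE h (by omega)
  rwa [add_sub_cancel] at this

theorem SqP.even (hn : 1 ≤ n) (h : SqP p n z) : Even (padicValRat p z) := by
  obtain ⟨r, hr⟩ := h
  have h0 := hasVal_zero_of_sub_one hn hr
  obtain ⟨k, hk⟩ := exists_hasVal p ((pow_ne_zero_iff two_ne_zero).1 (right_ne_zero_of_mul h0.1))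
  obtain ⟨m, hm⟩ := exists_hasVal p (left_ne_zero_of_mul h0.1)
  have := (hm.mul (hk.pow 2)).unique h0
  rw [hm.2]
  exact ⟨-k, by push_cast at this; omega⟩

theorem SqP.of_mul_sq (h : SqP p n (c * r ^ 2)) : SqP p n c := by
  obtain ⟨s, hs⟩ := h
  exact ⟨r * s, by rwa [mul_pow, ← mul_assoc]⟩

theorem SqP.add (hn : 1 ≤ n) (hc : SqP p n c) (hc0 : HasVal p 0 c) (hz : ValGE p n z) :
    SqP p n (c + z) := by
  obtain ⟨r, hr⟩ := hc
  have h0 := hasVal_zero_of_sub_one hn hr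
  obtain ⟨k, hk⟩ := exists_hasVal p ((pow_ne_zero_iff two_ne_zero).1 (right_ne_zero_of_mul h0.1))
  have e := (hc0.mul (hk.pow 2)).unique h0
  have hk0 : k = 0 := by push_cast at e; omega
  subst hk0
  refine ⟨r, ?_⟩
  rw [show (c + z) * r ^ 2 - 1 = c * r ^ 2 - 1 + z * r ^ 2 by ring]
  exact hr.add ((hz.mul ((hk.pow 2).valGE le_rfl)).congr (by ring))

/-- Since y² = d₁d₂d₃, the product d₃(d₁ / y)² equals d₁ / d₂, which is close to 1. -/
theorem sqP_of_ratio (h₂ : d₂ ≠ 0) (h₃ : d₃ ≠ 0) (hy : y ^ 2 = d₁ * d₂ * d₃)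
    (h : ValGE p n ((d₁ - d₂) / d₂)) : SqP p n d₃ := by
  refine ⟨d₁ / y, ?_⟩
  have e : d₃ * (d₁ / y) ^ 2 - 1 = (d₁ - d₂) / d₂ := by
    rw [div_pow, hy]; field_simp
  rwa [e]

/-- Two roots are congruent modulo p^(2n - 1). If pⁿ divides d₁, then d₃ is congruent to the local
square d₃ - d₁. Otherwise d₁ and d₂ have the same valuation, less than n, their ratio is 1 modulo
pⁿ, and `sqP_of_ratio` applies. -/
theorem sqP_of_congr (h₁ : d₁ ≠ 0) (h₂ : d₂ ≠ 0) (h₃ : d₃ ≠ 0) (hy : y ^ 2 = d₁ * d₂ * d₃)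
    (hn : 1 ≤ n) (h₁₂ : ValGE p (2 * n - 1) (d₁ - d₂)) (h₁₃ : HasVal p 0 (d₃ - d₁))
    (hs : SqP p n (d₃ - d₁)) : SqP p n d₃ := by
  obtain ⟨m, hm⟩ := exists_hasVal p h₁
  by_cases hmn : n ≤ m
  · have := hs.add hn h₁₃ (hm.valGE hmn)
    rwa [sub_add_cancel] at this
  · have h2 : HasVal p m d₂ := by
      have := hm.sub_valGE h₁₂ (by omega)
      rwa [sub_sub_cancel] at this
    refine sqP_of_ratio h₂ h₃ hy ?_
    rw [div_eq_mul_inv]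
    exact (h₁₂.mul (h2.inv.valGE le_rfl)).mono (by omega)

/-- The roots of d₂ and d₃ are congruent modulo p but not modulo p². If p ∣ d₂, then -d₁ is
congruent to the square d₂ - d₁, and v(d₂) is odd: it is 1, or else v(d₃) = 1 and v(d₁) = 0. If p
does not divide d₂, then d₂ / d₃ is 1 modulo p and the parity of v(y²) settles the rest. -/
theorem even_or_odd_of_sub (h₁ : d₁ ≠ 0) (h₂ : d₂ ≠ 0) (h₃ : d₃ ≠ 0)
    (hy : y ^ 2 = d₁ * d₂ * d₃) (h₂₃ : HasVal p 1 (d₂ - d₃)) (h₁₂ : HasVal p 0 (d₂ - d₁))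
    (hs : SqP p 1 (d₂ - d₁)) :
    (Even (padicValRat p d₂) ∧ SqP p 1 d₁) ∨ (Odd (padicValRat p d₂) ∧ SqP p 1 (-d₁)) := by
  obtain ⟨m, hm⟩ := exists_hasVal p h₂
  have hy0 : y ≠ 0 := by
    rintro rfl
    rw [zero_pow two_ne_zero] at hy
    exact mul_ne_zero (mul_ne_zero h₁ h₂) h₃ hy.symm
  obtain ⟨k, hk⟩ := exists_hasVal p hy0
  rw [hm.2]
  by_cases h : 1 ≤ m
  · right
    refine ⟨?_, by
      have := hs.add le_rfl h₁₂ (hm.neg.valGE h)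
      rwa [show d₂ - d₁ + -d₂ = -d₁ by ring] at this⟩
    by_cases h1 : m = 1
    · exact h1 ▸ odd_one
    have v3 : HasVal p 1 d₃ := by
      have := (h₂₃.neg).add_valGE (hm.valGE (show (2 : ℤ) ≤ m by omega)) (by omega)
      rwa [show -(d₂ - d₃) + d₂ = d₃ by ring] at this
    have v1 : HasVal p 0 d₁ := by
      have := (h₁₂.neg).add_valGE (hm.valGE h) (by omega)
      rwa [show -(d₂ - d₁) + d₂ = d₁ by ring] at this
    have := hk.even_of_sq (hy ▸ (v1.mul hm).mul v3)
    rw [zero_add, Int.even_add_one, Int.not_even_iff_odd] at this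
    exact this
  · left
    have v3 : HasVal p m d₃ := by
      have := hm.sub_valGE (h₂₃.valGE le_rfl) (by omega)
      rwa [sub_sub_cancel] at this
    refine ⟨?_, ?_⟩
    · by_cases h0 : m = 0
      · exact h0 ▸ Even.zero
      have v1 : HasVal p m d₁ := by
        have := hm.sub_valGE (h₁₂.valGE le_rfl) (by omega)
        rwa [sub_sub_cancel] at this
      have := hk.even_of_sq (hy ▸ (v1.mul hm).mul v3)
      rw [Int.even_iff] at this ⊢
      omega
    · refine sqP_of_ratio (d₁ := d₂) h₃ h₁ (y := y) (by rw [hy]; ring) ?_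
      exact (h₂₃.div v3).valGE (by omega)

/-- If d₁ has negative valuation, all three factors share it; if positive, the other two are units.
Either way v(y²) even forces v(d₁) even. -/
theorem even_of_sub (h₁ : d₁ ≠ 0) (h₂ : d₂ ≠ 0) (h₃ : d₃ ≠ 0) (hy : y ^ 2 = d₁ * d₂ * d₃)
    (h₁₂ : HasVal p 0 (d₂ - d₁)) (h₁₃ : HasVal p 0 (d₃ - d₁)) : Even (padicValRat p d₁) := by
  obtain ⟨m, hm⟩ := exists_hasVal p h₁
  have hy0 : y ≠ 0 := by
    rintro rfl
    rw [zero_pow two_ne_zero] at hy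
    exact mul_ne_zero (mul_ne_zero h₁ h₂) h₃ hy.symm
  obtain ⟨k, hk⟩ := exists_hasVal p hy0
  rw [hm.2]
  rcases lt_trichotomy m 0 with h | rfl | h
  · have v2 := hm.add_valGE (h₁₂.valGE le_rfl) h
    have v3 := hm.add_valGE (h₁₃.valGE le_rfl) h
    rw [add_sub_cancel] at v2 v3
    have := hk.even_of_sq (hy ▸ (hm.mul v2).mul v3)
    rw [Int.even_iff] at this ⊢
    omega
  · exact Even.zero
  · have v2 := h₁₂.add_valGE (hm.valGE (show (1 : ℤ) ≤ m by omega)) (by omega)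
    have v3 := h₁₃.add_valGE (hm.valGE (show (1 : ℤ) ≤ m by omega)) (by omega)
    rw [sub_add_cancel] at v2 v3
    have := hk.even_of_sq (hy ▸ (hm.mul v2).mul v3)
    simpa using this

theorem exists_int_of_sqP (hn : 1 ≤ n) {c : ℤ} (hc : ¬ (p : ℤ) ∣ c) (h : SqP p n c) :
    ∃ a b : ℤ, ¬ (p : ℤ) ∣ b ∧ ValGE p n ((c * a ^ 2 - b ^ 2 : ℤ) : ℚ) := by
  obtain ⟨r, hr⟩ := h
  have h0 := hasVal_zero_of_sub_one hn hr
  obtain ⟨k, hk⟩ := exists_hasVal p ((pow_ne_zero_iff two_ne_zero).1 (right_ne_zero_of_mul h0.1))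
  have e := ((hasVal_intCast hc).mul (hk.pow 2)).unique h0
  have hk0 : k = 0 := by push_cast at e; omega
  subst hk0
  have hb : ¬ p ∣ r.den := by
    intro hd
    have h1 : ¬ p ∣ r.num.natAbs := fun hn' => by
      have := Nat.dvd_gcd hn' hd
      rw [r.reduced] at this
      exact (Fact.out : p.Prime).one_lt.ne' (Nat.dvd_one.1 this)
    have h2 := hk.2
    rw [padicValRat.eq_1, padicValInt.eq_1, padicValNat.eq_zero_of_not_dvd h1] at h2
    have h3 := one_le_padicValNat_of_dvd (p := p) r.den_nz hd
    omega
  have hden : (r.den : ℚ) ≠ 0 := mod_cast r.den_nz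
  refine ⟨r.num, r.den, mod_cast hb, ?_⟩
  have : ((c * r.num ^ 2 - (r.den : ℤ) ^ 2 : ℤ) : ℚ) = (c * r ^ 2 - 1) * ((r.den : ℤ) : ℚ) ^ 2 := by
    push_cast
    rw [← Rat.mul_den_eq_num]
    ring
  rw [this]
  exact (hr.mul (((hasVal_intCast (mod_cast hb)).pow 2).valGE le_rfl)).congr (by ring)

theorem dvd_of_valGE {k : ℕ} {c : ℤ} (h : ValGE p k (c : ℚ)) : (p : ℤ) ^ k ∣ c := by
  by_cases hc : c = 0
  · rw [hc]; exact dvd_zero _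
  rcases h with h | h
  · exact absurd (Int.cast_eq_zero.1 h) hc
  · rw [padicValRat.of_int] at h
    exact (padicValInt_dvd_iff k c).2 (Or.inr (by exact_mod_cast h))

theorem legendreSym_eq_one_of_sqP {c : ℤ} (hc : ¬ (p : ℤ) ∣ c) (h : SqP p 1 c) :
    legendreSym p c = 1 := by
  obtain ⟨a, b, hb, h⟩ := exists_int_of_sqP le_rfl hc h
  have hd := dvd_of_valGE (k := 1) (mod_cast h)
  rw [pow_one, ← ZMod.intCast_zmod_eq_zero_iff_dvd] at hd
  rw [← ZMod.intCast_zmod_eq_zero_iff_dvd] at hb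
  push_cast at hd
  rw [legendreSym.eq_one_iff _ (by rwa [ne_eq, ZMod.intCast_zmod_eq_zero_iff_dvd])]
  have ha : (a : ZMod p) ≠ 0 := by
    intro ha
    rw [ha] at hd
    exact hb (pow_eq_zero_iff two_ne_zero |>.1 (by linear_combination -hd))
  exact ⟨b / a, by field_simp; linear_combination hd⟩

theorem mod_eight_of_sqP {c : ℤ} (hc : ¬ (2 : ℤ) ∣ c) (h : SqP 2 3 c) : c % 8 = 1 := by
  obtain ⟨a, b, hb, h⟩ := exists_int_of_sqP (p := 2) (by norm_num) hc h
  have hd := dvd_of_valGE (k := 3) (mod_cast h)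
  have h1 : (c * a ^ 2 - b ^ 2) % 8 = 0 := Int.emod_eq_zero_of_dvd hd
  have sq : ∀ x : ℤ, x % 2 = 1 → x ^ 2 % 8 = 1 := fun x hx => by
    obtain ⟨k, rfl⟩ : ∃ k, x = 2 * k + 1 := ⟨x / 2, by omega⟩
    obtain ⟨j, hj⟩ := Int.even_mul_succ_self k
    have : (2 * k + 1) ^ 2 = 8 * j + 1 := by linear_combination 4 * hj
    omega
  have hb1 := sq b (by push_cast at hb; omega)
  have ha : a % 2 = 1 := by
    by_contra ha
    obtain ⟨k, rfl⟩ : ∃ k, a = 2 * k := ⟨a / 2, by omega⟩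
    have : c * (2 * k) ^ 2 = 4 * (c * k ^ 2) := by ring
    omega
  have ha1 := sq a ha
  have : c * a ^ 2 % 8 = c % 8 := by rw [Int.mul_emod, ha1, mul_one, Int.emod_emod]
  omega

end LocalSquares

/-! ### Square classes of positive rationals from parities of valuations. -/

section SquareClass

theorem Nat.isSquare_of_even_factorization {n : ℕ} (hn : n ≠ 0)
    (h : ∀ p : ℕ, p.Prime → Even (n.factorization p)) : IsSquare n := by
  refine ⟨n.factorization.prod fun p k => p ^ (k / 2), ?_⟩
  conv_lhs => rw [← Nat.prod_factorization_pow_eq_self hn]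
  rw [← Finsupp.prod_mul]
  refine Finsupp.prod_congr fun p hp => ?_
  obtain ⟨k, hk⟩ := h p (Nat.prime_of_mem_primeFactors hp)
  rw [← pow_add, hk]
  congr 1
  omega

theorem Rat.isSquare_of_even_padicValRat {q : ℚ} (hq : 0 < q)
    (h : ∀ p : ℕ, p.Prime → Even (padicValRat p q)) : IsSquare q := by
  have hn : q.num.natAbs ≠ 0 := Int.natAbs_ne_zero.2 (Rat.num_ne_zero.2 hq.ne')
  have e : (q.num.natAbs : ℚ) = q * q.den := by
    rw [Rat.mul_den_eq_num, Nat.cast_natAbs, abs_of_pos (Rat.num_pos.2 hq)]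
  have hden : (q.den : ℚ) ≠ 0 := mod_cast q.den_nz
  have : IsSquare (q.num.natAbs * q.den) := by
    refine Nat.isSquare_of_even_factorization (mul_ne_zero hn q.den_nz) fun p hp => ?_
    have : Fact p.Prime := ⟨hp⟩
    have h1 := h p hp
    rw [padicValRat.eq_1, padicValInt.eq_1] at h1
    rw [Nat.factorization_mul hn q.den_nz, Finsupp.add_apply, Nat.factorization_def _ hp,
      Nat.factorization_def _ hp]
    rw [Int.even_sub] at h1
    rw [Nat.even_add]
    exact_mod_cast h1
  obtain ⟨k, hk⟩ := this
  have hk' : (q.num.natAbs : ℚ) * q.den = k * k := mod_cast hk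
  rw [e] at hk'
  exact ⟨k / q.den, by field_simp; linear_combination hk'⟩

theorem Rat.exists_eq_prod_mul_sq {q : ℚ} (hq : 0 < q) (s : Finset ℕ) (b : ℕ → ℕ)
    (hs : ∀ p ∈ s, p.Prime) (h : ∀ p : ℕ, p.Prime → p ∉ s → Even (padicValRat p q))
    (h' : ∀ p ∈ s, Even (padicValRat p q + b p)) :
    ∃ r : ℚ, r ≠ 0 ∧ q = (∏ p ∈ s, (p : ℚ) ^ b p) * r ^ 2 := by
  have hpos : 0 < ∏ p ∈ s, (p : ℚ) ^ b p :=
    Finset.prod_pos fun p hp => pow_pos (mod_cast (hs p hp).pos) _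
  have hval : ∀ p : ℕ, p.Prime → ∀ t ⊆ s, HasVal p (if p ∈ t then b p else 0) (∏ p ∈ t, (p : ℚ) ^ b p) := by
    intro p hp t ht
    have : Fact p.Prime := ⟨hp⟩
    induction t using Finset.induction_on with
    | empty => simpa using hasVal_one
    | insert l t hl ih =>
      rw [Finset.prod_insert hl]
      have ih := ih ((Finset.subset_insert l t).trans ht)
      by_cases hpl : p = l
      · subst hpl
        rw [if_neg hl] at ih
        exact (((hasVal_self (p := p)).pow (b p)).mul ih).congr (by simp)
      · have hl' : HasVal p 0 (l : ℚ) := by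
          have : ¬ (p : ℤ) ∣ (l : ℤ) := by
            rw [Int.natCast_dvd_natCast, Nat.prime_dvd_prime_iff_eq hp (hs l (ht (Finset.mem_insert_self l t)))]
            exact hpl
          exact_mod_cast hasVal_intCast this
        refine ((hl'.pow (b l)).mul ih).congr ?_
        simp [hpl]
  -- Multiplying by the product makes every valuation even, and the product differs from its inverse
  -- by a square.
  have : IsSquare (q * ∏ p ∈ s, (p : ℚ) ^ b p) := by
    refine Rat.isSquare_of_even_padicValRat (mul_pos hq hpos) fun p hp => ?_
    have : Fact p.Prime := ⟨hp⟩
    rw [padicValRat.mul hq.ne' hpos.ne', (hval p hp s subset_rfl).2]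
    split_ifs with hps
    · exact h' p hps
    · rw [add_zero]; exact h p hp hps
  obtain ⟨k, hk⟩ := this
  have hk0 : k ≠ 0 := by
    rintro rfl
    rw [mul_zero] at hk
    exact (mul_pos hq hpos).ne' hk
  refine ⟨k / ∏ p ∈ s, (p : ℚ) ^ b p, div_ne_zero hk0 hpos.ne', ?_⟩
  have := hpos.ne'
  field_simp
  linear_combination hk

end SquareClass

section LegendreParity

variable {p : ℕ} [Fact p.Prime]

theorem legendreSym_pow (a : ℤ) (k : ℕ) : legendreSym p (a ^ k) = legendreSym p a ^ k := by
  rw [← legendreSym.hom_apply, map_pow, legendreSym.hom_apply]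

theorem even_of_sqP {c : ℤ} {k : ℕ} (e : legendreSym p c = (-1) ^ k) (h : SqP p 1 c) : Even k := by
  have hc : ¬ (p : ℤ) ∣ c := by
    rw [← ZMod.intCast_zmod_eq_zero_iff_dvd, ← legendreSym.eq_zero_iff, e]
    exact pow_ne_zero _ (by norm_num)
  rw [legendreSym_eq_one_of_sqP hc h] at e
  exact (neg_one_pow_eq_one_iff_even (by norm_num)).1 e.symm

end LegendreParity

/-! ### Local conditions for u = 2415, v = 1768, where 2415² + 1768² = 2993². -/

section Explicit

variable {x y : ℚ}

/-- Modulo p the roots 0 and -2415⁴ coincide, and the distance to the third is the square 1768⁴. -/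
theorem explicit_sqP₃ {p : ℕ} [Fact p.Prime] (hp : (p : ℤ) ∣ 2415) (hp' : ¬ (p : ℤ) ∣ 1768)
    (h₁ : x ≠ 0) (h₂ : x + 2415 ^ 4 ≠ 0) (h₃ : x + 1768 ^ 4 ≠ 0)
    (hy : y ^ 2 = x * (x + 2415 ^ 4) * (x + 1768 ^ 4)) : SqP p 1 (x + 1768 ^ 4) := by
  refine sqP_of_congr h₁ h₂ h₃ hy le_rfl ?_ ?_ ⟨1 / 1768 ^ 2, ?_⟩
  · have := valGE_intCast_of_dvd ((hp.mul_right (2415 ^ 3)).neg_right)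
    norm_num at this ⊢
    exact this
  · have := (hasVal_intCast hp').pow 4
    norm_num at this ⊢
    exact this
  · exact Or.inl (by field_simp; ring)

theorem explicit_sqP₂ {p : ℕ} [Fact p.Prime] {n : ℤ} (hn : 1 ≤ n)
    (hp : ValGE p (2 * n - 1) (-1768 ^ 4 : ℚ)) (hp' : ¬ (p : ℤ) ∣ 2415)
    (h₁ : x ≠ 0) (h₂ : x + 2415 ^ 4 ≠ 0) (h₃ : x + 1768 ^ 4 ≠ 0)
    (hy : y ^ 2 = x * (x + 2415 ^ 4) * (x + 1768 ^ 4)) : SqP p n (x + 2415 ^ 4) := by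
  refine sqP_of_congr (d₂ := x + 1768 ^ 4) h₁ h₃ h₂ (y := y) (by rw [hy]; ring) hn ?_ ?_
    ⟨1 / 2415 ^ 2, ?_⟩
  · rwa [show x - (x + 1768 ^ 4) = -1768 ^ 4 by ring]
  · have := (hasVal_intCast hp').pow 4
    norm_num at this ⊢
    exact this
  · exact Or.inl (by field_simp; ring)

/-- The roots -2415⁴ and -1768⁴ coincide modulo p, and the remaining distance -2415⁴ is a local
square because i² = -1 modulo p. -/
theorem explicit_sqP₁ {p : ℕ} [Fact p.Prime] (hp : (p : ℤ) ∣ 2415 ^ 4 - 1768 ^ 4)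
    (hp' : ¬ (p : ℤ) ∣ 2415) (i : ℤ) (hi : (p : ℤ) ∣ i ^ 2 + 1)
    (h₁ : x ≠ 0) (h₂ : x + 2415 ^ 4 ≠ 0) (h₃ : x + 1768 ^ 4 ≠ 0)
    (hy : y ^ 2 = x * (x + 2415 ^ 4) * (x + 1768 ^ 4)) : SqP p 1 x := by
  refine sqP_of_congr (d₁ := x + 2415 ^ 4) (d₂ := x + 1768 ^ 4) h₂ h₃ h₁ (y := y)
    (by rw [hy]; ring) le_rfl ?_ ?_ ⟨i / 2415 ^ 2, ?_⟩
  · have := valGE_intCast_of_dvd hp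
    norm_num at this ⊢
    exact this
  · have := ((hasVal_intCast hp').pow 4).neg
    norm_num at this ⊢
    exact this
  · have := valGE_intCast_of_dvd hi.neg_right
    rw [show (x - (x + 2415 ^ 4)) * ((i : ℚ) / 2415 ^ 2) ^ 2 - 1 = ((-(i ^ 2 + 1) : ℤ) : ℚ) by
      push_cast; field_simp; ring]
    exact this

/-- Replaces `explicit_sqP₁` at 47 and 647, where -1 is not a square; these primes divide 2415⁴ -
1768⁴ exactly once. -/
theorem explicit_sqP_or {p : ℕ} [Fact p.Prime] (hp : HasVal p 1 (2415 ^ 4 - 1768 ^ 4 : ℚ))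
    (hp' : ¬ (p : ℤ) ∣ 2415)
    (h₁ : x ≠ 0) (h₂ : x + 2415 ^ 4 ≠ 0) (h₃ : x + 1768 ^ 4 ≠ 0)
    (hy : y ^ 2 = x * (x + 2415 ^ 4) * (x + 1768 ^ 4)) :
    (Even (padicValRat p (x + 2415 ^ 4)) ∧ SqP p 1 x) ∨
      (Odd (padicValRat p (x + 2415 ^ 4)) ∧ SqP p 1 (-x)) := by
  refine even_or_odd_of_sub h₁ h₂ h₃ hy ?_ ?_ ⟨1 / 2415 ^ 2, ?_⟩
  · rwa [show x + 2415 ^ 4 - (x + 1768 ^ 4) = 2415 ^ 4 - 1768 ^ 4 by ring]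
  · have := (hasVal_intCast hp').pow 4
    norm_num at this ⊢
    exact this
  · exact Or.inl (by field_simp; ring)

end Explicit

instance fact_prime_7 : Fact (Nat.Prime 7) := ⟨by norm_num⟩
instance fact_prime_13 : Fact (Nat.Prime 13) := ⟨by norm_num⟩
instance fact_prime_23 : Fact (Nat.Prime 23) := ⟨by norm_num⟩
instance fact_prime_41 : Fact (Nat.Prime 41) := ⟨by norm_num⟩
instance fact_prime_47 : Fact (Nat.Prime 47) := ⟨by norm_num⟩
instance fact_prime_73 : Fact (Nat.Prime 73) := ⟨by norm_num⟩
instance fact_prime_89 : Fact (Nat.Prime 89) := ⟨by norm_num⟩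
instance fact_prime_647 : Fact (Nat.Prime 647) := ⟨by norm_num⟩
instance fact_prime_5 : Fact (Nat.Prime 5) := ⟨by norm_num⟩

/-- Eleven linear equations over 𝔽₂ in ten exponents, with only the zero solution. -/
theorem explicit_parity {a₃ a₅ a₇ a₂₃ a₁₇ a₄₁ a₇₃ a₄₇ a₈₉ a₆₄₇ : ℕ}
    (h₃ : Even (a₁₇ + a₄₁ + a₄₇ + a₈₉ + a₆₄₇))
    (h₅ : Even (a₁₇ + a₇₃ + a₄₇ + a₆₄₇))
    (h₇ : Even (a₁₇ + a₄₁ + a₇₃ + a₄₇ + a₈₉ + a₆₄₇))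
    (h₂₃ : Even (a₁₇ + a₈₉))
    (h₁₃ : Even (a₅ + a₇ + a₄₁ + a₇₃ + a₄₇ + a₈₉))
    (h₂ : Even (a₃ + a₅))
    (h₄₁ : Even (a₃ + a₇ + a₁₇)) (h₇₃ : Even (a₅ + a₇ + a₁₇))
    (h₈₉ : Even (a₃ + a₇ + a₂₃)) (h₄₇ : Even (a₄₇ + a₅ + a₂₃)) (h₆₄₇ : Even (a₆₄₇ + a₅ + a₂₃)) :
    Even a₃ ∧ Even a₅ ∧ Even a₇ ∧ Even a₂₃ ∧ Even a₁₇ ∧ Even a₄₁ ∧ Even a₇₃ ∧ Even a₄₇ ∧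
      Even a₈₉ ∧ Even a₆₄₇ := by
  simp only [Nat.even_iff] at *
  have e73 : a₇₃ % 2 = 0 := by clear * - h₃ h₇; omega
  have e17 : a₁₇ % 2 = 0 := by clear * - h₅ h₄₇ h₆₄₇ e73; omega
  have e89 : a₈₉ % 2 = 0 := by clear * - h₂₃ e17; omega
  have e41 : a₄₁ % 2 = 0 := by clear * - h₃ h₅ e73 e89; omega
  have e47 : a₄₇ % 2 = 0 := by clear * - h₁₃ h₇₃ e17 e41 e73 e89; omega
  have e647 : a₆₄₇ % 2 = 0 := by clear * - h₄₇ h₆₄₇ e47; omega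
  have e23 : a₂₃ % 2 = 0 := by clear * - h₄₁ h₈₉ e17; omega
  have e5 : a₅ % 2 = 0 := by clear * - h₄₇ e47 e23; omega
  have e7 : a₇ % 2 = 0 := by clear * - h₇₃ e5 e17; omega
  have e3 : a₃ % 2 = 0 := by clear * - h₂ e5; omega
  exact ⟨e3, e5, e7, e23, e17, e41, e73, e47, e89, e647⟩

theorem toNat_emod_two (n : ℤ) : Even (n + (n % 2).toNat) := by
  rw [Int.even_iff, Int.toNat_of_nonneg (Int.emod_nonneg n two_ne_zero)]
  omega

theorem mem_of_prime_dvd_prod {p : ℕ} (hp : p.Prime) (l : List ℕ) (hl : ∀ q ∈ l, q.Prime)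
    (h : p ∣ l.prod) : p ∈ l := by
  obtain ⟨q, hq, hd⟩ := hp.prime.dvd_prod_iff.1 h
  rwa [(Nat.prime_dvd_prime_iff_eq hp (hl q hq)).1 hd]

theorem chi_eight_of_sqP {c : ℤ} {k : ℕ} (e : ZMod.χ₈ (c : ZMod 8) = (-1) ^ k) (hc : ¬ (2 : ℤ) ∣ c)
    (h : SqP 2 3 c) : Even k := by
  have h1 : (c : ZMod 8) = 1 := by
    have := mod_eight_of_sqP hc h
    have := (ZMod.intCast_eq_intCast_iff_dvd_sub 1 c 8).2 (by omega)
    rw [← this, Int.cast_one]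
  rw [h1, map_one] at e
  exact (neg_one_pow_eq_one_iff_even (by norm_num)).1 e.symm

theorem explicit_even {x y : ℚ} (h₁ : 0 < x) (hy : y ^ 2 = x * (x + 2415 ^ 4) * (x + 1768 ^ 4))
    {p : ℕ} (hp : p.Prime) : Even (padicValRat p x + padicValRat p (x + 2415 ^ 4) +
      padicValRat p (x + 1768 ^ 4)) := by
  have h₂ : 0 < x + 2415 ^ 4 := by positivity
  have h₃ : 0 < x + 1768 ^ 4 := by positivity
  have : Fact p.Prime := ⟨hp⟩
  rw [← padicValRat.mul h₁.ne' h₂.ne', ← padicValRat.mul (mul_pos h₁ h₂).ne' h₃.ne', ← hy,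
    padicValRat.pow]
  exact ⟨padicValRat p y, by push_cast; ring⟩

/-- For p dividing neither 2415 nor 1768, the distances from the root 0 are p-units. Of the primes
of 1768, the valuations at 2 and 13 are assumed even and 17 remains in the support. -/
theorem explicit_even₁ {x y : ℚ} (h₁ : 0 < x) (hy : y ^ 2 = x * (x + 2415 ^ 4) * (x + 1768 ^ 4))
    (h2 : Even (padicValRat 2 x)) (h13 : Even (padicValRat 13 x)) {p : ℕ} (hp : p.Prime)
    (hps : p ∉ ({3, 5, 7, 23, 17} : Finset ℕ)) : Even (padicValRat p x) := by
  have h₂ : 0 < x + 2415 ^ 4 := by positivity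
  have h₃ : 0 < x + 1768 ^ 4 := by positivity
  have : Fact p.Prime := ⟨hp⟩
  have n1 : ¬ (p : ℤ) ∣ 2415 := by
    intro hd
    have := mem_of_prime_dvd_prod hp [3, 5, 7, 23] (by norm_num) (by exact_mod_cast hd)
    simp only [List.mem_cons, List.not_mem_nil, or_false] at this
    rcases this with rfl | rfl | rfl | rfl <;> exact hps (by decide)
  by_cases hd : (p : ℤ) ∣ 1768
  · have := mem_of_prime_dvd_prod hp [2, 2, 2, 13, 17] (by norm_num) (by exact_mod_cast hd)
    simp only [List.mem_cons, List.not_mem_nil, or_false] at this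
    rcases this with rfl | rfl | rfl | rfl | rfl
    · exact h2
    · exact h2
    · exact h2
    · exact h13
    · exact absurd (by decide) hps
  refine even_of_sub h₁.ne' h₂.ne' h₃.ne' hy ?_ ?_
  · have := (hasVal_intCast n1).pow 4
    norm_num at this ⊢
    exact this
  · have := (hasVal_intCast hd).pow 4
    norm_num at this ⊢
    exact this

theorem explicit_sqP₂' {x y : ℚ} (h₁ : 0 < x) (hy : y ^ 2 = x * (x + 2415 ^ 4) * (x + 1768 ^ 4))
    {p : ℕ} [Fact p.Prime] (hp : (p : ℤ) ∣ 1768) (hp' : ¬ (p : ℤ) ∣ 2415) :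
    SqP p 1 (x + 2415 ^ 4) := by
  have h₂ : 0 < x + 2415 ^ 4 := by positivity
  have h₃ : 0 < x + 1768 ^ 4 := by positivity
  refine explicit_sqP₂ le_rfl ?_ hp' h₁.ne' h₂.ne' h₃.ne' hy
  have := valGE_intCast_of_dvd ((hp.mul_right (1768 ^ 3)).neg_right)
  norm_num at this ⊢
  exact this

/-- Primes dividing 1768 are covered by a local square condition. The rest of the support comes from
2415 and from 2415⁴ - 1768⁴ = 41² · 73² · 47 · 89 · 647. -/
theorem explicit_even₂ {x y : ℚ} (h₁ : 0 < x) (hy : y ^ 2 = x * (x + 2415 ^ 4) * (x + 1768 ^ 4))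
    {p : ℕ} (hp : p.Prime) (hps : p ∉ ({3, 5, 7, 23, 41, 73, 47, 89, 647} : Finset ℕ)) :
    Even (padicValRat p (x + 2415 ^ 4)) := by
  have h₂ : 0 < x + 2415 ^ 4 := by positivity
  have h₃ : 0 < x + 1768 ^ 4 := by positivity
  have : Fact p.Prime := ⟨hp⟩
  have n1 : ¬ (p : ℤ) ∣ 2415 := by
    intro hd
    have := mem_of_prime_dvd_prod hp [3, 5, 7, 23] (by norm_num) (by exact_mod_cast hd)
    simp only [List.mem_cons, List.not_mem_nil, or_false] at this
    rcases this with rfl | rfl | rfl | rfl <;> exact hps (by decide)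
  by_cases hd : (p : ℤ) ∣ 1768
  · exact (explicit_sqP₂' h₁ hy hd n1).even le_rfl
  have n2 : ¬ (p : ℤ) ∣ 2415 ^ 4 - 1768 ^ 4 := by
    intro hd
    have := mem_of_prime_dvd_prod hp [41, 41, 73, 73, 47, 89, 647] (by norm_num)
      (by norm_num at hd ⊢; exact_mod_cast hd)
    simp only [List.mem_cons, List.not_mem_nil, or_false] at this
    rcases this with rfl | rfl | rfl | rfl | rfl | rfl | rfl <;> exact hps (by decide)
  refine even_of_sub h₂.ne' h₁.ne' h₃.ne' (y := y) (by rw [hy]; ring) ?_ ?_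
  · have := ((hasVal_intCast n1).pow 4).neg
    norm_num at this ⊢
    exact this
  · have := (hasVal_intCast n2).neg
    norm_num at this ⊢
    exact this

/-- At 3, 5, 7, 23 the factor x + 1768⁴ is a local square, so x and x + 2415⁴ have valuations of
equal parity there. Hence one exponent function b serves both. -/
theorem explicit_sqClass {x y : ℚ} (h₁ : 0 < x)
    (hy : y ^ 2 = x * (x + 2415 ^ 4) * (x + 1768 ^ 4))
    (h2 : Even (padicValRat 2 x)) (h13 : Even (padicValRat 13 x)) :
    ∃ b : ℕ → ℕ, ∃ r₁ r₂ : ℚ, r₁ ≠ 0 ∧ r₂ ≠ 0 ∧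
      x = (∏ p ∈ ({3, 5, 7, 23, 17} : Finset ℕ), (p : ℚ) ^ b p) * r₁ ^ 2 ∧
      x + 2415 ^ 4 =
        (∏ p ∈ ({3, 5, 7, 23, 41, 73, 47, 89, 647} : Finset ℕ), (p : ℚ) ^ b p) * r₂ ^ 2 ∧
      Even (padicValRat 47 (x + 2415 ^ 4) + b 47) ∧
      Even (padicValRat 647 (x + 2415 ^ 4) + b 647) := by
  have h₂ : 0 < x + 2415 ^ 4 := by positivity
  have h₃ : 0 < x + 1768 ^ 4 := by positivity
  obtain ⟨b, hb⟩ : ∃ b : ℕ → ℕ, b = fun p => if p ∈ ({3, 5, 7, 23, 17} : Finset ℕ) then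
    (padicValRat p x % 2).toNat else (padicValRat p (x + 2415 ^ 4) % 2).toNat := ⟨_, rfl⟩
  have b1 : ∀ p ∈ ({3, 5, 7, 23, 17} : Finset ℕ), Even (padicValRat p x + b p) := by
    intro p hp
    rw [hb]
    simp only [if_pos hp]
    exact toNat_emod_two _
  have b2 : ∀ p ∉ ({3, 5, 7, 23, 17} : Finset ℕ), Even (padicValRat p (x + 2415 ^ 4) + b p) := by
    intro p hp
    rw [hb]
    simp only [if_neg hp]
    exact toNat_emod_two _
  obtain ⟨r₁, hr₁, e₁⟩ := Rat.exists_eq_prod_mul_sq h₁ {3, 5, 7, 23, 17} b (by norm_num)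
    (fun p hp hps => explicit_even₁ h₁ hy h2 h13 hp hps) b1
  have b12 : ∀ p : ℕ, p.Prime → p ∈ ({3, 5, 7, 23, 17} : Finset ℕ) → (p : ℤ) ∣ 2415 →
      ¬ (p : ℤ) ∣ 1768 → Even (padicValRat p (x + 2415 ^ 4) + b p) := by
    intro p hp hps hd hd'
    have : Fact p.Prime := ⟨hp⟩
    have k1 := b1 p hps
    have k2 := (explicit_sqP₃ hd hd' h₁.ne' h₂.ne' h₃.ne' hy).even le_rfl
    have k3 := explicit_even h₁ hy hp
    rw [Int.even_iff] at *
    omega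
  obtain ⟨r₂, hr₂, e₂⟩ := Rat.exists_eq_prod_mul_sq h₂ {3, 5, 7, 23, 41, 73, 47, 89, 647} b
    (by norm_num) (fun p hp hps => explicit_even₂ h₁ hy hp hps) (by
    intro p hp
    simp only [Finset.mem_insert, Finset.mem_singleton] at hp
    rcases hp with rfl | rfl | rfl | rfl | rfl | rfl | rfl | rfl | rfl
    · exact b12 _ (by norm_num) (by decide) (by norm_num) (by norm_num)
    · exact b12 _ (by norm_num) (by decide) (by norm_num) (by norm_num)
    · exact b12 _ (by norm_num) (by decide) (by norm_num) (by norm_num)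
    · exact b12 _ (by norm_num) (by decide) (by norm_num) (by norm_num)
    all_goals exact b2 _ (by decide))
  exact ⟨b, r₁, r₂, hr₁, hr₂, e₁, e₂, b2 47 (by decide), b2 647 (by decide)⟩

theorem even_add_of_even {v : ℤ} {a c d : ℕ} (h : Even (v + a)) (k : Even v)
    (h' : Even (c + d)) : Even (a + c + d) := by
  rw [Int.even_iff] at h k
  rw [Nat.even_iff] at h' ⊢
  omega

theorem even_add_of_odd {v : ℤ} {a c d : ℕ} (h : Even (v + a)) (k : Odd v)
    (h' : Even (1 + c + d)) : Even (a + c + d) := by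
  rw [Int.even_iff] at h
  rw [Int.odd_iff] at k
  rw [Nat.even_iff] at h' ⊢
  omega

-- The square classes of the three factors are products of ten primes with unknown exponents. Each
-- local condition becomes a linear equation modulo 2 through the Legendre symbols of these primes,
-- or through the character modulo 8 at p = 2, and `explicit_parity` solves the system.
set_option maxHeartbeats 800000 in
theorem explicit_isSquare {x y : ℚ} (h₁ : 0 < x) (hy0 : y ≠ 0)
    (hy : y ^ 2 = x * (x + 2415 ^ 4) * (x + 1768 ^ 4))
    (h2 : Even (padicValRat 2 x)) (h13 : Even (padicValRat 13 x)) :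
    IsSquare x ∧ IsSquare (x + 2415 ^ 4) ∧ IsSquare (x + 1768 ^ 4) := by
  have h₂ : 0 < x + 2415 ^ 4 := by positivity
  have h₃ : 0 < x + 1768 ^ 4 := by positivity
  have H₃ := fun (p : ℕ) [Fact p.Prime] (hp : (p : ℤ) ∣ 2415) (hp' : ¬ (p : ℤ) ∣ 1768) =>
    explicit_sqP₃ hp hp' h₁.ne' h₂.ne' h₃.ne' hy
  have H₁ := fun (p : ℕ) [Fact p.Prime] (hp : (p : ℤ) ∣ 2415 ^ 4 - 1768 ^ 4)
      (hp' : ¬ (p : ℤ) ∣ 2415) (i : ℤ) (hi : (p : ℤ) ∣ i ^ 2 + 1) =>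
    explicit_sqP₁ hp hp' i hi h₁.ne' h₂.ne' h₃.ne' hy
  have H₀ := fun (p : ℕ) [Fact p.Prime] (hp : HasVal p 1 (2415 ^ 4 - 1768 ^ 4 : ℚ))
      (hp' : ¬ (p : ℤ) ∣ 2415) => explicit_sqP_or hp hp' h₁.ne' h₂.ne' h₃.ne' hy
  -- Being a square modulo 8 requires 2 · 3 - 1 = 5 factors of 2 in 1768⁴, which has twelve.
  have s2 : SqP 2 3 (x + 2415 ^ 4) := explicit_sqP₂ (by norm_num)
    (valGE_of_eq 5 (-1768 ^ 4 / 32) 1 (by norm_num) (by norm_num)) (by norm_num)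
    h₁.ne' h₂.ne' h₃.ne' hy
  have s3 := H₃ 3 (by norm_num) (by norm_num)
  have s5 := H₃ 5 (by norm_num) (by norm_num)
  have s7 := H₃ 7 (by norm_num) (by norm_num)
  have s23 := H₃ 23 (by norm_num) (by norm_num)
  have s13 := explicit_sqP₂' h₁ hy (p := 13) (by norm_num) (by norm_num)
  -- The square roots of -1: 9² + 1 = 2 · 41, 27² + 1 = 10 · 73, 34² + 1 = 13 · 89.
  have s41 := H₁ 41 (by norm_num) (by norm_num) 9 (by norm_num)
  have s73 := H₁ 73 (by norm_num) (by norm_num) 27 (by norm_num)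
  have s89 := H₁ 89 (by norm_num) (by norm_num) 34 (by norm_num)
  have s47 := H₀ 47 (hasVal_of_eq 1 ((2415 ^ 4 - 1768 ^ 4) / 47) 1 (by norm_num) (by norm_num)
    (by norm_num)) (by norm_num)
  have s647 := H₀ 647 (hasVal_of_eq 1 ((2415 ^ 4 - 1768 ^ 4) / 647) 1 (by norm_num) (by norm_num)
    (by norm_num)) (by norm_num)
  obtain ⟨b, r₁, r₂, hr₁, hr₂, e₁, e₂, c47, c647⟩ := explicit_sqClass h₁ hy h2 h13
  simp only [Finset.prod_insert, Finset.prod_singleton, Finset.mem_insert, Finset.mem_singleton,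
    Nat.reduceEqDiff, or_self, not_false_eq_true, Nat.cast_ofNat] at e₁ e₂
  clear H₀ H₁ H₃ h13 h2
  generalize b 3 = a₃ at *
  generalize b 5 = a₅ at *
  generalize b 7 = a₇ at *
  generalize b 23 = a₂₃ at *
  generalize b 17 = a₁₇ at *
  generalize b 41 = a₄₁ at *
  generalize b 73 = a₇₃ at *
  generalize b 47 = a₄₇ at *
  generalize b 89 = a₈₉ at *
  generalize b 647 = a₆₄₇ at *
  -- The third class is the product of the first two; the exponents at 3, 5, 7, 23 occur twice and
  -- go into the square.
  have e₃ : x + 1768 ^ 4 = (17 ^ a₁₇ * (41 ^ a₄₁ * (73 ^ a₇₃ * (47 ^ a₄₇ * (89 ^ a₈₉ * 647 ^ a₆₄₇)))))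
    * (y / (3 ^ a₃ * 5 ^ a₅ * 7 ^ a₇ * 23 ^ a₂₃ * (17 ^ a₁₇ * (41 ^ a₄₁ * (73 ^ a₇₃ * (47 ^ a₄₇ *
      (89 ^ a₈₉ * 647 ^ a₆₄₇))))) * r₁ * r₂)) ^ 2 := by
    have : x + 1768 ^ 4 = y ^ 2 / (x * (x + 2415 ^ 4)) := by
      rw [hy]; field_simp
    rw [this, e₂, e₁]
    field_simp
  rw [e₃] at s3 s5 s7 s23
  rw [e₂] at s2 s13
  have E {p : ℕ} [Fact p.Prime] {c : ℤ} {q r : ℚ} {k : ℕ} (h : SqP p 1 (q * r ^ 2)) (hq : q = c)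
      (e : legendreSym p c = (-1) ^ k) : Even k := even_of_sqP e (hq ▸ h.of_mul_sq)
  have k₃ := E (c := (17 ^ a₁₇ * (41 ^ a₄₁ * (73 ^ a₇₃ * (47 ^ a₄₇ * (89 ^ a₈₉ * 647 ^ a₆₄₇)))))) (k := a₁₇ + a₄₁ + a₄₇ + a₈₉ + a₆₄₇) s3
    (by push_cast; ring) (by norm_num [legendreSym.mul, legendreSym_pow, pow_add, mul_assoc])
  have k₅ := E (c := (17 ^ a₁₇ * (41 ^ a₄₁ * (73 ^ a₇₃ * (47 ^ a₄₇ * (89 ^ a₈₉ * 647 ^ a₆₄₇)))))) (k := a₁₇ + a₇₃ + a₄₇ + a₆₄₇) s5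
    (by push_cast; ring) (by norm_num [legendreSym.mul, legendreSym_pow, pow_add, mul_assoc])
  have k₇ := E (c := (17 ^ a₁₇ * (41 ^ a₄₁ * (73 ^ a₇₃ * (47 ^ a₄₇ * (89 ^ a₈₉ * 647 ^ a₆₄₇)))))) (k := a₁₇ + a₄₁ + a₇₃ + a₄₇ + a₈₉ + a₆₄₇) s7
    (by push_cast; ring) (by norm_num [legendreSym.mul, legendreSym_pow, pow_add, mul_assoc])
  have k₂₃ := E (c := (17 ^ a₁₇ * (41 ^ a₄₁ * (73 ^ a₇₃ * (47 ^ a₄₇ * (89 ^ a₈₉ * 647 ^ a₆₄₇)))))) (k := a₁₇ + a₈₉) s23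
    (by push_cast; ring) (by norm_num [legendreSym.mul, legendreSym_pow, pow_add, mul_assoc])
  have k₁₃ := E (c := (3 ^ a₃ * (5 ^ a₅ * (7 ^ a₇ * (23 ^ a₂₃ * (41 ^ a₄₁ * (73 ^ a₇₃ * (47 ^ a₄₇ * (89 ^ a₈₉ *
      647 ^ a₆₄₇))))))))) (k := a₅ + a₇ + a₄₁ + a₇₃ + a₄₇ + a₈₉) s13
    (by push_cast; ring) (by norm_num [legendreSym.mul, legendreSym_pow, pow_add, mul_assoc])
  have k₂ : Even (a₃ + a₅) := by
    refine chi_eight_of_sqP (c := (3 ^ a₃ * (5 ^ a₅ * (7 ^ a₇ * (23 ^ a₂₃ * (41 ^ a₄₁ * (73 ^ a₇₃ * (47 ^ a₄₇ * (89 ^ a₈₉ *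
      647 ^ a₆₄₇))))))))) ?_ ?_ ?_
    · push_cast
      simp only [map_mul, map_pow]
      rw [show ZMod.χ₈ 3 = -1 by decide, show ZMod.χ₈ 5 = -1 by decide,
        show ZMod.χ₈ 7 = 1 by decide, show ZMod.χ₈ 23 = 1 by decide,
        show ZMod.χ₈ 41 = 1 by decide, show ZMod.χ₈ 73 = 1 by decide,
        show ZMod.χ₈ 47 = 1 by decide, show ZMod.χ₈ 89 = 1 by decide,
        show ZMod.χ₈ 647 = 1 by decide]
      simp [pow_add]
    · rw [← even_iff_two_dvd, Int.not_even_iff_odd]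
      simp only [Int.odd_mul]
      refine ⟨?_, ?_, ?_, ?_, ?_, ?_, ?_, ?_, ?_⟩ <;> exact Odd.pow (by decide)
    · have := s2.of_mul_sq
      push_cast
      exact this
  have s47' : Even (a₄₇ + a₅ + a₂₃) := by
    rcases s47 with ⟨k, s⟩ | ⟨k, s⟩
    · rw [e₁] at s
      have := E (c := (3 ^ a₃ * (5 ^ a₅ * (7 ^ a₇ * (23 ^ a₂₃ * 17 ^ a₁₇))))) (k := a₅ + a₂₃) s
        (by push_cast; ring) (by norm_num [legendreSym.mul, legendreSym_pow, pow_add, mul_assoc])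
      exact even_add_of_even c47 k this
    · rw [e₁, ← neg_mul] at s
      have := E (c := -1 * (3 ^ a₃ * (5 ^ a₅ * (7 ^ a₇ * (23 ^ a₂₃ * 17 ^ a₁₇))))) (k := 1 + a₅ + a₂₃) s
        (by push_cast; ring) (by rw [legendreSym.mul]; norm_num [legendreSym.mul, legendreSym_pow, pow_add, mul_assoc])
      exact even_add_of_odd c47 k this
  have s647' : Even (a₆₄₇ + a₅ + a₂₃) := by
    rcases s647 with ⟨k, s⟩ | ⟨k, s⟩
    · rw [e₁] at s
      have := E (c := (3 ^ a₃ * (5 ^ a₅ * (7 ^ a₇ * (23 ^ a₂₃ * 17 ^ a₁₇))))) (k := a₅ + a₂₃) s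
        (by push_cast; ring) (by norm_num [legendreSym.mul, legendreSym_pow, pow_add, mul_assoc])
      exact even_add_of_even c647 k this
    · rw [e₁, ← neg_mul] at s
      have := E (c := -1 * (3 ^ a₃ * (5 ^ a₅ * (7 ^ a₇ * (23 ^ a₂₃ * 17 ^ a₁₇))))) (k := 1 + a₅ + a₂₃) s
        (by push_cast; ring) (by rw [legendreSym.mul]; norm_num [legendreSym.mul, legendreSym_pow, pow_add, mul_assoc])
      exact even_add_of_odd c647 k this
  rw [e₁] at s41 s73 s89
  have k₄₁ := E (c := (3 ^ a₃ * (5 ^ a₅ * (7 ^ a₇ * (23 ^ a₂₃ * 17 ^ a₁₇))))) (k := a₃ + a₇ + a₁₇) s41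
    (by push_cast; ring) (by norm_num [legendreSym.mul, legendreSym_pow, pow_add, mul_assoc])
  have k₇₃ := E (c := (3 ^ a₃ * (5 ^ a₅ * (7 ^ a₇ * (23 ^ a₂₃ * 17 ^ a₁₇))))) (k := a₅ + a₇ + a₁₇) s73
    (by push_cast; ring) (by norm_num [legendreSym.mul, legendreSym_pow, pow_add, mul_assoc])
  have k₈₉ := E (c := (3 ^ a₃ * (5 ^ a₅ * (7 ^ a₇ * (23 ^ a₂₃ * 17 ^ a₁₇))))) (k := a₃ + a₇ + a₂₃) s89
    (by push_cast; ring) (by norm_num [legendreSym.mul, legendreSym_pow, pow_add, mul_assoc])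
  obtain ⟨t₃, t₅, t₇, t₂₃, t₁₇, t₄₁, t₇₃, t₄₇, t₈₉, t₆₄₇⟩ :=
    explicit_parity k₃ k₅ k₇ k₂₃ k₁₃ k₂ k₄₁ k₇₃ k₈₉ s47' s647'
  have sq {k : ℕ} (h : Even k) (q : ℚ) : IsSquare (q ^ k) := h.isSquare_pow q
  refine ⟨?_, ?_, ?_⟩
  · rw [e₁]
    exact ((sq t₃ 3).mul ((sq t₅ 5).mul ((sq t₇ 7).mul ((sq t₂₃ 23).mul (sq t₁₇ 17))))).mul
      (IsSquare.sq r₁)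
  · rw [e₂]
    exact ((sq t₃ 3).mul ((sq t₅ 5).mul ((sq t₇ 7).mul ((sq t₂₃ 23).mul ((sq t₄₁ 41).mul
      ((sq t₇₃ 73).mul ((sq t₄₇ 47).mul ((sq t₈₉ 89).mul (sq t₆₄₇ 647))))))))).mul (IsSquare.sq r₂)
  · rw [e₃]
    exact ((sq t₁₇ 17).mul ((sq t₄₁ 41).mul ((sq t₇₃ 73).mul ((sq t₄₇ 47).mul ((sq t₈₉ 89).mul
      (sq t₆₄₇ 647)))))).mul (IsSquare.sq _)

/-! ### Signs and valuation parities as descent characters. -/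

section ParityBits

/-- The parity of the `p`-adic valuation. -/
def valBit (p : ℕ) (q : ℚ) : ZMod 2 := (padicValRat p q : ZMod 2)

/-- The sign, as an element of `ℤ/2`. -/
def signBit (q : ℚ) : ZMod 2 := if q < 0 then 1 else 0

theorem valBit_eq_zero_iff {p : ℕ} {q : ℚ} : valBit p q = 0 ↔ Even (padicValRat p q) := by
  rw [valBit, even_iff_two_dvd]
  exact ZMod.intCast_zmod_eq_zero_iff_dvd _ 2

theorem HasVal.valBit {p : ℕ} {n : ℤ} {q : ℚ} (h : HasVal p n q) : valBit p q = (n : ZMod 2) := by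
  rw [_root_.valBit, h.2]

theorem signBit_eq_zero_iff {q : ℚ} : signBit q = 0 ↔ 0 ≤ q := by
  rw [signBit]
  split_ifs with h
  · simpa using h
  · simpa using h

theorem valBit_mul (p : ℕ) [Fact p.Prime] (a b r : ℚ) (ha : a ≠ 0) (hb : b ≠ 0) (hr : r ≠ 0) :
    valBit p (a * b * r ^ 2) = valBit p a + valBit p b := by
  rw [valBit, padicValRat.mul (mul_ne_zero ha hb) (pow_ne_zero 2 hr), padicValRat.mul ha hb,
    padicValRat.pow]
  push_cast
  rw [show (2 : ZMod 2) = 0 by rfl, zero_mul, add_zero]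
  rfl

theorem signBit_mul (a b r : ℚ) (ha : a ≠ 0) (hb : b ≠ 0) (hr : r ≠ 0) :
    signBit (a * b * r ^ 2) = signBit a + signBit b := by
  have hr2 : 0 < r ^ 2 := by positivity
  simp only [signBit, mul_neg_iff, hr2, hr2.not_gt, and_true, and_false, false_or, mul_pos_iff]
  rcases lt_or_gt_of_ne ha with h | h <;> rcases lt_or_gt_of_ne hb with h' | h' <;>
    simp [h, h', h.not_gt, h'.not_gt]
  rfl

/-- The homomorphism obtained by composing a descent map with a quadratic character. -/
noncomputable def IsSplit.descentHom {W : WeierstrassCurve ℚ} {e₁ e₂ e₃ : ℚ}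
    (h : IsSplit W e₁ e₂ e₃) (f : ℚ → ZMod 2)
    (hf : ∀ a b r, a ≠ 0 → b ≠ 0 → r ≠ 0 → f (a * b * r ^ 2) = f a + f b) :
    W.toAffine.Point →+ ZMod 2 :=
  AddMonoidHom.mk' (fun P => f (descentMap e₁ e₂ e₃ P)) fun P Q => by
    obtain ⟨r, hr, e⟩ := h.descentMap_add P Q
    rw [e, hf _ _ _ (h.descentMap_ne_zero P) (h.descentMap_ne_zero Q) hr]

theorem exists_dual_shift {G : Type*} [AddCommGroup G] (χ : Fin 3 → G →+ ZMod 2) (g : Fin 3 → G)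
    (h : ∀ i j, χ i (g j) = if i = j then 1 else 0) (P : G) :
    ∃ a : Fin 3 → ZMod 2, ∀ i, χ i (P - ∑ j, (a j).val • g j) = 0 := by
  refine ⟨fun j => χ j P, fun i => ?_⟩
  rw [map_sub, map_sum]
  simp only [map_nsmul, h, smul_ite, smul_zero, Finset.sum_ite_eq, Finset.mem_univ, if_true]
  simp

end ParityBits

namespace IsSplit

variable {W : WeierstrassCurve ℚ} {e₁ e₂ e₃ : ℚ}

theorem isOfFinAddOrder_of_two_smul {P : W.toAffine.Point} (hP : 2 • P = 0) : IsOfFinAddOrder P :=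
  isOfFinAddOrder_iff_nsmul_eq_zero.2 ⟨2, two_pos, hP⟩

/-- Complete `2`-descent with three independent quadratic characters. -/
theorem exists_odd_smul_mem_of_descent (h : IsSplit W e₁ e₂ e₃) (B : W.toAffine.Point)
    (χ : Fin 3 → W.toAffine.Point →+ ZMod 2) (g : Fin 3 → W.toAffine.Point)
    (hχ : ∀ i j, χ i (g j) = if i = j then 1 else 0)
    (hg : ∀ j, ∃ m : ℤ, IsOfFinAddOrder (g j - m • B))
    (hker : ∀ x y hp, y ≠ 0 → (∀ i, χ i (Point.some x y hp) = 0) →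
      ∃ Q, 2 • Q = Point.some x y hp) :
    ∃ n : ℤ, Odd n ∧ ∀ P : W.toAffine.Point, ∃ m : ℤ, IsOfFinAddOrder (n • P - m • B) := by
  let H : AddSubgroup W.toAffine.Point := AddCommGroup.torsion _ ⊔ AddSubgroup.zmultiples B
  have hmem : ∀ P, P ∈ H ↔ ∃ m : ℤ, IsOfFinAddOrder (P - m • B) := by
    intro P
    rw [AddSubgroup.mem_sup]
    constructor
    · rintro ⟨t, ht, _, ⟨m, rfl⟩, rfl⟩
      exact ⟨m, by rw [add_sub_cancel_right]; exact ht⟩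
    · rintro ⟨m, hm⟩
      exact ⟨_, hm, _, ⟨m, rfl⟩, sub_add_cancel _ _⟩
  have hfin : {P : W.toAffine.Point | 2 • P = 0}.Finite :=
    Set.Finite.subset (Set.toFinite {0, Point.some e₁ 0 h.nonsingular_root,
      Point.some e₂ 0 h.swap₁₂.nonsingular_root, Point.some e₃ 0 h.rotate.nonsingular_root})
      fun P hP => h.eq_of_two_smul_eq_zero hP
  -- After subtraction of the dual combination of the g j, the point lies in the kernel of all
  -- characters, so it is a double or 2-torsion.
  have key : ∀ P : W.toAffine.Point, ∃ a : Fin 3 → ZMod 2, ∃ t, 2 • t = 0 ∧ ∃ R,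
      P = (∑ j, (a j).val • g j + t) + 2 • R := by
    intro P
    obtain ⟨a, ha⟩ := exists_dual_shift χ g hχ P
    refine ⟨a, ?_⟩
    generalize ∑ j, (a j).val • g j = s at ha
    by_cases h2 : 2 • (P - s) = 0
    · exact ⟨P - s, h2, 0, by rw [nsmul_zero, add_zero, add_sub_cancel]⟩
    · rcases hP : P - s with _ | ⟨x, y, hp⟩
      · exact absurd (by rw [hP]; exact nsmul_zero 2) h2
      · rw [hP, h.two_smul_eq_zero_iff] at h2
        obtain ⟨R, hR⟩ := hker x y hp h2 fun i => hP ▸ ha i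
        exact ⟨0, nsmul_zero 2, R, by rw [add_zero, hR, ← hP, add_sub_cancel]⟩
  have hFG : AddGroup.FG W.toAffine.Point := by
    refine h.fg_of_finite (s := Set.image2 (· + ·)
      (Set.range fun a : Fin 3 → ZMod 2 => ∑ j, (a j).val • g j)
      {P | 2 • P = 0}) ((Set.finite_range _).image2 _ hfin) fun P => ?_
    obtain ⟨a, t, ht, R, e⟩ := key P
    exact ⟨_, Set.mem_image2_of_mem ⟨a, rfl⟩ ht, R, e⟩
  obtain ⟨n, hn, hH⟩ := exists_odd_smul_mem H fun P => by
    obtain ⟨a, t, ht, R, e⟩ := key P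
    refine ⟨_, ?_, R, e⟩
    exact H.add_mem (H.sum_mem fun j _ => H.nsmul_mem ((hmem _).2 (hg j)) _)
      ((hmem _).2 ⟨0, by rw [zero_zsmul, sub_zero]; exact isOfFinAddOrder_of_two_smul ht⟩)
  exact ⟨n, hn, fun P => (hmem _).1 (hH P)⟩

end IsSplit

/-! ### The explicit curve has rank one. -/

section Explicit

theorem explicit_isSplit : IsSplit (legCurve 2415 1768) 0 (-2415 ^ 4) (-1768 ^ 4) :=
  legCurve_isSplit (by norm_num) (by norm_num) (by norm_num)

theorem explicit_rank_le : Module.rank ℤ (legCurve 2415 1768).toAffine.Point ≤ 1 := by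
  have hW := explicit_isSplit
  obtain ⟨yR, hR, H4⟩ := legCurve_exists_order_eight (t := 2993) hW (by norm_num)
  have H8 := (legCurve_root_ne hW H4).1
  -- The abscissa is u³v³ / g² with u = 2415, v = 1768 and g² = u² + uv + v² = 3637², that of the
  -- image of [0, abc].
  have hB : (legCurve 2415 1768).toAffine.Nonsingular (77839168368282048000 / 13227769)
      (2916751873887587202837604416000 / 48109395853) := by
    rw [hW.nonsingular_iff]; norm_num
  have dR := IsSplit.descentMap_of_ne (e₁ := 0) (e₂ := -2415 ^ 4) (e₃ := -1768 ^ 4) hR (by norm_num)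
  have dB := IsSplit.descentMap_of_ne (e₁ := 0) (e₂ := -2415 ^ 4) (e₃ := -1768 ^ 4) hB (by norm_num)
  have dT := IsSplit.descentMap_of_ne (e₁ := 0) (e₂ := -2415 ^ 4) (e₃ := -1768 ^ 4)
    hW.swap₁₂.nonsingular_root (by norm_num)
  have hT := hW.swap₁₂.two_smul_root
  generalize Point.some _ _ hR = R at H8 dR
  generalize Point.some _ _ hB = B at dB
  generalize Point.some _ _ hW.swap₁₂.nonsingular_root = T at hT dT
  have fT : IsOfFinAddOrder T := IsSplit.isOfFinAddOrder_of_two_smul hT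
  have fR : IsOfFinAddOrder R := isOfFinAddOrder_iff_nsmul_eq_zero.2 ⟨8, by norm_num, H8⟩
  let χ₀ := hW.descentHom signBit signBit_mul
  let χ₁ := hW.descentHom (valBit 2) (valBit_mul 2)
  let χ₂ := hW.descentHom (valBit 13) (valBit_mul 13)
  have t0 : χ₀ T = 1 := by
    change signBit (descentMap _ _ _ T) = 1
    rw [dT]; norm_num [signBit]
  have t1 : χ₁ T = 0 := by
    change valBit 2 (descentMap _ _ _ T) = 0
    rw [dT, (hasVal_of_eq (p := 2) 0 (-2415 ^ 4) 1 (by norm_num) (by norm_num) (by norm_num)).valBit]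
    rfl
  have t2 : χ₂ T = 0 := by
    change valBit 13 (descentMap _ _ _ T) = 0
    rw [dT, (hasVal_of_eq (p := 13) 0 (-2415 ^ 4) 1 (by norm_num) (by norm_num) (by norm_num)).valBit]
    rfl
  have r0 : χ₀ R = 0 := by
    change signBit (descentMap _ _ _ R) = 0
    rw [dR]; norm_num [signBit]
  have r1 : χ₁ R = 0 := by
    change valBit 2 (descentMap _ _ _ R) = 0
    rw [dR, (hasVal_of_eq (p := 2) 8 (109934564463360 / 2 ^ 8) 1 (by norm_num) (by norm_num)
      (by norm_num)).valBit]
    rfl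
  have r2 : χ₂ R = 1 := by
    change valBit 13 (descentMap _ _ _ R) = 1
    rw [dR, (hasVal_of_eq (p := 13) 3 (109934564463360 / 13 ^ 3) 1 (by norm_num) (by norm_num)
      (by norm_num)).valBit]
    rfl
  have b0 : χ₀ B = 0 := by
    change signBit (descentMap _ _ _ B) = 0
    rw [dB]; norm_num [signBit]
  have b1 : χ₁ B = 1 := by
    change valBit 2 (descentMap _ _ _ B) = 1
    rw [dB, (hasVal_of_eq (p := 2) 9 (77839168368282048000 / 2 ^ 9) 13227769 (by norm_num)
      (by norm_num) (by norm_num)).valBit]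
    rfl
  have b2 : χ₂ B = 1 := by
    change valBit 13 (descentMap _ _ _ B) = 1
    rw [dB, (hasVal_of_eq (p := 13) 3 (77839168368282048000 / 13 ^ 3) 13227769 (by norm_num)
      (by norm_num) (by norm_num)).valBit]
    rfl
  -- The values of (χ₀, χ₁, χ₂) are (1, 0, 0) at T, (0, 0, 1) at R and (0, 1, 1) at B, so T, B + R,
  -- R form a dual basis.
  obtain ⟨n, hn, H⟩ := hW.exists_odd_smul_mem_of_descent B ![χ₀, χ₁, χ₂] ![T, B + R, R] (by
      intro i j
      fin_cases i <;> fin_cases j <;> simp [t0, t1, t2, r0, r1, r2, b0, b1, b2] <;> rfl) (by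
      intro j
      fin_cases j
      · exact ⟨0, by simpa using fT⟩
      · exact ⟨1, by simpa using fR⟩
      · exact ⟨0, by simpa using fR⟩) (by
      intro x y hp hy hχ
      have hE := hW.nonsingular_iff.1 hp
      have hy2 : 0 < y ^ 2 := by positivity
      have hx : x ≠ 0 := by rintro rfl; simp at hE; exact hy hE
      have k0 : signBit (descentMap 0 (-2415 ^ 4) (-1768 ^ 4) (Point.some x y hp)) = 0 := hχ 0
      have k1 : valBit 2 (descentMap 0 (-2415 ^ 4) (-1768 ^ 4) (Point.some x y hp)) = 0 := hχ 1
      have k2 : valBit 13 (descentMap 0 (-2415 ^ 4) (-1768 ^ 4) (Point.some x y hp)) = 0 := hχ 2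
      rw [IsSplit.descentMap_of_ne hp hx, sub_zero] at k0 k1 k2
      rw [signBit_eq_zero_iff] at k0
      rw [valBit_eq_zero_iff] at k1 k2
      obtain ⟨q1, q2, q3⟩ := explicit_isSquare (lt_of_le_of_ne k0 hx.symm) hy
        (by rw [hE]; ring) k1 k2
      refine hW.exists_half_of_isSquare hp ?_ ?_ ?_
      · rwa [sub_zero]
      · rwa [sub_neg_eq_add]
      · rwa [sub_neg_eq_add])
  exact rank_le_one_of_smul B fun P => ⟨n, by rintro rfl; simp at hn, H P⟩

theorem explicit_rank : rationalRank (inducedCurve (famA (26 / 89)) (famB (26 / 89)) (famC (26 / 89))) = 1 := by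
  have hW := isSplit_of_ne (u := 1 - (26 / 89) ^ 2) (v := (26 / 89) ^ 2 + 2 * (26 / 89))
    (by norm_num) (by norm_num) (by norm_num) (by norm_num)
  obtain ⟨φ, -⟩ := fam_exists_equiv (w := 26 / 89) (by norm_num) (by norm_num) (by norm_num)
    (by norm_num) (by norm_num)
  -- Multiplication of u = 7245/7921 and v = 5304/7921 by 7921/3 gives 2415 and 1768; the roots
  -- scale by its fourth power, which is m².
  obtain ⟨ψ, -⟩ := hW.exists_scale_equiv (m := (7921 / 3) ^ 2) (r := 0) (W' := legCurve 2415 1768)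
    (by norm_num) (by
      have := explicit_isSplit
      norm_num at this ⊢
      exact this)
  refine le_antisymm ?_ (by simpa using fam_three.rank_pos)
  rw [rationalRank, (φ.trans ψ).toIntLinearEquiv.rank_eq]
  exact explicit_rank_le

end Explicit

namespace IsSplit

variable {W : WeierstrassCurve ℚ} {e₁ e₂ e₃ : ℚ}

theorem add_some_eq (h : IsSplit W e₁ e₂ e₃) {x₁ y₁ x₂ y₂ l x₃ y₃ : ℚ}
    (h₁ : W.toAffine.Nonsingular x₁ y₁) (h₂ : W.toAffine.Nonsingular x₂ y₂) (hx : x₁ ≠ x₂)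
    (hl : l * (x₁ - x₂) = y₁ - y₂) (hx₃ : x₃ = l ^ 2 + e₁ + e₂ + e₃ - x₁ - x₂)
    (hy₃ : y₃ = -(l * (x₃ - x₁) + y₁)) :
    ∃ h₃, Point.some x₁ y₁ h₁ + Point.some x₂ y₂ h₂ = Point.some x₃ y₃ h₃ := by
  obtain ⟨l', x, y, h₃, H, H1, H2, H3, -⟩ := h.add_spec h₁ h₂ fun H => hx H.1
  obtain rfl : l = l' := mul_right_cancel₀ (sub_ne_zero.2 hx) (hl.trans (H3 hx).symm)
  obtain rfl : x = x₃ := by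
    rw [hx₃]
    linear_combination (1 / 2) * (H1 1 - 2 * H1 0 + H1 (-1))
  obtain rfl : y = y₃ := H2.trans hy₃.symm
  exact ⟨h₃, H⟩

theorem two_smul_some_eq (h : IsSplit W e₁ e₂ e₃) {x₁ y₁ l x₃ y₃ : ℚ}
    (h₁ : W.toAffine.Nonsingular x₁ y₁) (hy : y₁ ≠ 0)
    (hl : 2 * y₁ * l = (x₁ - e₁) * (x₁ - e₂) + (x₁ - e₁) * (x₁ - e₃) + (x₁ - e₂) * (x₁ - e₃))
    (hx₃ : x₃ = l ^ 2 + e₁ + e₂ + e₃ - 2 * x₁) (hy₃ : y₃ = -(l * (x₃ - x₁) + y₁)) :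
    ∃ h₃, 2 • Point.some x₁ y₁ h₁ = Point.some x₃ y₃ h₃ := by
  obtain ⟨l', x, y, h₃, H, H1, H2, -⟩ := h.add_spec h₁ h₁ fun H => hy (by linarith [H.2])
  obtain ⟨k1, k2⟩ := h.slope_self H1
  obtain rfl : l = l' := mul_left_cancel₀ (mul_ne_zero two_ne_zero hy) (hl.trans k1.symm)
  obtain rfl : x = x₃ := k2.trans hx₃.symm
  obtain rfl : y = y₃ := H2.trans hy₃.symm
  exact ⟨h₃, by rw [two_nsmul, H]⟩

end IsSplit

/-! ### The auxiliary curve: torsion and squares. -/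

section AuxCurve

theorem auxCurve_isSplit : IsSplit auxCurve 1 3 (-3) := by
  constructor <;> norm_num [auxCurve]

theorem auxCurve_equation {x y : ℚ} (hp : auxCurve.toAffine.Nonsingular x y) :
    y ^ 2 = (x - 1) * (x - 3) * (x + 3) := by
  rw [auxCurve_isSplit.nonsingular_iff.1 hp]; ring

theorem auxCurve_pointVal_two_smul_of_neg (P : auxCurve.toAffine.Point) (n : ℤ) (hn : n < 0)
    (hP : PointVal 2 1 n P) : PointVal 2 1 (n - 2) (2 • P) := by
  obtain ⟨x, y, hp, rfl, hx⟩ := hP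
  have hE := auxCurve_equation hp
  have e2 : x - 3 = x - 1 - 2 := by ring
  have e3 : x + 3 = x - 1 + 4 := by ring
  have v2 : HasVal 2 n (x - 3) := e2 ▸ hx.sub_valGE (two_hasVal.valGE le_rfl) (by omega)
  have v3 : HasVal 2 n (x + 3) := e3 ▸ hx.add_valGE (four_hasVal.valGE le_rfl) (by omega)
  have vy := (hx.mul v2).mul v3
  rw [← hE] at vy
  have hy : y ≠ 0 := fun h => vy.1 (by rw [h]; norm_num)
  obtain ⟨x', y', hp', H, H1, -⟩ := auxCurve_isSplit.two_smul_spec hp hy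
  refine ⟨x', y', hp', H, ?_⟩
  have v8 : HasVal 2 3 (8 : ℚ) := hasVal_of_eq 3 1 1 (by norm_num) (by norm_num) (by norm_num)
  have vn : HasVal 2 (2 * n) ((x - 1) ^ 2 - (1 - 3) * (1 - -3)) := by
    rw [show (x - 1) ^ 2 - (1 - 3) * (1 - -3) = (x - 1) ^ 2 + 8 by ring]
    exact ((hx.pow 2).congr (by norm_num)).add_valGE (v8.valGE le_rfl) (by omega)
  have vd : HasVal 2 (2 + 3 * n) ((2 * y) ^ 2) := by
    rw [mul_pow]
    exact ((two_hasVal.pow 2).mul vy).congr (by push_cast; ring)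
  refine ((H1 ▸ vn.pow 2).of_mul vd).congr ?_
  push_cast; ring

/-- In x(2P) - 1 = ((x - 1)² + 8)² / (4(x - 1)(x - 3)(x + 3)) the valuation n of x - 1 is negative,
0, 1, 2 or at least 3, and in each case the quotient has valuation at most -2. -/
theorem auxCurve_pointVal_two_smul (P : auxCurve.toAffine.Point) (hP : 2 • P ≠ 0) :
    ∃ n : ℤ, n ≤ -2 ∧ PointVal 2 1 n (2 • P) := by
  rcases P with _ | ⟨x, y, hp⟩
  · exact absurd (nsmul_zero 2) hP
  have hy : y ≠ 0 := fun h => hP ((auxCurve_isSplit.two_smul_eq_zero_iff hp).2 h)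
  have hE := auxCurve_equation hp
  have hx0 : x - 1 ≠ 0 := fun h => hy (by rw [h] at hE; simpa using hE)
  have hx3 : x + 3 ≠ 0 := fun h => hy (by rw [h] at hE; simpa using hE)
  have hx2 : x - 3 ≠ 0 := fun h => hy (by rw [h] at hE; simpa using hE)
  obtain ⟨n, hx⟩ := exists_hasVal 2 hx0
  have e2 : x - 3 = x - 1 - 2 := by ring
  have e3 : x + 3 = x - 1 + 4 := by ring
  have v8 : HasVal 2 3 (8 : ℚ) := hasVal_of_eq 3 1 1 (by norm_num) (by norm_num) (by norm_num)
  by_cases hn : n < 0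
  · exact ⟨n - 2, by omega, auxCurve_pointVal_two_smul_of_neg _ n hn ⟨x, y, hp, rfl, hx⟩⟩
  obtain ⟨x', y', hp', H, H1, -⟩ := auxCurve_isSplit.two_smul_spec hp hy
  rw [show (x - 1) ^ 2 - (1 - 3) * (1 - -3) = (x - 1) ^ 2 + 8 by ring] at H1
  have fin : ∀ {a b c d : ℤ}, HasVal 2 a ((x - 1) ^ 2 + 8) → HasVal 2 b (x - 3) →
      HasVal 2 c (x + 3) → 2 * a - (2 + n + b + c) ≤ -2 →
      ∃ n : ℤ, n ≤ -2 ∧ PointVal 2 1 n (2 • Point.some x y hp) := by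
    intro a b c d h1 h2 h3 hle
    have vy := (hx.mul h2).mul h3
    rw [← hE] at vy
    have vd := (two_hasVal.pow 2).mul vy
    rw [← mul_pow] at vd
    have := (H1 ▸ h1.pow 2).of_mul vd
    refine ⟨_, ?_, x', y', hp', H, this⟩
    push_cast; omega
  obtain ⟨b, hb⟩ := exists_hasVal 2 hx2
  obtain ⟨c, hc⟩ := exists_hasVal 2 hx3
  have hsq : HasVal 2 (2 * n) ((x - 1) ^ 2) := (hx.pow 2).congr (by norm_num)
  rcases (show n = 0 ∨ n = 1 ∨ n = 2 ∨ 3 ≤ n by omega) with rfl | rfl | rfl | h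
  · refine fin (d := 0) (hsq.add_valGE (v8.valGE le_rfl) (by norm_num)) (e2 ▸ hx.sub_valGE
      (two_hasVal.valGE le_rfl) (by norm_num)) (e3 ▸ hx.add_valGE (four_hasVal.valGE le_rfl)
      (by norm_num)) (by norm_num)
  · have h2 : ValGE 2 2 (x - 3) := by
      rw [e2, sub_eq_add_neg]; exact hx.add_of_two two_hasVal.neg
    have hb2 : 2 ≤ b := by by_contra h; exact hb.not_valGE (by omega) h2
    exact fin (d := 0) (hsq.add_valGE (v8.valGE le_rfl) (by norm_num)) hb (e3 ▸ hx.add_valGE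
      (four_hasVal.valGE le_rfl) (by norm_num)) (by omega)
  · have h3 : ValGE 2 3 (x + 3) := e3 ▸ (hx.add_of_two four_hasVal)
    have hc3 : 3 ≤ c := by by_contra h; exact hc.not_valGE (by omega) h3
    refine fin (d := 0) (a := 3) ?_ (b := 1) ?_ hc (by omega)
    · rw [add_comm]; exact v8.add_valGE (hsq.valGE le_rfl) (by norm_num)
    · rw [e2, sub_eq_add_neg, add_comm]
      exact two_hasVal.neg.add_valGE (hx.valGE le_rfl) (by norm_num)
  · refine fin (d := 0) (a := 3) ?_ (b := 1) ?_ (c := 2) ?_ (by omega)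
    · rw [add_comm]; exact v8.add_valGE (hsq.valGE le_rfl) (by omega)
    · rw [e2, sub_eq_add_neg, add_comm]
      exact two_hasVal.neg.add_valGE (hx.valGE le_rfl) (by omega)
    · rw [e3, add_comm]
      exact four_hasVal.add_valGE (hx.valGE le_rfl) (by omega)

/-- A non-zero double has v₂(x - 1) < 0, and from there each further doubling lowers the valuation
by 2. -/
theorem auxCurve_isOfFinAddOrder_iff {P : auxCurve.toAffine.Point} :
    IsOfFinAddOrder P ↔ 2 • P = 0 := by
  refine ⟨fun h => ?_, fun h => IsSplit.isOfFinAddOrder_of_two_smul h⟩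
  by_contra h2
  obtain ⟨n, hn, hv⟩ := auxCurve_pointVal_two_smul P h2
  exact not_isOfFinAddOrder_of_pointVal auxCurve_pointVal_two_smul_of_neg (by omega) hv h.nsmul

theorem auxP_two_smul_ne : 2 • auxP ≠ 0 := by
  rw [auxP, ne_eq, auxCurve_isSplit.two_smul_eq_zero_iff]
  norm_num

theorem auxP_not_isOfFinAddOrder : ¬ IsOfFinAddOrder auxP := fun h =>
  auxP_two_smul_ne (auxCurve_isOfFinAddOrder_iff.1 h)

/-! ### Complete `2`-descent -/

/-- The roots differ by 2, 4 and 6, so only 2 and 3 can obstruct. The prime 2 is covered by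
hypothesis. At 3, odd valuation of x - 3 would make -(x - 1) a local square; but x - 1 is a square
and -1 is not one modulo 3. -/
theorem auxCurve_isSquare {x y : ℚ} (hy0 : y ≠ 0) (hE : y ^ 2 = (x - 1) * (x - 3) * (x + 3))
    (h₁ : 0 < x - 1) (h2 : Even (padicValRat 2 (x - 1))) (h2' : Even (padicValRat 2 (x + 3))) :
    IsSquare (x - 1) ∧ IsSquare (x - 3) ∧ IsSquare (x + 3) := by
  have h₃ : 0 < x + 3 := by linarith
  have h₂ : 0 < x - 3 := by
    have hy2 : 0 < y ^ 2 := by positivity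
    rw [hE] at hy2
    exact pos_of_mul_pos_right (pos_of_mul_pos_left hy2 h₃.le) h₁.le
  have v1 : ∀ p : ℕ, p.Prime → Even (padicValRat p (x - 1)) := by
    intro p hp
    have : Fact p.Prime := ⟨hp⟩
    by_cases hp2 : p = 2
    · exact hp2 ▸ h2
    have n2 : ¬ (p : ℤ) ∣ 2 := fun h =>
      hp2 ((Nat.prime_dvd_prime_iff_eq hp Nat.prime_two).1 (by exact_mod_cast h))
    have n4 : ¬ (p : ℤ) ∣ 2 ^ 2 := fun h => n2 ((Nat.prime_iff_prime_int.1 hp).dvd_of_dvd_pow h)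
    refine even_of_sub h₁.ne' h₂.ne' h₃.ne' hE ?_ ?_
    · rw [show x - 3 - (x - 1) = -((2 : ℤ) : ℚ) by push_cast; ring]
      exact (hasVal_intCast n2).neg
    · rw [show x + 3 - (x - 1) = ((2 ^ 2 : ℤ) : ℚ) by push_cast; ring]
      exact hasVal_intCast n4
  have s1 : IsSquare (x - 1) := Rat.isSquare_of_even_padicValRat h₁ v1
  have v2' : Even (padicValRat 3 (x - 3)) := by
    rcases even_or_odd_of_sub (p := 3) h₁.ne' h₂.ne' h₃.ne' hE
      (by
        rw [show x - 3 - (x + 3) = -6 by ring]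
        exact (hasVal_of_eq 1 2 1 (by norm_num) (by norm_num) (by norm_num)).neg)
      (by
        rw [show x - 3 - (x - 1) = -2 by ring]
        exact (hasVal_of_eq 0 2 1 (by norm_num) (by norm_num) (by norm_num)).neg)
      ⟨1, by
        rw [show (x - 3 - (x - 1)) * 1 ^ 2 - 1 = -3 by ring]
        exact (hasVal_self (p := 3)).neg.valGE le_rfl⟩ with h | h
    · exact h.1
    · exfalso
      obtain ⟨r, hr⟩ := s1
      have h' := h.2
      rw [show -(x - 1) = ((-1 : ℤ) : ℚ) * r ^ 2 by rw [hr]; push_cast; ring] at h'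
      have := legendreSym_eq_one_of_sqP (p := 3) (by norm_num) h'.of_mul_sq
      norm_num at this
  have s3 : IsSquare (x + 3) := by
    refine Rat.isSquare_of_even_padicValRat h₃ fun p hp => ?_
    have : Fact p.Prime := ⟨hp⟩
    by_cases hp2 : p = 2
    · exact hp2 ▸ h2'
    have n2 : ¬ (p : ℤ) ∣ 2 := fun h =>
      hp2 ((Nat.prime_dvd_prime_iff_eq hp Nat.prime_two).1 (by exact_mod_cast h))
    have n4 : ¬ (p : ℤ) ∣ 2 ^ 2 := fun h => n2 ((Nat.prime_iff_prime_int.1 hp).dvd_of_dvd_pow h)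
    by_cases hp3 : p = 3
    · subst hp3
      have e : padicValRat 3 (y ^ 2) = padicValRat 3 (x - 1) + padicValRat 3 (x - 3) +
          padicValRat 3 (x + 3) := by
        rw [hE, padicValRat.mul (mul_pos h₁ h₂).ne' h₃.ne', padicValRat.mul h₁.ne' h₂.ne']
      rw [padicValRat.pow] at e
      have := v1 3 hp
      push_cast at e
      rw [Int.even_iff] at *
      omega
    have n3 : ¬ (p : ℤ) ∣ 3 := fun h =>
      hp3 ((Nat.prime_dvd_prime_iff_eq hp Nat.prime_three).1 (by exact_mod_cast h))
    refine even_of_sub h₃.ne' h₁.ne' h₂.ne' (y := y) (by rw [hE]; ring) ?_ ?_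
    · rw [show x - 1 - (x + 3) = -((2 ^ 2 : ℤ) : ℚ) by push_cast; ring]
      exact (hasVal_intCast n4).neg
    · rw [show x - 3 - (x + 3) = -(((2 : ℤ) : ℚ) * ((3 : ℤ) : ℚ)) by push_cast; ring]
      exact ((hasVal_intCast n2).mul (hasVal_intCast n3)).neg
  refine ⟨s1, ?_, s3⟩
  obtain ⟨r, hr⟩ := s1
  obtain ⟨s, hs⟩ := s3
  have hr0 : r ≠ 0 := by rintro rfl; linarith
  have hs0 : s ≠ 0 := by rintro rfl; linarith
  refine ⟨y / (r * s), ?_⟩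
  field_simp
  rw [hE, hr, hs]; ring

end AuxCurve

/-! ### From odd index to a generator. -/

section Generator

variable {G : Type*} [AddCommGroup G]

theorem isOfFinAddOrder_of_zsmul {t : G} {n : ℤ} (hn : n ≠ 0) (h : IsOfFinAddOrder (n • t)) :
    IsOfFinAddOrder t := by
  obtain ⟨k, hk, e⟩ := isOfFinAddOrder_iff_nsmul_eq_zero.1 h
  refine isOfFinAddOrder_iff_zsmul_eq_zero.2 ⟨k * n, mul_ne_zero (by exact_mod_cast hk.ne') hn, ?_⟩
  rw [mul_zsmul, natCast_zsmul, e]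

/-- A point which is a multiple, up to torsion, of no smaller point generates a group in which it
has odd index up to torsion. -/
theorem exists_sub_zsmul_of_odd {P : G} (htors : ∀ t : G, IsOfFinAddOrder t → 2 • t = 0)
    (hP : ¬ IsOfFinAddOrder P)
    (hdiv : ∀ (R : G) (n : ℤ), Odd n → n • R = P →
      ∃ ε : ℤ, (ε = 1 ∨ ε = -1) ∧ IsOfFinAddOrder (R - ε • P))
    {Q : G} {n m : ℤ} (hn : Odd n) (h : IsOfFinAddOrder (n • Q - m • P)) :
    ∃ k : ℤ, IsOfFinAddOrder (Q - k • P) := by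
  have hn0 : n ≠ 0 := by rintro rfl; simp at hn
  have hg : (Int.gcd n m : ℤ) ≠ 0 := by
    rw [ne_eq, Int.natCast_eq_zero, Int.gcd_eq_zero_iff]; tauto
  obtain ⟨n', hn'⟩ := Int.gcd_dvd_left n m
  obtain ⟨m', hm'⟩ := Int.gcd_dvd_right n m
  have hb := Int.gcd_eq_gcd_ab n m
  generalize (Int.gcd n m : ℤ) = g at *
  generalize Int.gcdA n m = a at *
  generalize Int.gcdB n m = b at *
  have hab : n' * a + m' * b = 1 := by
    apply mul_left_cancel₀ hg
    rw [hn', hm'] at hb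
    linear_combination -hb
  have hno : Odd n' := by rw [hn'] at hn; exact (Int.odd_mul.1 hn).2
  have ht : IsOfFinAddOrder (n' • Q - m' • P) := by
    refine isOfFinAddOrder_of_zsmul hg ?_
    rw [smul_sub, ← mul_smul, ← mul_smul, ← hn', ← hm']
    exact h
  obtain ⟨t, et⟩ : ∃ t, t = n' • Q - m' • P := ⟨_, rfl⟩
  rw [← et] at ht
  have h2t : (2 : ℤ) • t = 0 := by exact_mod_cast htors t ht
  obtain ⟨c, hc⟩ := hno
  -- By Bézout n'(aP + bQ) is P + bt. Subtracting bt inside the bracket corrects this exactly,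
  -- because n' is odd and 2t = 0.
  obtain ⟨ε, hε, hR⟩ := hdiv (a • P + b • Q - b • t) n' ⟨c, hc⟩ (by
    have e : n' • (a • P + b • Q - b • t) = (n' * a + m' * b) • P + b • t - (n' * b) • t := by
      rw [et]; module
    rw [e, hab, hc]
    have : b • t - ((2 * c + 1) * b) • t = (-(c * b)) • (2 : ℤ) • t := by module
    rw [add_sub_assoc, this, h2t, smul_zero, add_zero, one_smul])
  -- Comparing n'(point) = P with point = εP up to torsion forces n'ε = 1, hence n' = ±1.
  have key : IsOfFinAddOrder ((1 - n' * ε) • P) := by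
    have h1 : IsOfFinAddOrder (n' • (a • P + b • Q - b • t - ε • P)) := hR.zsmul
    have e : n' • (a • P + b • Q - b • t - ε • P) =
        (1 - n' * ε) • P + (-(c * b)) • (2 : ℤ) • t := by
      have : n' • (a • P + b • Q - b • t - ε • P) =
        (n' * a + m' * b - n' * ε) • P + b • t - (n' * b) • t := by rw [et]; module
      rw [this, hab, hc]; module
    rwa [e, h2t, smul_zero, add_zero] at h1
  have hu : 1 - n' * ε = 0 := by
    by_contra h0
    exact hP (isOfFinAddOrder_of_zsmul h0 key)
  have hn1 : n' = 1 ∨ n' = -1 := by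
    rcases hε with rfl | rfl
    · left; linarith
    · right; linarith
  rcases hn1 with rfl | rfl
  · exact ⟨m', by rw [et, one_smul] at ht; exact ht⟩
  · refine ⟨-m', ?_⟩
    have := ht.neg
    rw [et] at this
    have e : -((-1 : ℤ) • Q - m' • P) = Q - (-m') • P := by module
    rwa [e] at this

end Generator

theorem Rat.exists_int_of_valGE {x : ℚ} (h : ∀ p : ℕ, p.Prime → ValGE p 0 x) : ∃ k : ℤ, x = k := by
  refine ⟨x.num, ?_⟩
  suffices hd : x.den = 1 by
    have := Rat.num_div_den x
    rw [hd] at this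
    simpa using this.symm
  by_contra hd
  obtain ⟨p, hp, hpd⟩ := Nat.exists_prime_and_dvd hd
  have : Fact p.Prime := ⟨hp⟩
  have h1 : ¬ p ∣ x.num.natAbs := fun hn' => by
    have := Nat.dvd_gcd hn' hpd
    rw [x.reduced] at this
    exact hp.one_lt.ne' (Nat.dvd_one.1 this)
  have h3 := one_le_padicValNat_of_dvd (p := p) x.den_nz hpd
  rcases h p hp with h0 | h0
  · rw [h0] at hd; exact hd rfl
  · rw [padicValRat.eq_1, padicValInt.eq_1, padicValNat.eq_zero_of_not_dvd h1] at h0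
    omega

section AuxCurve

theorem auxCurve_valGE_y {p : ℕ} [Fact p.Prime] {x y : ℚ} (hp : auxCurve.toAffine.Nonsingular x y)
    (hx : ValGE p 0 x) : ValGE p 0 y := by
  by_cases hy : y = 0
  · exact Or.inl hy
  obtain ⟨m, hm⟩ := exists_hasVal p hy
  have hE := auxCurve_equation hp
  have hi : ∀ k : ℤ, ValGE p 0 (x + k) := fun k => hx.add (valGE_intCast k)
  have h := ((hi (-1)).mul (hi (-3))).mul (hi 3)
  have hv := hm.pow 2
  rw [hE] at hv
  refine hm.valGE ?_
  by_contra hneg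
  refine hv.not_valGE (n := 0) (by push_cast; omega) ?_
  convert h using 1
  push_cast; ring

/-- In the numerator of the new abscissa the cube x₁³ cancels against y₁². The remaining terms have
valuation at least 2n, which is that of the denominator (x₁ - x₂)². -/
theorem auxCurve_add_integral {p : ℕ} [Fact p.Prime] {n : ℤ} (hn : n < 0) {x₁ y₁ x₂ y₂ : ℚ}
    (h₁ : auxCurve.toAffine.Nonsingular x₁ y₁) (h₂ : auxCurve.toAffine.Nonsingular x₂ y₂)
    (hx₁ : HasVal p n x₁) (hx₂ : ValGE p 0 x₂) :
    ∃ x y h, Point.some x₁ y₁ h₁ + Point.some x₂ y₂ h₂ = Point.some x y h ∧ ValGE p 0 x := by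
  have hne : x₁ ≠ x₂ := by
    rintro rfl
    exact hx₁.not_valGE hn hx₂
  have hE₁ := auxCurve_equation h₁
  have hE₂ := auxCurve_equation h₂
  obtain ⟨h, H⟩ := auxCurve_isSplit.add_some_eq h₁ h₂ hne (l := (y₁ - y₂) / (x₁ - x₂))
    (by field_simp [sub_ne_zero.2 hne]) rfl rfl
  refine ⟨_, _, h, H, ?_⟩
  have hy₂ := auxCurve_valGE_y h₂ hx₂
  have c : ∀ k : ℤ, ValGE p 0 (k : ℚ) := valGE_intCast
  have vE : HasVal p (3 * n) (y₁ ^ 2) := by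
    have v1 : HasVal p n (x₁ - 1) := by simpa using hx₁.sub_valGE (c 1) hn
    have v2 : HasVal p n (x₁ - 3) := by simpa using hx₁.sub_valGE (c 3) hn
    have v3 : HasVal p n (x₁ + 3) := by simpa using hx₁.add_valGE (c 3) hn
    rw [hE₁]
    exact ((v1.mul v2).mul v3).congr (by ring)
  have vy : ValGE p (2 * n) (y₁ * y₂ * (2 : ℤ)) := by
    by_cases hy : y₁ = 0
    · exact Or.inl (by rw [hy]; ring)
    obtain ⟨k, hk⟩ := exists_hasVal p hy
    have := (hk.pow 2).unique vE
    push_cast at this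
    exact (((hk.valGE le_rfl).mul hy₂).mul (c 2)).mono (by omega)
  have vx : ValGE p n x₁ := hx₁.valGE le_rfl
  have v4 : ValGE p (2 * n) (x₁ ^ 2 * x₂) := ((hx₁.pow 2).valGE le_rfl).mul hx₂ |>.congr (by push_cast; ring)
  have v5 : ValGE p (2 * n) (x₁ * (x₂ ^ 2 + -2 * x₂ + -9)) := by
    have e : x₂ ^ 2 + -2 * x₂ + -9 = x₂ * x₂ + ((-2 : ℤ) : ℚ) * x₂ + ((-9 : ℤ) : ℚ) := by
      push_cast; ring
    rw [e]
    refine (vx.mul ((((hx₂.mul hx₂).congr (add_zero 0)).add (((c (-2)).mul hx₂).congr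
      (add_zero 0))).add (c (-9)))).mono (by omega)
  have v6 : ValGE p (2 * n) (-9 * x₂ + 18) := by
    have := (((c (-9)).mul hx₂).congr (add_zero 0)).add (c 18)
    push_cast at this
    exact this.mono (by omega)
  have num : ValGE p (2 * n) (x₁ ^ 2 * x₂ + x₁ * (x₂ ^ 2 + -2 * x₂ + -9) + (-9 * x₂ + 18) -
      y₁ * y₂ * (2 : ℤ)) := ((v4.add v5).add v6).sub vy
  have den : HasVal p (2 * n) ((x₁ - x₂) ^ 2) := ((hx₁.sub_valGE hx₂ hn).pow 2).congr (by norm_num)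
  have e : ((y₁ - y₂) / (x₁ - x₂)) ^ 2 + 1 + 3 + -3 - x₁ - x₂ =
      (x₁ ^ 2 * x₂ + x₁ * (x₂ ^ 2 + -2 * x₂ + -9) + (-9 * x₂ + 18) - y₁ * y₂ * (2 : ℤ)) *
        ((x₁ - x₂) ^ 2)⁻¹ := by
    have := sub_ne_zero.2 hne
    push_cast
    field_simp
    linear_combination hE₁ + hE₂
  rw [e]
  exact (num.mul (den.inv.valGE le_rfl)).congr (by ring)

/-- If (k + 1)R were p-integral, then kR = (k + 1)R - R would be integral as well by
`auxCurve_add_integral`, against the induction hypothesis. -/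
theorem auxCurve_nsmul_not_integral {p : ℕ} [Fact p.Prime] {n : ℤ} (hn : n < 0)
    {R : auxCurve.toAffine.Point} (hR : PointVal p 0 n R) (k : ℕ) :
    k • R = 0 ∨ ∃ m < 0, PointVal p 0 m (k • R) := by
  induction k with
  | zero => exact Or.inl (zero_nsmul R)
  | succ k ih =>
    obtain ⟨x₁, y₁, h₁, rfl, hx₁⟩ := hR
    rw [sub_zero] at hx₁
    rcases hZ : (k + 1) • Point.some x₁ y₁ h₁ with _ | ⟨x, y, h⟩
    · exact Or.inl rfl
    right
    by_contra hcon
    have hx : ValGE p 0 x := by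
      by_cases hx0 : x = 0
      · exact Or.inl hx0
      obtain ⟨m, hm⟩ := exists_hasVal p hx0
      refine hm.valGE ?_
      by_contra hm0
      exact hcon ⟨m, by omega, x, y, h, rfl, by rwa [sub_zero]⟩
    obtain ⟨hneg, en⟩ := auxCurve_isSplit.neg_some h₁
    obtain ⟨x', y', h', e, hx'⟩ := auxCurve_add_integral hn hneg h hx₁ hx
    have ek : k • Point.some x₁ y₁ h₁ = Point.some x' y' h' := by
      rw [← e, ← en, ← hZ, succ_nsmul]; abel
    rw [ek] at ih
    rcases ih with ih | ⟨m, hm, x'', y'', h'', e'', hv⟩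
    · exact Point.some_ne_zero _ ih
    · simp only [Point.some.injEq] at e''
      rw [sub_zero, ← e''.1] at hv
      exact hv.not_valGE hm hx'

end AuxCurve

section AuxCurve

theorem auxCurve_nonsingular_neg_one : auxCurve.toAffine.Nonsingular (-1) (-4) := by
  rw [auxCurve_isSplit.nonsingular_iff]; norm_num

theorem auxP_add_root :
    auxP + Point.some 3 0 auxCurve_isSplit.swap₁₂.nonsingular_root =
      Point.some (-1) (-4) auxCurve_nonsingular_neg_one := by
  obtain ⟨h, H⟩ := auxCurve_isSplit.add_some_eq auxCurve_nonsingular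
    auxCurve_isSplit.swap₁₂.nonsingular_root (l := -1) (x₃ := -1) (y₃ := -4) (by norm_num)
    (by norm_num) (by norm_num) (by norm_num)
  exact H

theorem auxCurve_isOfFinAddOrder_root :
    IsOfFinAddOrder (Point.some 3 0 auxCurve_isSplit.swap₁₂.nonsingular_root) :=
  IsSplit.isOfFinAddOrder_of_two_smul auxCurve_isSplit.swap₁₂.two_smul_root

theorem neg_auxP : ∃ h, -auxP = Point.some 0 (-3) h := auxCurve_isSplit.neg_some auxCurve_nonsingular

/-- A point of which `auxP` is an odd multiple equals `± auxP` up to torsion. -/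
theorem auxCurve_eq_of_odd_zsmul {R : auxCurve.toAffine.Point} {n : ℤ} (hn : Odd n)
    (h : n • R = auxP) : ∃ ε : ℤ, (ε = 1 ∨ ε = -1) ∧ IsOfFinAddOrder (R - ε • auxP) := by
  have hR0 : ¬ IsOfFinAddOrder R := fun hR => auxP_not_isOfFinAddOrder (h ▸ hR.zsmul)
  rcases hRdef : R with _ | ⟨x, y, hp⟩
  · exact absurd (hRdef ▸ IsOfFinAddOrder.zero) hR0
  -- A non-integral R would have only non-integral or zero multiples, whereas ±auxP has x = 0.
  have hint : ∀ p : ℕ, p.Prime → ValGE p 0 x := by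
    intro p hpp
    have : Fact p.Prime := ⟨hpp⟩
    by_cases hx0 : x = 0
    · exact Or.inl hx0
    obtain ⟨m, hm⟩ := exists_hasVal p hx0
    refine hm.valGE ?_
    by_contra hm0
    have hv : PointVal p 0 m R := ⟨x, y, hp, hRdef, by rwa [sub_zero]⟩
    obtain ⟨hneg, eneg⟩ := neg_auxP
    rcases auxCurve_nsmul_not_integral (by omega) hv n.natAbs with hk | ⟨j, hj, hk⟩
    · apply hR0
      refine isOfFinAddOrder_iff_nsmul_eq_zero.2 ⟨n.natAbs, Int.natAbs_pos.2 ?_, hk⟩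
      rintro rfl; simp at hn
    · obtain ⟨x', y', h', e, hv'⟩ := hk
      have e0 : n.natAbs • R = auxP ∨ n.natAbs • R = -auxP := by
        rcases Int.natAbs_eq n with hn' | hn'
        · left; rw [← h, ← natCast_zsmul, ← hn']
        · right; rw [← h, ← natCast_zsmul, ← neg_zsmul]; congr 1; omega
      have hx' : x' = 0 := by
        rcases e0 with e0 | e0
        · rw [e, auxP] at e0
          simp only [Point.some.injEq] at e0
          exact e0.1
        · rw [e, eneg] at e0
          simp only [Point.some.injEq] at e0
          exact e0.1
      exact hv'.1 (by rw [hx', sub_zero])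
  obtain ⟨k, rfl⟩ := Rat.exists_int_of_valGE hint
  have hE := auxCurve_equation hp
  -- The sign of x - 3 distinguishes the two real components. It is non-trivial on auxP, hence on R,
  -- which therefore has -3 ≤ x ≤ 1.
  let χ := auxCurve_isSplit.swap₁₂.descentHom signBit signBit_mul
  have hχP : χ auxP = 1 := by
    change signBit (descentMap 3 1 (-3) (Point.some 0 3 auxCurve_nonsingular)) = 1
    rw [IsSplit.descentMap_of_ne _ (by norm_num)]
    norm_num [signBit]
  have hχR : χ R ≠ 0 := by
    intro h0
    rw [← h, map_zsmul, h0, smul_zero] at hχP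
    exact absurd hχP (by decide)
  have hk3 : (k : ℚ) < 3 := by
    by_contra hk
    apply hχR
    change signBit (descentMap 3 1 (-3) R) = 0
    rw [hRdef, signBit_eq_zero_iff]
    by_cases hk3 : (k : ℚ) = 3
    · rw [IsSplit.descentMap_of_eq _ hk3]; norm_num
    · rw [IsSplit.descentMap_of_ne _ hk3]; linarith
  have hk1 : (k : ℚ) ≤ 1 := by
    by_contra hk
    nlinarith [sq_nonneg y, mul_pos (mul_pos (show (0 : ℚ) < k - 1 by linarith) (show (0 : ℚ) < 3 - k by linarith)) (show (0 : ℚ) < k + 3 by linarith)]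
  have hk2 : (-3 : ℚ) ≤ k := by
    by_contra hk
    nlinarith [sq_nonneg y, mul_pos (mul_pos (show (0 : ℚ) < 1 - k by linarith) (show (0 : ℚ) < 3 - k by linarith)) (show (0 : ℚ) < -3 - k by linarith)]
  have hk1' : k ≤ 1 := by exact_mod_cast hk1
  have hk2' : -3 ≤ k := by exact_mod_cast hk2
  have hy0 : y ≠ 0 := by
    intro hy
    apply hR0
    rw [hRdef]
    exact IsSplit.isOfFinAddOrder_of_two_smul ((auxCurve_isSplit.two_smul_eq_zero_iff hp).2 hy)
  have hfin := auxCurve_isOfFinAddOrder_root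
  obtain ⟨hneg, eneg⟩ := neg_auxP
  -- The abscissae -3 and 1 are of order two, -2 would give y² = 15, -1 gives ±(auxP + (3, 0)), and
  -- 0 gives ±auxP.
  interval_cases k
  · norm_num at hE; exact absurd hE hy0
  · norm_num at hE
    exact absurd ⟨y, by rw [← hE]; ring⟩ (show ¬ IsSquare (15 : ℚ) by norm_num)
  · have : (y - 4) * (y + 4) = 0 := by
      push_cast at hE
      linear_combination hE
    rcases mul_eq_zero.1 this with hy | hy
    · refine ⟨-1, Or.inr rfl, ?_⟩
      have : Point.some _ y hp = -Point.some (-1) (-4) auxCurve_nonsingular_neg_one := by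
        obtain ⟨h', e⟩ := auxCurve_isSplit.neg_some auxCurve_nonsingular_neg_one
        rw [e]
        exact IsSplit.some_congr (by norm_num) (by linarith)
      rw [this, ← auxP_add_root, neg_one_zsmul, neg_add, sub_neg_eq_add, neg_add_cancel_comm]
      exact hfin.neg
    · refine ⟨1, Or.inl rfl, ?_⟩
      have : Point.some _ y hp = Point.some (-1) (-4) auxCurve_nonsingular_neg_one :=
        IsSplit.some_congr (by norm_num) (by linarith)
      rw [this, ← auxP_add_root, one_zsmul, add_sub_cancel_left]
      exact hfin
  · have : (y - 3) * (y + 3) = 0 := by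
      push_cast at hE
      linear_combination hE
    rcases mul_eq_zero.1 this with hy | hy
    · refine ⟨1, Or.inl rfl, ?_⟩
      have : Point.some _ y hp = auxP := IsSplit.some_congr (by norm_num) (by linarith)
      rw [this, one_zsmul, sub_self]
      exact IsOfFinAddOrder.zero
    · refine ⟨-1, Or.inr rfl, ?_⟩
      have : Point.some _ y hp = -auxP := by
        rw [eneg]
        exact IsSplit.some_congr (by norm_num) (by linarith)
      rw [this, neg_one_zsmul, sub_self]
      exact IsOfFinAddOrder.zero
  · norm_num at hE; exact absurd hE hy0

theorem auxCurve_exists_odd : ∃ n : ℤ, Odd n ∧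
    ∀ Q : auxCurve.toAffine.Point, ∃ m : ℤ, IsOfFinAddOrder (n • Q - m • auxP) := by
  have hW := auxCurve_isSplit
  have d1P : descentMap 1 3 (-3) auxP = -1 := by
    rw [auxP, IsSplit.descentMap_of_ne _ (by norm_num)]; norm_num
  have d3P : descentMap (-3) 1 3 auxP = 3 := by
    rw [auxP, IsSplit.descentMap_of_ne _ (by norm_num)]; norm_num
  have d1T : descentMap 1 3 (-3) (Point.some 1 0 hW.nonsingular_root) = -8 := by
    rw [IsSplit.descentMap_of_eq _ rfl]; norm_num
  have d3T : descentMap (-3) 1 3 (Point.some 1 0 hW.nonsingular_root) = 4 := by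
    rw [IsSplit.descentMap_of_ne _ (by norm_num)]; norm_num
  have d1S : descentMap 1 3 (-3) (Point.some 3 0 hW.swap₁₂.nonsingular_root) = 2 := by
    rw [IsSplit.descentMap_of_ne _ (by norm_num)]; norm_num
  have d3S : descentMap (-3) 1 3 (Point.some 3 0 hW.swap₁₂.nonsingular_root) = 6 := by
    rw [IsSplit.descentMap_of_ne _ (by norm_num)]; norm_num
  have fT := IsSplit.isOfFinAddOrder_of_two_smul hW.two_smul_root
  have fS := IsSplit.isOfFinAddOrder_of_two_smul hW.swap₁₂.two_smul_root
  generalize Point.some 1 0 hW.nonsingular_root = T at fT d1T d3T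
  generalize Point.some 3 0 hW.swap₁₂.nonsingular_root = S at fS d1S d3S
  let χ₀ := hW.descentHom signBit signBit_mul
  let χ₁ := hW.descentHom (valBit 2) (valBit_mul 2)
  let χ₂ := hW.rotate.descentHom (valBit 2) (valBit_mul 2)
  have p0 : χ₀ auxP = 1 := by
    change signBit (descentMap _ _ _ _) = _
    rw [d1P]; norm_num [signBit]
  have p1 : χ₁ auxP = 0 := by
    change valBit 2 (descentMap _ _ _ _) = _
    rw [d1P, (hasVal_of_eq (p := 2) 0 (-1) 1 (by norm_num) (by norm_num) (by norm_num)).valBit]; rfl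
  have p2 : χ₂ auxP = 0 := by
    change valBit 2 (descentMap _ _ _ _) = _
    rw [d3P, (hasVal_of_eq (p := 2) 0 3 1 (by norm_num) (by norm_num) (by norm_num)).valBit]; rfl
  have t0 : χ₀ T = 1 := by
    change signBit (descentMap _ _ _ _) = _
    rw [d1T]; norm_num [signBit]
  have t1 : χ₁ T = 1 := by
    change valBit 2 (descentMap _ _ _ _) = _
    rw [d1T, (hasVal_of_eq (p := 2) 3 (-1) 1 (by norm_num) (by norm_num) (by norm_num)).valBit]; rfl
  have t2 : χ₂ T = 0 := by
    change valBit 2 (descentMap _ _ _ _) = _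
    rw [d3T, (hasVal_of_eq (p := 2) 2 1 1 (by norm_num) (by norm_num) (by norm_num)).valBit]; rfl
  have s0 : χ₀ S = 0 := by
    change signBit (descentMap _ _ _ _) = _
    rw [d1S]; norm_num [signBit]
  have s1 : χ₁ S = 1 := by
    change valBit 2 (descentMap _ _ _ _) = _
    rw [d1S, (hasVal_of_eq (p := 2) 1 1 1 (by norm_num) (by norm_num) (by norm_num)).valBit]; rfl
  have s2 : χ₂ S = 1 := by
    change valBit 2 (descentMap _ _ _ _) = _
    rw [d3S, (hasVal_of_eq (p := 2) 1 3 1 (by norm_num) (by norm_num) (by norm_num)).valBit]; rfl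
  -- The characters take the values (1, 0, 0) at auxP, (1, 1, 0) at T and (0, 1, 1) at S, whence the
  -- triangular dual basis.
  refine hW.exists_odd_smul_mem_of_descent auxP ![χ₀, χ₁, χ₂] ![auxP, T + auxP, S + (T + auxP)]
    ?_ ?_ ?_
  · intro i j
    fin_cases i <;> fin_cases j <;> simp [p0, p1, p2, t0, t1, t2, s0, s1, s2] <;> decide
  · intro j
    fin_cases j
    · exact ⟨1, by simp⟩
    · exact ⟨1, by simpa using fT⟩
    · exact ⟨1, by
        simp only [one_zsmul, Fin.reduceFinMk, Matrix.cons_val]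
        rw [← add_assoc, add_sub_cancel_right]
        exact fS.add fT⟩
  · intro x y hp hy hχ
    have hE := auxCurve_equation hp
    have hx1 : x ≠ 1 := by rintro rfl; norm_num at hE; exact hy hE
    have hx3 : x ≠ -3 := by rintro rfl; norm_num at hE; exact hy hE
    have k0 : signBit (descentMap 1 3 (-3) (Point.some x y hp)) = 0 := hχ 0
    have k1 : valBit 2 (descentMap 1 3 (-3) (Point.some x y hp)) = 0 := hχ 1
    have k2 : valBit 2 (descentMap (-3) 1 3 (Point.some x y hp)) = 0 := hχ 2
    rw [IsSplit.descentMap_of_ne hp hx1] at k0 k1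
    rw [IsSplit.descentMap_of_ne hp hx3, sub_neg_eq_add] at k2
    rw [signBit_eq_zero_iff] at k0
    rw [valBit_eq_zero_iff] at k1 k2
    obtain ⟨q1, q2, q3⟩ := auxCurve_isSquare hy hE
      (lt_of_le_of_ne k0 (sub_ne_zero.2 hx1).symm) k1 k2
    exact hW.exists_half_of_isSquare hp q1 q2 (by rwa [sub_neg_eq_add])

theorem auxCurve_generator (Q : auxCurve.toAffine.Point) :
    ∃ n : ℤ, IsOfFinAddOrder (Q - n • auxP) := by
  obtain ⟨n, hn, H⟩ := auxCurve_exists_odd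
  obtain ⟨m, hm⟩ := H Q
  exact exists_sub_zsmul_of_odd (fun t ht => auxCurve_isOfFinAddOrder_iff.1 ht)
    auxP_not_isOfFinAddOrder (fun R n hn h => auxCurve_eq_of_odd_zsmul hn h) hn hm

theorem auxCurve_rank : rationalRank auxCurve = 1 := by
  refine le_antisymm (rank_le_one_of_smul auxP fun Q => ?_)
    (one_le_rank_of_not_isOfFinAddOrder auxP_not_isOfFinAddOrder)
  obtain ⟨n, hn⟩ := auxCurve_generator Q
  exact ⟨1, one_ne_zero, n, by rwa [one_zsmul]⟩

/-! ### Multiples of the generator -/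

theorem two_smul_auxP : ∃ h, 2 • auxP = Point.some (13 / 4) (15 / 8) h :=
  auxCurve_isSplit.two_smul_some_eq auxCurve_nonsingular (l := -3 / 2) (by norm_num) (by norm_num)
    (by norm_num) (by norm_num)

theorem three_smul_auxP : ∃ h : auxCurve.toAffine.Nonsingular (-360 / 169) (-8211 / 2197),
    3 • auxP = Point.some (-360 / 169) (-8211 / 2197) h := by
  obtain ⟨h₂, e₂⟩ := two_smul_auxP
  obtain ⟨h, e⟩ := auxCurve_isSplit.add_some_eq h₂ auxCurve_nonsingular (l := -9 / 26)
    (x₃ := -360 / 169) (y₃ := -8211 / 2197) (by norm_num) (by norm_num) (by norm_num) (by norm_num)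
  exact ⟨h, by rw [← e, ← e₂]; exact succ_nsmul auxP 2⟩

theorem five_smul_auxP : ∃ h, 5 • auxP =
    Point.some (12809160 / 13227769) (24300774579 / 48109395853) h := by
  obtain ⟨h₂, e₂⟩ := two_smul_auxP
  obtain ⟨h₃, e₃⟩ := three_smul_auxP
  obtain ⟨h, e⟩ := auxCurve_isSplit.add_some_eq h₃ h₂ (l := 98643 / 94562)
    (x₃ := 12809160 / 13227769) (y₃ := 24300774579 / 48109395853) (by norm_num) (by norm_num)
    (by norm_num) (by norm_num)
  exact ⟨h, by rw [← e, ← e₂, ← e₃]; exact add_nsmul auxP 3 2⟩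

theorem eight_smul_auxP : ∃ h : auxCurve.toAffine.Nonsingular
    (5379748235630627521 / 1332772073127950400)
    (-7240802274937433597003412481 / 1538628688957669336348992000), 8 • auxP =
    Point.some (5379748235630627521 / 1332772073127950400)
      (-7240802274937433597003412481 / 1538628688957669336348992000) h := by
  obtain ⟨h₃, e₃⟩ := three_smul_auxP
  obtain ⟨h₅, e₅⟩ := five_smul_auxP
  obtain ⟨h, e⟩ := auxCurve_isSplit.add_some_eq h₅ h₃ (l := 74735841849841 / 54583904111880)
    (x₃ := 5379748235630627521 / 1332772073127950400)
    (y₃ := -7240802274937433597003412481 / 1538628688957669336348992000) (by norm_num)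
    (by norm_num) (by norm_num) (by norm_num)
  exact ⟨h, by rw [← e, ← e₅, ← e₃]; exact add_nsmul auxP 5 3⟩

theorem wCoord_three : wCoord (3 • auxP) = 26 / 89 := by
  obtain ⟨h, e⟩ := three_smul_auxP
  rw [e]; norm_num [wCoord]

theorem wCoord_five : wCoord (5 • auxP) = -1389334 / 1233407 := by
  obtain ⟨h, e⟩ := five_smul_auxP
  rw [e]; norm_num [wCoord]

theorem wCoord_eight : wCoord (8 • auxP) = -29961886650170640 / 25895756518234849 := by
  obtain ⟨h, e⟩ := eight_smul_auxP
  rw [e]; norm_num [wCoord]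

end AuxCurve

/-! ### The bijection with the quartic. -/

section AuxCurve

theorem auxCurve_eq_neg_one_of_eq_four {x : ℚ} (hp : auxCurve.toAffine.Nonsingular x 4) :
    x = -1 := by
  have hE := auxCurve_equation hp
  have : (x + 1) * (x ^ 2 - 2 * x - 7) = 0 := by linear_combination -hE
  rcases mul_eq_zero.1 this with h | h
  · linarith
  · exact absurd ⟨x - 1, by linear_combination -h⟩ (show ¬ IsSquare (8 : ℚ) by norm_num)

theorem wCoord_mul {x y : ℚ} (hp : auxCurve.toAffine.Nonsingular x y) :
    wCoord (Point.some x y hp) * (y - 4) = 2 * (x + 1) := by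
  by_cases hy : y = 4
  · subst hy
    obtain rfl := auxCurve_eq_neg_one_of_eq_four hp
    norm_num
  · simp only [wCoord, if_neg hy]
    field_simp [sub_ne_zero.2 hy]

theorem sCoord_some {x y : ℚ} (hp : auxCurve.toAffine.Nonsingular x y) :
    sCoord (Point.some x y hp) = wCoord (Point.some x y hp) ^ 2 * (x - 1) / 2 - 1 := rfl

theorem sCoord_sq (Q : auxCurve.toAffine.Point) : sCoord Q ^ 2 = quartic (wCoord Q) := by
  rcases Q with _ | ⟨x, y, hp⟩
  · norm_num [sCoord, wCoord, quartic]
  · have hw := wCoord_mul hp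
    rw [sCoord_some, quartic]
    by_cases hy : y = 4
    · subst hy
      obtain rfl := auxCurve_eq_neg_one_of_eq_four hp
      simp only [wCoord]
      norm_num
    · have hE := auxCurve_equation hp
      generalize wCoord (Point.some x y hp) = w at *
      have hd := sub_ne_zero.2 hy
      obtain rfl : w = 2 * (x + 1) / (y - 4) := by field_simp; exact hw
      field_simp
      linear_combination -4 * (x + 1) ^ 3 * hE

theorem wCoord_eq_zero {Q : auxCurve.toAffine.Point} (h : wCoord Q = 0) :
    Q = 0 ∨ (sCoord Q = -1 ∧ Q = Point.some (-1) (-4) auxCurve_nonsingular_neg_one) := by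
  rcases Q with _ | ⟨x, y, hp⟩
  · exact Or.inl rfl
  right
  have hw := wCoord_mul hp
  refine ⟨by rw [sCoord_some, h]; norm_num, ?_⟩
  rw [h, zero_mul] at hw
  obtain rfl : x = -1 := by linarith
  have hE := auxCurve_equation hp
  have hy : y ≠ 4 := by
    rintro rfl
    simp [wCoord] at h
  have : (y - 4) * (y + 4) = 0 := by linear_combination hE
  exact IsSplit.some_congr rfl (by linarith [(mul_eq_zero.1 this).resolve_left (sub_ne_zero.2 hy)])

theorem coord_injective {Q Q' : auxCurve.toAffine.Point} (hw : wCoord Q = wCoord Q')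
    (hs : sCoord Q = sCoord Q') : Q = Q' := by
  by_cases h0 : wCoord Q = 0
  · have h0' := hw ▸ h0
    rcases wCoord_eq_zero h0 with h | ⟨h, e⟩ <;> rcases wCoord_eq_zero h0' with h' | ⟨h', e'⟩
    · rw [h, h']
    · have : sCoord (0 : auxCurve.toAffine.Point) = 1 := rfl
      rw [h, this, h'] at hs; norm_num at hs
    · have : sCoord (0 : auxCurve.toAffine.Point) = 1 := rfl
      rw [h', this, h] at hs; norm_num at hs
    · rw [e, e']
  · rcases Q with _ | ⟨x, y, hp⟩
    · exact absurd rfl h0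
    rcases Q' with _ | ⟨x', y', hp'⟩
    · exact absurd hw h0
    have k := wCoord_mul hp
    have k' := wCoord_mul hp'
    rw [sCoord_some, sCoord_some, ← hw] at hs
    rw [← hw] at k'
    generalize wCoord (Point.some x y hp) = w at *
    have hx : x = x' := by
      apply mul_left_cancel₀ (pow_ne_zero 2 h0)
      linear_combination 2 * hs
    refine IsSplit.some_congr hx (mul_left_cancel₀ h0 ?_)
    linear_combination k - k' + 2 * hx

theorem exists_coord {w s : ℚ} (h : s ^ 2 = quartic w) : ∃ Q, wCoord Q = w ∧ sCoord Q = s := by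
  by_cases h0 : w = 0
  · subst h0
    have : (s - 1) * (s + 1) = 0 := by
      rw [quartic] at h; linear_combination h
    rcases mul_eq_zero.1 this with hs | hs
    · exact ⟨0, rfl, (sub_eq_zero.1 hs).symm⟩
    · refine ⟨Point.some (-1) (-4) auxCurve_nonsingular_neg_one, ?_, ?_⟩
      · norm_num [wCoord]
      · norm_num [sCoord, wCoord]; linarith
  · rw [quartic] at h
    -- The formulas for s and w are solved for X and then for Y.
    have hp : auxCurve.toAffine.Nonsingular (2 * (s + 1) / w ^ 2 + 1)
        (4 + 2 * (2 * (s + 1) / w ^ 2 + 1 + 1) / w) := by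
      rw [auxCurve_isSplit.nonsingular_iff]
      field_simp
      linear_combination -8 * (s + 1 + w ^ 2) * h
    have hk := wCoord_mul hp
    have hw : wCoord (Point.some _ _ hp) = w := by
      by_cases hy : 4 + 2 * (2 * (s + 1) / w ^ 2 + 1 + 1) / w = 4
      · have e : s + 1 = -w ^ 2 := by
          have : 2 * (2 * (s + 1) / w ^ 2 + 1 + 1) / w = 0 := by linarith
          field_simp at this
          linear_combination (1 / 4) * this
        simp only [wCoord, if_pos hy]
        obtain rfl : s = -w ^ 2 - 1 := by linarith
        have : w ^ 3 * (w + 4) = 0 := by linear_combination -h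
        have := (mul_eq_zero.1 this).resolve_left (pow_ne_zero 3 h0)
        linarith
      · apply mul_right_cancel₀ (sub_ne_zero.2 hy)
        rw [hk]; field_simp; ring
    refine ⟨Point.some _ _ hp, hw, ?_⟩
    rw [sCoord_some, hw]
    field_simp
    ring

theorem coord_bijOn : Set.BijOn (fun Q : auxCurve.toAffine.Point => (wCoord Q, sCoord Q)) Set.univ
    {p : ℚ × ℚ | p.2 ^ 2 = quartic p.1} := by
  refine ⟨fun Q _ => sCoord_sq Q, fun Q _ Q' _ h => ?_, fun p hp => ?_⟩
  · exact coord_injective (congrArg Prod.fst h) (congrArg Prod.snd h)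
  · obtain ⟨Q, h₁, h₂⟩ := exists_coord hp
    exact ⟨Q, trivial, Prod.ext h₁ h₂⟩

end AuxCurve

/-! ### Multiples of a point approach the origin in the real topology. -/

section Recurrence

theorem auxCurve_neg_three_le {x y : ℚ} (hp : auxCurve.toAffine.Nonsingular x y) : -3 ≤ x := by
  have hE := auxCurve_equation hp
  by_contra hx
  nlinarith [sq_nonneg y, mul_pos (mul_pos (show (0 : ℚ) < 1 - x by linarith)
    (show (0 : ℚ) < 3 - x by linarith)) (show (0 : ℚ) < -3 - x by linarith)]

theorem exists_close_of_bounded {x y : ℕ → ℚ} {C : ℚ} (hx : ∀ n, |x n| ≤ C) (hy : ∀ n, |y n| ≤ C)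
    {δ : ℚ} (hδ : 0 < δ) : ∃ i j, i < j ∧ |x i - x j| < δ ∧ |y i - y j| < δ := by
  have hb : Bornology.IsBounded (Metric.closedBall (0 : ℝ × ℝ) C) := Metric.isBounded_closedBall
  obtain ⟨a, -, φ, hφ, ha⟩ := tendsto_subseq_of_bounded hb
    (x := fun n => ((x n : ℝ), (y n : ℝ))) fun n => by
      rw [Metric.mem_closedBall, Prod.dist_eq]
      simp only [Prod.fst_zero, Prod.snd_zero, Real.dist_0_eq_abs]
      exact max_le (by exact_mod_cast hx n) (by exact_mod_cast hy n)
  obtain ⟨N, hN⟩ := Metric.cauchySeq_iff.1 ha.cauchySeq δ (by exact_mod_cast hδ)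
  refine ⟨φ N, φ (N + 1), hφ (Nat.lt_succ_self N), ?_⟩
  have := hN N le_rfl (N + 1) (Nat.le_succ N)
  rw [Function.comp_apply, Function.comp_apply, Prod.dist_eq, max_lt_iff, Real.dist_eq,
    Real.dist_eq] at this
  dsimp only at this
  exact ⟨by exact_mod_cast this.1, by exact_mod_cast this.2⟩

/-- The multiples of a point of infinite order come arbitrarily close to the origin. -/
theorem auxCurve_exists_large {S : auxCurve.toAffine.Point} (hS : ¬ IsOfFinAddOrder S) (B : ℚ) :
    ∃ m : ℕ, 0 < m ∧ ∃ x y h, m • S = Point.some x y h ∧ B < x := by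
  wlog hB : 4 ≤ B generalizing B
  · obtain ⟨m, hm, x, y, h, e, hx⟩ := this 4 le_rfl
    exact ⟨m, hm, x, y, h, e, by linarith⟩
  by_contra hcon
  push Not at hcon
  have hne : ∀ m : ℕ, 0 < m → m • S ≠ 0 := fun m hm h =>
    hS (isOfFinAddOrder_iff_nsmul_eq_zero.2 ⟨m, hm, h⟩)
  have hex : ∀ m : ℕ, ∃ x y : ℚ, ∃ h, (m + 1) • S = Point.some x y h := by
    intro m
    rcases hm : (m + 1) • S with _ | ⟨x, y, h⟩
    · exact absurd hm (hne _ m.succ_pos)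
    · exact ⟨x, y, h, rfl⟩
  choose x y h e using hex
  have hx : ∀ m, x m ≤ B := fun m => hcon _ m.succ_pos _ _ _ (e m)
  have hx' : ∀ m, -3 ≤ x m := fun m => auxCurve_neg_three_le (h m)
  have hE : ∀ m, y m ^ 2 = (x m - 1) * (x m - 3) * (x m + 3) := fun m => auxCurve_equation (h m)
  have hy0 : ∀ m, y m ≠ 0 := by
    intro m h0
    have := (auxCurve_isSplit.two_smul_eq_zero_iff (h m)).2 h0
    rw [← e, ← mul_nsmul] at this
    exact hne _ (by positivity) this
  -- From (x(2Q) - 1) · 4y² = ((x - 1)² + 8)² ≥ 64 and x(2Q) ≤ B.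
  have hyl : ∀ m, 16 ≤ B * y m ^ 2 := by
    intro m
    obtain ⟨x', y', h', H, H1, -⟩ := auxCurve_isSplit.two_smul_spec (h m) (hy0 m)
    rw [← e, ← mul_nsmul] at H
    have hB' := hcon _ (by positivity) _ _ _ H
    have hy2 : 0 < y m ^ 2 := by have := hy0 m; positivity
    nlinarith [sq_nonneg (x m - 1), mul_le_mul_of_nonneg_right hB' hy2.le,
      sq_nonneg ((x m - 1) ^ 2)]
  have hyu : ∀ m, y m ^ 2 ≤ (4 * B ^ 2) ^ 2 := by
    intro m
    rw [hE]
    have h1 : |x m - 1| ≤ 2 * B := abs_le.2 ⟨by linarith [hx' m], by linarith [hx m]⟩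
    have h2 : |x m - 3| ≤ 2 * B := abs_le.2 ⟨by linarith [hx' m], by linarith [hx m]⟩
    have h3 : |x m + 3| ≤ 2 * B := abs_le.2 ⟨by linarith [hx' m], by linarith [hx m]⟩
    calc (x m - 1) * (x m - 3) * (x m + 3) ≤ |(x m - 1) * (x m - 3) * (x m + 3)| := le_abs_self _
      _ = |x m - 1| * |x m - 3| * |x m + 3| := by rw [abs_mul, abs_mul]
      _ ≤ (2 * B) * (2 * B) * (2 * B) := by gcongr
      _ ≤ (4 * B ^ 2) ^ 2 := by nlinarith [pow_pos (show 0 < B by linarith) 3]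
  have hyu' : ∀ m, |y m| ≤ 4 * B ^ 2 := fun m => abs_le_of_sq_le_sq (hyu m) (by positivity)
  have hBpos : 0 < B := by linarith
  -- Two nearby multiples have a nearby difference to the origin: a bounded abscissa there bounds
  -- the slope, so y i + y j is small together with y i - y j, contrary to the lower bound `hyl`.
  obtain ⟨i, j, hij, h1, h2⟩ := exists_close_of_bounded (x := x) (y := y) (C := 4 * B ^ 2)
    (fun m => abs_le.2 ⟨by nlinarith [hx' m], by nlinarith [hx m]⟩) hyu'
    (δ := 1 / B) (by positivity)
  have hsub : (j - i) • S = Point.some _ _ (h j) - Point.some _ _ (h i) := by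
    rw [← e, ← e, eq_sub_iff_add_eq, ← add_nsmul]
    congr 1; omega
  obtain ⟨hn, en⟩ := auxCurve_isSplit.neg_some (h i)
  rw [sub_eq_add_neg, en] at hsub
  have hxne : x j ≠ x i := by
    intro hxx
    have hyy : (y j - y i) * (y j + y i) = 0 := by
      have := hE j
      rw [hxx] at this
      linear_combination this - hE i
    rcases mul_eq_zero.1 hyy with hy | hy
    · exact hne (j - i) (by omega) (hsub.trans (auxCurve_isSplit.add_eq_zero _ _ hxx (by linarith)))
    · have : (j + 1) • S + (i + 1) • S = 0 := by
        rw [e, e]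
        exact auxCurve_isSplit.add_eq_zero _ _ hxx (by linarith)
      rw [← add_nsmul] at this
      exact hne _ (by positivity) this
  obtain ⟨l, x₃, y₃, h₃, H, H1, -, H3, -⟩ := auxCurve_isSplit.add_spec (h j) hn fun H => hxne H.1
  rw [H] at hsub
  have hx₃ := hcon _ (by omega) _ _ _ hsub
  have hl : l ^ 2 = x₃ + x j + x i - 1 := by
    linear_combination -(1 / 2) * (H1 1 - 2 * H1 0 + H1 (-1))
  have hl2 : l ^ 2 * (x i - x j) ^ 2 = (y i + y j) ^ 2 := by
    have := H3 hxne
    linear_combination (l * (x j - x i) + y j + y i) * this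
  have h1s : (x i - x j) ^ 2 < (1 / B) ^ 2 := sq_lt_sq' (abs_lt.1 h1).1 (abs_lt.1 h1).2
  have h2s : (y i - y j) ^ 2 < (1 / B) ^ 2 := sq_lt_sq' (abs_lt.1 h2).1 (abs_lt.1 h2).2
  have hl3 : l ^ 2 ≤ 3 * B := by rw [hl]; linarith [hx i, hx j]
  have k1 : (y i + y j) ^ 2 ≤ 3 * B * (1 / B) ^ 2 := by
    rw [← hl2]
    gcongr
  have k2 : B * (3 * B * (1 / B) ^ 2) = 3 := by field_simp
  have k3 : B * (1 / B) ^ 2 ≤ 1 := by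
    rw [div_pow, one_pow, mul_one_div, div_le_one (by positivity)]
    nlinarith
  nlinarith [hyl i, hyl j]

end Recurrence

/-! ### Continuity of w under addition of a small point. -/

section Addition

/-- The `x`-coordinate of the sum of `(a, b)` and `(1 / r, q / r²)` on `auxCurve`. -/
def sumX {K : Type*} [Field K] (a b r q : K) : K :=
  a + ((3 * a ^ 2 - 2 * a - 9) * r + (18 - 9 * a - a ^ 3) * r ^ 2 - 2 * b * q) / (1 - a * r) ^ 2

/-- The `y`-coordinate of the sum of `(a, b)` and `(1 / r, q / r²)` on `auxCurve`. -/
def sumY {K : Type*} [Field K] (a b r q : K) : K :=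
  -b - ((3 * a ^ 2 - 2 * a - 9) * q + (18 - 9 * a - a ^ 3) * q * r -
    2 * b * (1 - r - 9 * r ^ 2 + 9 * r ^ 3) - (3 * a ^ 2 - 2 * a - 9) * b * r ^ 2 -
    (18 - 9 * a - a ^ 3) * b * r ^ 3 + 2 * b ^ 2 * q * r) / (1 - a * r) ^ 3

/-- The chord formula in terms of 1/x and y/x², which vanish at the origin, so that it stays regular
there. -/
theorem auxCurve_add_eq {a b x y : ℚ} (h₁ : auxCurve.toAffine.Nonsingular a b)
    (h₂ : auxCurve.toAffine.Nonsingular x y) (hx : x ≠ 0) (hax : a ≠ x) :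
    ∃ h, Point.some a b h₁ + Point.some x y h₂ =
      Point.some (sumX a b (1 / x) (y / x ^ 2)) (sumY a b (1 / x) (y / x ^ 2)) h := by
  have hE₁ := auxCurve_equation h₁
  have hE₂ := auxCurve_equation h₂
  have hax' := sub_ne_zero.2 hax
  have hax2 : x - a ≠ 0 := sub_ne_zero.2 hax.symm
  have hX : sumX a b (1 / x) (y / x ^ 2) = ((b - y) / (a - x)) ^ 2 + 1 + 3 + -3 - a - x := by
    have : 1 - a * (1 / x) = (x - a) / x := by field_simp
    rw [sumX, this, show a - x = -(x - a) by ring]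
    field_simp
    linear_combination -hE₁ - hE₂
  refine auxCurve_isSplit.add_some_eq h₁ h₂ hax (l := (b - y) / (a - x)) (by field_simp) hX ?_
  have : 1 - a * (1 / x) = (x - a) / x := by field_simp
  rw [sumX, sumY, this, show a - x = -(x - a) by ring]
  field_simp
  linear_combination -2 * b * hE₂

theorem sumX_zero {K : Type*} [Field K] (a b : K) : sumX a b 0 0 = a := by simp [sumX]

theorem sumY_zero {K : Type*} [Field K] (a b : K) : sumY a b 0 0 = b := by
  simp [sumY]; ring

theorem Rat.cast_sumX {K : Type*} [Field K] [CharZero K] (a b r q : ℚ) :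
    ((sumX a b r q : ℚ) : K) = sumX (a : K) b r q := by
  simp only [sumX]; push_cast; rfl

theorem Rat.cast_sumY {K : Type*} [Field K] [CharZero K] (a b r q : ℚ) :
    ((sumY a b r q : ℚ) : K) = sumY (a : K) b r q := by
  simp only [sumY]; push_cast; rfl

theorem continuousAt_sumX {K : Type*} [NormedField K] (a b : K) :
    ContinuousAt (fun z : K × K => sumX a b z.1 z.2) (0, 0) := by
  unfold sumX
  refine continuousAt_const.add (ContinuousAt.div (by fun_prop) (by fun_prop) (by simp))

theorem continuousAt_sumY {K : Type*} [NormedField K] (a b : K) :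
    ContinuousAt (fun z : K × K => sumY a b z.1 z.2) (0, 0) := by
  unfold sumY
  refine continuousAt_const.sub (ContinuousAt.div (by fun_prop) (by fun_prop) (by simp))

/-- Adding a point near the origin changes `w` only a little. -/
theorem exists_near {K : Type*} [NormedField K] [CharZero K] {a b : ℚ} (hb : b ≠ 4) {ε : ℝ}
    (hε : 0 < ε) : ∃ η : ℝ, 0 < η ∧ ∀ r q : ℚ, ‖(r : K)‖ < η → ‖(q : K)‖ < η →
      sumY a b r q ≠ 4 ∧
      ‖((2 * (sumX a b r q + 1) / (sumY a b r q - 4) - 2 * (a + 1) / (b - 4) : ℚ) : K)‖ < ε := by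
  have hb' : (b : K) - 4 ≠ 0 := by
    rw [sub_ne_zero]; exact_mod_cast hb
  have hcX := continuousAt_sumX (a : K) b
  have hcY := continuousAt_sumY (a : K) b
  have hc : ContinuousAt (fun z : K × K => 2 * (sumX (a : K) b z.1 z.2 + 1) /
      (sumY (a : K) b z.1 z.2 - 4)) (0, 0) :=
    ((hcX.add continuousAt_const).const_mul 2).div (hcY.sub continuousAt_const) (by
      simpa only [sumY_zero] using hb')
  have h1 := hcY.eventually_ne (y := (4 : K)) (by
    simpa only [sumY_zero] using sub_ne_zero.1 hb')
  have h2 := Metric.continuousAt_iff'.1 hc ε hε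
  obtain ⟨η, hη, H⟩ := Metric.eventually_nhds_iff.1 (h1.and h2)
  refine ⟨η, hη, fun r q hr hq => ?_⟩
  obtain ⟨k1, k2⟩ := H (y := ((r : K), (q : K))) (by
    rw [Prod.dist_eq, dist_zero_right, dist_zero_right]; exact max_lt hr hq)
  refine ⟨fun h => k1 ?_, ?_⟩
  · rw [← Rat.cast_sumY, h]; norm_num
  · rw [dist_eq_norm] at k2
    simp only [sumX_zero, sumY_zero, ← Rat.cast_sumX, ← Rat.cast_sumY] at k2
    push_cast
    exact k2

/-- With r = 1/x and q = y/x² the curve reads q² = r(1 - r - 9r² + 9r³), so smallness of r implies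
that of q. The bound 20 = 1 + 1 + 9 + 9 uses only the triangle inequality, hence is valid in both ℝ
and ℚ₂. -/
theorem exists_near_of_equation {K : Type*} [NormedField K] [CharZero K] {a b : ℚ} (hb : b ≠ 4)
    {ε : ℝ} (hε : 0 < ε) : ∃ η : ℝ, 0 < η ∧ ∀ x y : ℚ, x ≠ 0 →
      y ^ 2 = (x - 1) * (x - 3) * (x + 3) → ‖((1 / x : ℚ) : K)‖ < η →
      sumY a b (1 / x) (y / x ^ 2) ≠ 4 ∧
      ‖((2 * (sumX a b (1 / x) (y / x ^ 2) + 1) / (sumY a b (1 / x) (y / x ^ 2) - 4) -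
        2 * (a + 1) / (b - 4) : ℚ) : K)‖ < ε := by
  obtain ⟨η, hη, H⟩ := exists_near (K := K) (a := a) hb hε
  refine ⟨min (min 1 η) (η ^ 2 / 20), by positivity, fun x y hx hE hr => ?_⟩
  rw [lt_min_iff, lt_min_iff] at hr
  refine H _ _ hr.1.2 ?_
  have e : (y / x ^ 2) ^ 2 =
      1 / x * (1 - 1 / x - 9 * (1 / x * (1 / x)) + 9 * (1 / x * (1 / x) * (1 / x))) := by
    rw [div_pow, hE]; field_simp; ring
  generalize 1 / x = r at *
  generalize y / x ^ 2 = q at *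
  obtain ⟨⟨hr1, -⟩, hr2⟩ := hr
  have e' : (q : K) ^ 2 = r * (1 - r - 9 * (r * r) + 9 * (r * r * r)) := by
    exact_mod_cast congrArg (Rat.cast : ℚ → K) e
  have h9 : ‖(9 : K)‖ ≤ 9 := by
    have := Nat.norm_cast_le (α := K) 9
    simpa using this
  have hrr : ‖(r : K) * r‖ ≤ 1 := by
    rw [norm_mul]; nlinarith [norm_nonneg (r : K)]
  have hrrr : ‖(r : K) * r * r‖ ≤ 1 := by
    rw [norm_mul]; nlinarith [norm_nonneg (r : K), norm_nonneg ((r : K) * r)]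
  have hbr : ‖(1 - r - 9 * (r * r) + 9 * (r * r * r) : K)‖ ≤ 20 := by
    have a1 : ‖(9 * (r * r) : K)‖ ≤ 9 := by
      rw [norm_mul]; nlinarith [norm_nonneg ((r : K) * r), norm_nonneg (9 : K)]
    have a2 : ‖(9 * (r * r * r) : K)‖ ≤ 9 := by
      rw [norm_mul]; nlinarith [norm_nonneg ((r : K) * r * r), norm_nonneg (9 : K)]
    calc _ ≤ ‖(1 - r - 9 * (r * r) : K)‖ + ‖(9 * (r * r * r) : K)‖ := norm_add_le _ _
      _ ≤ ‖(1 - r : K)‖ + ‖(9 * (r * r) : K)‖ + ‖(9 * (r * r * r) : K)‖ := by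
        gcongr; exact norm_sub_le _ _
      _ ≤ (‖(1 : K)‖ + ‖(r : K)‖) + 9 + 9 := by
        gcongr; exact norm_sub_le _ _
      _ ≤ 20 := by rw [norm_one]; linarith
  have hq2 : ‖(q : K)‖ ^ 2 < η ^ 2 := by
    rw [← norm_pow, e', norm_mul]
    nlinarith [norm_nonneg (r : K)]
  exact lt_of_pow_lt_pow_left₀ 2 hη.le hq2

end Addition

/-! ### Infinitely many j-invariants. -/

section InfiniteFamily

/-- A positive triple with torsion group `ℤ/2 × ℤ/8` arises from every rational point of the quartic
with `0 < w < 1 / 3` and `w` close `2`-adically to `26 / 89`. -/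
theorem fam_of_near {w : ℚ} (hw₀ : 0 < w) (hw₁ : w < 1 / 3) (hδ : ValGE 2 6 (w - 26 / 89))
    (h : IsSquare (quartic w)) : IsPositiveTwoEightTriple (famA w) (famB w) (famC w) := by
  have hc : HasVal 2 1 (26 / 89 : ℚ) :=
    hasVal_of_eq 1 13 89 (by norm_num) (by norm_num) (by norm_num)
  have hw : HasVal 2 1 w := by
    simpa using hc.add_valGE hδ (by norm_num)
  have hw' : HasVal 2 2 (w + 2) := by
    have : HasVal 2 2 (204 / 89 : ℚ) :=
      hasVal_of_eq 2 51 89 (by norm_num) (by norm_num) (by norm_num)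
    have := this.add_valGE hδ (by norm_num)
    rwa [show (204 / 89 : ℚ) + (w - 26 / 89) = w + 2 by ring] at this
  have hu : HasVal 2 0 (1 - w ^ 2) :=
    hasVal_one.sub_valGE ((hw.pow 2).valGE le_rfl) (by norm_num)
  have hv : HasVal 2 3 (w ^ 2 + 2 * w) := by
    rw [show w ^ 2 + 2 * w = w * (w + 2) by ring]
    exact (hw.mul hw').congr (by norm_num)
  have huv := (hu.mul hv).congr (zero_add 3)
  -- The polynomial uv has integral coefficients, so w ≡ 26/89 modulo 2⁶ passes to uv; `i4` is its
  -- difference quotient.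
  have hdiff : ValGE 2 6 ((1 - w ^ 2) * (w ^ 2 + 2 * w) - 7245 * 5304 / 7921 ^ 2) := by
    have i1 : ValGE 2 0 w := hw.valGE (by norm_num)
    have i2 : ValGE 2 0 (26 / 89 : ℚ) := hc.valGE (by norm_num)
    have i3 : ValGE 2 0 (2 : ℚ) := by simpa using valGE_intCast (p := 2) 2
    have i4 := (((i1.add i2).add i3).sub ((i1.add i2).mul ((i1.mul i1).add (i2.mul i2)))).sub
      (i3.mul (((i1.mul i1).add (i1.mul i2)).add (i2.mul i2)))
    have := (hδ.mul i4).congr (add_zero 6)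
    convert this using 1
    ring
  have h8 : HasVal 2 3 (8 : ℚ) :=
    hasVal_of_eq 3 1 1 (by norm_num) (by norm_num) (by norm_num)
  have hdiff8 : ValGE 2 3 ((1 - w ^ 2) * (w ^ 2 + 2 * w) / 8 - 7245 * 663 / 7921 ^ 2) := by
    have := (hdiff.mul (h8.inv.valGE le_rfl)).congr (show (6 + -3 : ℤ) = 3 by norm_num)
    convert this using 1
    ring
  have hodd : ∀ z x : ℚ, HasVal 2 3 x → x ≠ z * z := by
    intro z x hx e
    have hz : z ≠ 0 := by rintro rfl; exact hx.1 (by rw [e, zero_mul])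
    obtain ⟨n, hn⟩ := exists_hasVal 2 hz
    have := hx.unique (e ▸ hn.mul hn)
    omega
  have heven : ∀ z x : ℚ, HasVal 2 4 x → x = z * z → ValGE 2 3 (x / 16 - 1) := by
    intro z x hx e
    have hz : z ≠ 0 := by rintro rfl; exact hx.1 (by rw [e, zero_mul])
    obtain ⟨n, hn⟩ := exists_hasVal 2 hz
    have := hx.unique (e ▸ hn.mul hn)
    have h4 : HasVal 2 2 (4 : ℚ) :=
      hasVal_of_eq 2 1 1 (by norm_num) (by norm_num) (by norm_num)
    have := ((hn.div h4).congr (show n - 2 = 0 by omega)).sq_sub_one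
    rw [e]
    convert this using 1
    ring
  have h2uv : HasVal 2 4 (2 * ((1 - w ^ 2) * (w ^ 2 + 2 * w))) := by
    simpa using (hasVal_self (p := 2)).mul huv
  have hq : 2 * w + 2 * w ^ 2 - 1 < 0 := by nlinarith
  have hw1 : w - 1 < 0 := by linarith
  have key := fam_isPositiveTwoEightTriple (w := w) (ε := 1) hw₀.ne' (by linarith) (by linarith)
    (by linarith) h (Or.inl rfl) ?_ ?_ ?_
    (fun P hP => hP.eq_zero_of_three hu hv) ?_ ?_ ?_ ?_
  · simpa only [one_mul] using key
  · rw [one_mul, famA]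
    have : 0 < w * (2 * w + 2 * w ^ 2 - 1) * (2 + w) * (w - 1) * (w + 1) := by
      have := mul_pos_of_neg_of_neg hq hw1
      have : 0 < (2 * w + 2 * w ^ 2 - 1) * (w - 1) * (w * (2 + w) * (w + 1)) := by positivity
      linarith
    positivity
  · rw [one_mul, famB, ← div_neg]
    have hw2 := sq_pos_of_neg hw1
    have : 0 < -((2 + w) * (2 * w + 2 * w ^ 2 - 1) * w) := by
      have : 0 < (2 + w) * w * -(2 * w + 2 * w ^ 2 - 1) :=
        mul_pos (by positivity) (neg_pos.2 hq)
      linarith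
    positivity
  · rw [one_mul, famC]
    have := mul_pos_of_neg_of_neg hq hw1
    positivity
  -- Here 2uv/16 = uv/8 is congruent to 7245 · 663/7921² ≡ 3 modulo 8, which is neither 1 nor -1.
  -- The last two cases use that v₂(uv) = 3 is odd.
  · rintro ⟨z, hz⟩
    have := (heven z _ h2uv hz).sub hdiff8
    have hcon : HasVal 2 1 (7245 * 663 / 7921 ^ 2 - 1 : ℚ) :=
      hasVal_of_eq 1 (-28969403) (7921 ^ 2) (by norm_num) (by norm_num) (by norm_num)
    refine hcon.not_valGE (by norm_num) (n := 3) ?_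
    convert this using 1
    ring
  · rintro ⟨z, hz⟩
    have := ((heven z _ h2uv.neg hz).add hdiff8).neg
    have hcon : HasVal 2 2 (7245 * 663 / 7921 ^ 2 + 1 : ℚ) :=
      hasVal_of_eq 2 16886419 (7921 ^ 2) (by norm_num) (by norm_num) (by norm_num)
    refine hcon.not_valGE (by norm_num) (n := 3) ?_
    convert this using 1
    ring
  · rintro ⟨z, hz⟩
    exact hodd z _ huv hz
  · rintro ⟨z, hz⟩
    exact hodd z _ huv.neg hz

theorem auxCurve_pointVal_two_pow_smul {T : auxCurve.toAffine.Point} (hT : ¬ IsOfFinAddOrder T)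
    (j : ℕ) : ∃ n : ℤ, n ≤ -2 - 2 * j ∧ PointVal 2 1 n (2 ^ (j + 1) • T) := by
  induction j with
  | zero =>
    obtain ⟨n, hn, H⟩ := auxCurve_pointVal_two_smul T fun h =>
      hT (isOfFinAddOrder_iff_nsmul_eq_zero.2 ⟨2, two_pos, h⟩)
    exact ⟨n, by simpa using hn, by simpa using H⟩
  | succ j ih =>
    obtain ⟨n, hn, H⟩ := ih
    refine ⟨n - 2, by push_cast; omega, ?_⟩
    rw [pow_succ, mul_nsmul]
    exact auxCurve_pointVal_two_smul_of_neg _ _ (by omega) H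

theorem not_isOfFinAddOrder_nsmul {G : Type*} [AddCommGroup G] {P : G}
    (hP : ¬ IsOfFinAddOrder P) {k : ℕ} (hk : 0 < k) : ¬ IsOfFinAddOrder (k • P) := by
  rw [isOfFinAddOrder_iff_nsmul_eq_zero] at hP ⊢
  rintro ⟨n, hn, h⟩
  exact hP ⟨k * n, by positivity, by rw [mul_nsmul, h]⟩

/-- High powers of 2 bring multiples of P close to the origin 2-adically, and
`auxCurve_exists_large` then finds multiples that are close in ℝ too. The distances 1/100 and 1/64 =
2⁻⁶ keep w inside (0, 1/3) and in the required 2-adic class. -/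
theorem exists_wCoord_near (k : ℕ) : ∃ n, k ≤ n ∧ 0 < wCoord (n • auxP) ∧
    wCoord (n • auxP) < 1 / 3 ∧ ValGE 2 6 (wCoord (n • auxP) - 26 / 89) := by
  obtain ⟨η₁, hη₁, H₁⟩ := exists_near_of_equation (K := ℝ) (a := -360 / 169)
    (b := -8211 / 2197) (by norm_num) (ε := 1 / 100) (by norm_num)
  obtain ⟨η₂, hη₂, H₂⟩ := exists_near_of_equation (K := ℚ_[2]) (a := -360 / 169)
    (b := -8211 / 2197) (by norm_num) (ε := 1 / 64) (by norm_num)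
  obtain ⟨j, hj⟩ := exists_pow_lt_of_lt_one hη₂ (show (1 / 2 : ℝ) < 1 by norm_num)
  obtain ⟨B, hB⟩ := exists_nat_gt (1 / η₁)
  have hT := not_isOfFinAddOrder_nsmul auxP_not_isOfFinAddOrder k.succ_pos
  obtain ⟨m, hm, x, y, hp, e, hx⟩ := auxCurve_exists_large
    (not_isOfFinAddOrder_nsmul hT (show 0 < 2 ^ (j + 1) by positivity)) (B : ℚ)
  have hx0 : 0 < x := lt_of_le_of_lt (Nat.cast_nonneg B) hx
  obtain ⟨n, hn, x', y', hp', e', hval⟩ :=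
    auxCurve_pointVal_two_pow_smul (not_isOfFinAddOrder_nsmul hT hm) j
  rw [← mul_nsmul, mul_comm, mul_nsmul, e] at e'
  obtain ⟨rfl, rfl⟩ := Point.some.inj e'
  have hvx : HasVal 2 n x := by
    have := hval.add_valGE (hasVal_one.valGE le_rfl) (show n < 0 by omega)
    rwa [sub_add_cancel] at this
  have hE := auxCurve_equation hp
  obtain ⟨k₁, k₂⟩ := H₁ x y hx0.ne' hE (by
    have h1 : (0 : ℝ) < x := by exact_mod_cast hx0
    have h2 : (B : ℝ) < x := by exact_mod_cast hx
    rw [Real.norm_eq_abs, Rat.cast_div, Rat.cast_one, abs_of_pos (by positivity),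
      div_lt_comm₀ h1 hη₁]
    linarith)
  obtain ⟨-, k₃⟩ := H₂ x y hx0.ne' hE (by
    refine lt_of_le_of_lt ?_ hj
    rw [Padic.eq_padicNorm, padicNorm.eq_zpow_of_nonzero (by positivity), one_div,
      hvx.inv.2, neg_neg, one_div, inv_pow, ← zpow_natCast, ← zpow_neg]
    push_cast
    exact zpow_le_zpow_right₀ (by norm_num) (by omega))
  obtain ⟨h₃, e₃⟩ := three_smul_auxP
  obtain ⟨h₄, e₄⟩ := auxCurve_add_eq h₃ hp hx0.ne' (by linarith)
  refine ⟨3 + (k + 1) * 2 ^ (j + 1) * m, ?_, ?_⟩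
  · nlinarith [Nat.one_le_two_pow (n := j + 1), Nat.mul_le_mul (Nat.one_le_two_pow (n := j + 1)) hm]
  have hsum : (3 + (k + 1) * 2 ^ (j + 1) * m) • auxP = Point.some _ _ h₄ := by
    rw [add_nsmul, mul_nsmul, mul_nsmul, e, e₃, e₄]
  have hw : wCoord ((3 + (k + 1) * 2 ^ (j + 1) * m) • auxP) =
      2 * (sumX (-360 / 169) (-8211 / 2197) (1 / x) (y / x ^ 2) + 1) /
        (sumY (-360 / 169) (-8211 / 2197) (1 / x) (y / x ^ 2) - 4) := by
    rw [hsum]; exact if_neg k₁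
  rw [← hw, show 2 * ((-360 / 169 : ℚ) + 1) / (-8211 / 2197 - 4) = 26 / 89 by norm_num] at k₂ k₃
  generalize wCoord ((3 + (k + 1) * 2 ^ (j + 1) * m) • auxP) = w at *
  have k₄ : |w - 26 / 89| < 1 / 100 := by
    rw [Real.norm_eq_abs] at k₂
    have : ((|w - 26 / 89| : ℚ) : ℝ) < ((1 / 100 : ℚ) : ℝ) := by push_cast at k₂ ⊢; exact k₂
    exact_mod_cast this
  rw [abs_lt] at k₄
  refine ⟨by linarith, by linarith, ?_⟩
  by_cases h0 : w - 26 / 89 = 0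
  · exact Or.inl h0
  · refine Or.inr ?_
    rw [Padic.eq_padicNorm, padicNorm.eq_zpow_of_nonzero h0,
      show (1 / 64 : ℝ) = 2 ^ (-6 : ℤ) by norm_num] at k₃
    push_cast at k₃
    have := (zpow_lt_zpow_iff_right₀ (show (1 : ℝ) < 2 by norm_num)).1 k₃
    omega

theorem IsSplit.j_mul {W : WeierstrassCurve ℚ} {e₁ e₂ e₃ : ℚ} (h : IsSplit W e₁ e₂ e₃)
    [W.IsElliptic] : W.j * ((e₁ - e₂) * (e₁ - e₃) * (e₂ - e₃)) ^ 2 =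
      256 * (e₁ ^ 2 + e₂ ^ 2 + e₃ ^ 2 - e₁ * e₂ - e₁ * e₃ - e₂ * e₃) ^ 3 := by
  have h1 : W.j * W.Δ = W.c₄ ^ 3 := by
    rw [WeierstrassCurve.j, mul_right_comm, ← WeierstrassCurve.coe_Δ', Units.inv_mul, one_mul]
  have h2 : W.c₄ = 16 * (e₁ ^ 2 + e₂ ^ 2 + e₃ ^ 2 - e₁ * e₂ - e₁ * e₃ - e₂ * e₃) := by
    simp only [WeierstrassCurve.c₄, WeierstrassCurve.b₂, WeierstrassCurve.b₄, h.a₁, h.a₂, h.a₃,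
      h.a₄]
    ring
  rw [h.disc, h2] at h1
  linear_combination (1 / 16) * h1

/-- The j-invariant depends only on ratios of root differences. Here the differences are those of 0,
-u⁴, -v⁴ scaled by a common κ, which cancels. -/
theorem fam_j_mul {w : ℚ} (h₀ : w ≠ 0) (h₁ : w ≠ 1) (h₂ : w ≠ -1) (h₃ : w ≠ -2) (h₄ : w ≠ -1 / 2)
    [(inducedCurve (famA w) (famB w) (famC w)).IsElliptic] :
    (inducedCurve (famA w) (famB w) (famC w)).j * ((1 - w ^ 2) ^ 8 * (w ^ 2 + 2 * w) ^ 8 *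
      ((w ^ 2 + 2 * w) ^ 4 - (1 - w ^ 2) ^ 4) ^ 2) =
      256 * ((1 - w ^ 2) ^ 8 - (1 - w ^ 2) ^ 4 * (w ^ 2 + 2 * w) ^ 4 + (w ^ 2 + 2 * w) ^ 8) ^ 3 := by
  have hj := (inducedCurve_isSplit (fam_isDiophantineTriple h₀ h₁ h₂ h₃ h₄)).j_mul
  generalize (inducedCurve (famA w) (famB w) (famC w)).j = j at *
  rw [famA_eq, famB_eq, famC_eq] at hj
  have hu := one_sub_sq_ne_zero h₁ h₂
  have hv := sq_add_two_mul_ne_zero h₀ h₃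
  have hd := quadratic_ne_zero w
  have hs := add_ne_zero_of_ne h₄
  generalize w ^ 2 + 2 * w = v at *
  generalize 1 - w ^ 2 = u at *
  have hq : u ^ 2 + u * v + v ^ 2 ≠ 0 := by
    have : 0 < u ^ 2 := by positivity
    nlinarith [sq_nonneg (u + 2 * v), sq_nonneg (2 * u + v)]
  obtain ⟨κ, hκ⟩ : ∃ κ, κ = 4 * (u ^ 2 + u * v + v ^ 2) / (u ^ 2 * v ^ 2 * (v - u) ^ 2) := ⟨_, rfl⟩
  have hκ0 : κ ≠ 0 := by rw [hκ]; positivity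
  obtain ⟨a, ha⟩ : ∃ a, a = -(2 * (u ^ 2 + v ^ 2) * (u + v)) / (u * v * (v - u)) := ⟨_, rfl⟩
  obtain ⟨b, hb⟩ : ∃ b, b = -(2 * u ^ 2) / (v * (v - u)) := ⟨_, rfl⟩
  obtain ⟨c, hc⟩ : ∃ c, c = -(2 * v ^ 2) / (u * (v - u)) := ⟨_, rfl⟩
  rw [← ha, ← hb, ← hc] at hj
  have e₁ : -(b * c) = -(a * b) + u ^ 4 * κ := by rw [ha, hb, hc, hκ]; field_simp; ring
  have e₂ : -(a * c) = -(a * b) + (u ^ 4 - v ^ 4) * κ := by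
    rw [ha, hb, hc, hκ]; field_simp; ring
  rw [e₁, e₂] at hj
  refine mul_left_cancel₀ (pow_ne_zero 6 hκ0) ?_
  linear_combination hj

theorem finite_setOf_sq_eq {K : Type*} [Field K] (c : K) : {s : K | s ^ 2 = c}.Finite := by
  rcases Set.eq_empty_or_nonempty {s : K | s ^ 2 = c} with h | ⟨t, ht⟩
  · rw [h]; exact Set.finite_empty
  · refine (Set.toFinite {t, -t}).subset fun s hs => ?_
    exact sq_eq_sq_iff_eq_or_eq_neg.1 (hs.trans ht.symm)

theorem finite_setOf_wCoord {R : Set ℚ} (hR : R.Finite) :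
    {n : ℕ | wCoord (n • auxP) ∈ R}.Finite := by
  have hA : (⋃ w ∈ R, ({w} ×ˢ {s : ℚ | s ^ 2 = quartic w})).Finite :=
    hR.biUnion fun w _ => (Set.finite_singleton w).prod (finite_setOf_sq_eq _)
  refine (hA.preimage (f := fun n : ℕ => (wCoord (n • auxP), sCoord (n • auxP))) ?_).subset ?_
  · intro m _ n _ h
    obtain ⟨h₁, h₂⟩ := Prod.mk.inj h
    exact injective_nsmul_iff_not_isOfFinAddOrder.2 auxP_not_isOfFinAddOrder
      (coord_injective h₁ h₂)
  · intro n hn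
    simp only [Set.mem_preimage, Set.mem_iUnion]
    exact ⟨_, hn, rfl, sCoord_sq _⟩

/-- The polynomial is non-zero whatever j is: at w = 0 its value is -256. -/
theorem finite_setOf_j (j : ℚ) :
    {w : ℚ | j * ((1 - w ^ 2) ^ 8 * (w ^ 2 + 2 * w) ^ 8 *
      ((w ^ 2 + 2 * w) ^ 4 - (1 - w ^ 2) ^ 4) ^ 2) =
      256 * ((1 - w ^ 2) ^ 8 - (1 - w ^ 2) ^ 4 * (w ^ 2 + 2 * w) ^ 4 +
        (w ^ 2 + 2 * w) ^ 8) ^ 3}.Finite := by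
  open Polynomial in
  let U : ℚ[X] := 1 - X ^ 2
  let V : ℚ[X] := X ^ 2 + 2 * X
  let f : ℚ[X] := C j * (U ^ 8 * V ^ 8 * (V ^ 4 - U ^ 4) ^ 2) -
    256 * (U ^ 8 - U ^ 4 * V ^ 4 + V ^ 8) ^ 3
  have hf : ∀ w, f.eval w = j * ((1 - w ^ 2) ^ 8 * (w ^ 2 + 2 * w) ^ 8 *
      ((w ^ 2 + 2 * w) ^ 4 - (1 - w ^ 2) ^ 4) ^ 2) -
      256 * ((1 - w ^ 2) ^ 8 - (1 - w ^ 2) ^ 4 * (w ^ 2 + 2 * w) ^ 4 +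
        (w ^ 2 + 2 * w) ^ 8) ^ 3 := by
    intro w
    simp [f, U, V]
  have hf0 : f ≠ 0 := by
    intro h
    have := hf 0
    rw [h] at this
    norm_num at this
  refine (Polynomial.finite_setOfPred_isRoot hf0).subset fun w hw => ?_
  rw [Set.mem_ofPred_eq, Polynomial.IsRoot, hf]
  exact sub_eq_zero.2 hw

/-- Finitely many j would allow finitely many w, hence finitely many n, contrary to
`exists_wCoord_near`. -/
theorem infinite_setOf_j : {j : ℚ | ∃ n : ℕ, ∃ a b c : ℚ,
      a = famA (wCoord (n • auxP)) ∧ b = famB (wCoord (n • auxP)) ∧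
      c = famC (wCoord (n • auxP)) ∧ IsPositiveTwoEightTriple a b c ∧
      ∃ _ : (inducedCurve a b c).IsElliptic, (inducedCurve a b c).j = j}.Infinite := by
  intro hfin
  have hfin' := hfin.biUnion fun j _ => finite_setOf_wCoord (finite_setOf_j j)
  obtain ⟨k, hk⟩ := hfin'.bddAbove
  obtain ⟨n, hn, hw₀, hw₁, hδ⟩ := exists_wCoord_near (k + 1)
  have hsq : IsSquare (quartic (wCoord (n • auxP))) := ⟨sCoord (n • auxP), by rw [← sCoord_sq, sq]⟩
  have H := fam_of_near hw₀ hw₁ hδ hsq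
  have := inducedCurve_isElliptic H.triple
  have hmem := hk (a := n) (by
    simp only [Set.mem_iUnion]
    exact ⟨_, ⟨n, _, _, _, rfl, rfl, rfl, H, this, rfl⟩,
      fam_j_mul hw₀.ne' (by linarith) (by linarith) (by linarith) (by linarith)⟩)
  omega

end InfiniteFamily

theorem mainTheorem6 :
    -- the explicit triple: positive, torsion `ℤ/2 × ℤ/8`, rank exactly one
    (IsPositiveTwoEightTriple
        (37471518967 / 1381254420) (5832225 / 571948) (6251648 / 1562505) ∧
      rationalRank (inducedCurve
        (37471518967 / 1381254420) (5832225 / 571948) (6251648 / 1562505)) = 1) ∧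
    -- `Y² = X³ - X² - 9 X + 9` is an elliptic curve of rank one with generator `P = (0, 3)`
    (auxCurve.IsElliptic ∧ rationalRank auxCurve = 1 ∧
      ∀ Q : auxCurve.toAffine.Point, ∃ n : ℤ, IsOfFinAddOrder (Q - n • auxP)) ∧
    -- its rational points correspond to those of the quartic `s² = 2 w⁴ + 4 w³ + 2 w² + 1`
    Set.BijOn (fun Q : auxCurve.toAffine.Point => (wCoord Q, sCoord Q)) Set.univ
      {p : ℚ × ℚ | p.2 ^ 2 = quartic p.1} ∧
    -- the explicit triple is obtained from `3P`
    (∃ h : auxCurve.toAffine.Nonsingular (-360 / 169) (-8211 / 2197),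
      3 • auxP = WeierstrassCurve.Affine.Point.some (-360 / 169) (-8211 / 2197) h) ∧
    wCoord (3 • auxP) = 26 / 89 ∧
    famA (26 / 89) = 37471518967 / 1381254420 ∧
    famB (26 / 89) = 5832225 / 571948 ∧
    famC (26 / 89) = 6251648 / 1562505 ∧
    -- the family consists of Diophantine triples
    (∀ w : ℚ, w ≠ 0 → w ≠ 1 → w ≠ -1 → w ≠ -2 → w ≠ -1 / 2 →
      IsDiophantineTriple (famA w) (famB w) (famC w)) ∧
    -- the points of the quartic give curves whose torsion group contains `ℤ/2 × ℤ/8`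
    (∀ w : ℚ, w ≠ 0 → w ≠ 1 → w ≠ -1 → w ≠ -2 → IsSquare (quartic w) →
      ∃ f : ZMod 2 × ZMod 8 →+ (inducedCurve (famA w) (famB w) (famC w)).toAffine.Point,
        Function.Injective f) ∧
    -- `3P`, `5P`, `8P` give positive triples, up to changing all three signs
    (∀ n : ℕ, n = 3 ∨ n = 5 ∨ n = 8 →
      ∃ ε : ℚ, (ε = 1 ∨ ε = -1) ∧
        IsPositiveTwoEightTriple (ε * famA (wCoord (n • auxP))) (ε * famB (wCoord (n • auxP)))
          (ε * famC (wCoord (n • auxP)))) ∧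
    -- infinitely many curves, even up to isomorphism over an algebraic closure, arise in this way
    -- from multiples of `P` and positive triples
    {j : ℚ | ∃ n : ℕ, ∃ a b c : ℚ,
      a = famA (wCoord (n • auxP)) ∧ b = famB (wCoord (n • auxP)) ∧
      c = famC (wCoord (n • auxP)) ∧ IsPositiveTwoEightTriple a b c ∧
      ∃ _ : (inducedCurve a b c).IsElliptic, (inducedCurve a b c).j = j}.Infinite := by

  have hA : famA (26 / 89) = 37471518967 / 1381254420 := by norm_num [famA]
  have hB : famB (26 / 89) = 5832225 / 571948 := by norm_num [famB]
  have hC : famC (26 / 89) = 6251648 / 1562505 := by norm_num [famC]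
  refine ⟨⟨?_, ?_⟩, ⟨auxCurve_isSplit.isElliptic, auxCurve_rank, auxCurve_generator⟩, coord_bijOn,
    three_smul_auxP, wCoord_three, hA, hB, hC, fun w => fam_isDiophantineTriple,
    fun w => fam_exists_hom, ?_, infinite_setOf_j⟩
  · simpa only [one_mul, hA, hB, hC] using fam_three
  · simpa only [hA, hB, hC] using explicit_rank
  · rintro n (rfl | rfl | rfl)
    · exact ⟨1, Or.inl rfl, wCoord_three ▸ fam_three⟩
    · exact ⟨-1, Or.inr rfl, wCoord_five ▸ fam_five⟩
    · exact ⟨-1, Or.inr rfl, wCoord_eight ▸ fam_eight⟩
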